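/- **Lemma 3 (energy estimate).** Let $d\in\{1,2,3\}$, $\mathbb T^d=(0,\pi)^d$, let $\bar W=[\bar U,\bar V]\in\mathbb R^2$ and $\eta>0$, and let $D_1,D_2,f,g:\mathbb R^2\to\mathbb R$ be of class $C^2$ near the disc $\{|z-\bar W|\le\eta\}$ with $f(\bar W)=g(\bar W)=0$. Write $\bar D_i=D_i(\bar W)$, and $\bar f_u,\bar f_v,\bar g_u,\bar g_v$ for the partial derivatives of $f$ and $g$ at $\bar W$; assume $\bar D_1,\bar D_2>0$, $\bar f_u>0$ and $\bar g_v<0$. Let $\mathbf w=[u,v]$ be a solution on $[0,T)$ of $$u_t=\nabla\cdot\big(D_1(\mathbf w+\bar W)\nabla u\big)+f(\mathbf w+\bar W),\qquad v_t=\nabla\cdot\big(D_2(\mathbf w+\bar W)\nabla v\big)+g(\mathbf w+\bar W)$$ in $\mathbb T^d$ with the Neumann conditions $\partial u/\partial x_i=\partial v/\partial x_i=0$ at $x_i=0,\pi$, that is, a weak solution in the class $C([0,T);H^2(\mathbb T^d))\cap L^2_{\rm loc}([0,T);H^3(\mathbb T^d))$ that satisfies these conditions at every time. Put $$C_\eta=\max_{|w|\le\eta}\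 \sum_{h\in\{D_1,D_2,f,g\}}\ \sum_{k=0}^{2}|\nabla^kh(\bar W+w)|,$$ where $|\nabla^kh|$ is the operator norm of the $k$-th derivative, and $$C_2=\frac{1}{\bar D_1^2}\left(\frac{(\bar f_v+\bar g_u)^2}{2|\bar g_v|}+\bar f_u\right)^3 .$$ Then there is a universal constant $C_0>0$ such that, with $C_1=C_0C_\eta(1+\eta)$, for almost every $t\in(0,T)$ with $\|\mathbf w(t)\|_{H^2}\le\eta$ the derivative below exists and $$\frac12\frac{d}{dt}\sum_{|\partial|=2}\int_{\mathbb T^d}\{|\partial u|^2+|\partial v|^2\}\,dx+\sum_{|\partial|=2}\int_{\mathbb T^d}\Big\{\frac{\bar D_1}{2}|\nabla\partial u|^2+\bar D_2|\nabla\partial v|^2\Big\}dx+\frac{|\bar g_v|}{2}\sum_{|\partial|=2}\int_{\mathbb T^d}|\partial v|^2dx$$ $$\le\ C_0C_1\|\mathbf w\|_{H^2}\|\nabla^3\mathbf w\|^2+C_2\|u\|^2 .$$ Moreover the energy $t\mapsto\sum_{|\partial|=2}\int_{\mathbb T^d}\{|\partial u|^2+|\partial v|^2\}dx$ is absolutely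 continuous on every interval $[a,b]\subset[0,T)$ on which $\|\mathbf w(t)\|_{H^2}\le\eta$. Here $\|\cdot\|$ is the norm of $L^2(\mathbb T^d)$, $\partial$ runs over the partial derivatives of order two (each counted once), $\|\mathbf w\|_{H^2}^2=\sum_{|\alpha|\le2}(\|\partial^\alpha u\|^2+\|\partial^\alpha v\|^2)$, $\|\nabla^3\mathbf w\|^2$ is the sum over all $i,j,k$ of $\|\partial_i\partial_j\partial_ku\|^2+\|\partial_i\partial_j\partial_kv\|^2$, and $C_0$ depends on nothing: not on $d$, $D_1,D_2,f,g,\bar W,\eta,T$ or the solution. -/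

import Mathlib

open MeasureTheory Set Filter Topology
open scoped ContDiff

noncomputable section

namespace Turing

/-- Points of the spatial domain `ℝ^d`. -/
abbrev Pt (d : ℕ) := Fin d → ℝ

/-- The plane of pairs `[u, v]` of concentrations, with its Euclidean norm. -/
abbrev Plane := EuclideanSpace ℝ (Fin 2)

/-- The open box `(0, π)^d`. -/
def box (d : ℕ) : Set (Pt d) := Set.pi Set.univ (fun _ => Set.Ioo 0 Real.pi)

/-- Lebesgue measure on the box. -/
def boxMeasure (d : ℕ) : Measure (Pt d) := volume.restrict (box d)

/-- The classical partial derivative (used on smooth test functions only). -/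
def classicalPartial {d : ℕ} (i : Fin d) (φ : Pt d → ℝ) (x : Pt d) : ℝ :=
  fderiv ℝ φ x (Pi.single i 1)

/-- `g ∈ L²((0, π)^d)` is the weak derivative of `f` in the direction `x_i`. -/
def IsWeakPartial {d : ℕ} (i : Fin d) (f g : Pt d → ℝ) : Prop :=
  MemLp g 2 (boxMeasure d) ∧
    ∀ φ : Pt d → ℝ, ContDiff ℝ ∞ φ → HasCompactSupport φ → tsupport φ ⊆ box d →
      ∫ x, f x * classicalPartial i φ x ∂(boxMeasure d) = -∫ x, g x * φ x ∂(boxMeasure d)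

open Classical in
/-- The weak derivative `∂_i f ∈ L²((0, π)^d)`, unique up to null sets
(`0` if there is none). -/
def weakPartial {d : ℕ} (i : Fin d) (f : Pt d → ℝ) : Pt d → ℝ :=
  if h : ∃ g, IsWeakPartial i f g then h.choose else 0

/-- Membership in the Sobolev space `H^k((0, π)^d)`. -/
def InH {d : ℕ} : ℕ → (Pt d → ℝ) → Prop
  | 0, f => MemLp f 2 (boxMeasure d)
  | k + 1, f => MemLp f 2 (boxMeasure d) ∧
      ∀ i : Fin d, (∃ g, IsWeakPartial i f g) ∧ InH k (weakPartial i f)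

/-- `‖f‖²` in `L²((0, π)^d)`. -/
def l2Sq {d : ℕ} (f : Pt d → ℝ) : ℝ := ∫ x, f x ^ 2 ∂(boxMeasure d)

/-- `∑_{|∂| = 2} ‖∂f‖²`, each second-order derivative `∂ = ∂_i ∂_j`, `i ≤ j`, counted once. -/
def secondSq {d : ℕ} (f : Pt d → ℝ) : ℝ :=
  ∑ i : Fin d, ∑ j ∈ Finset.Ici i, l2Sq (weakPartial i (weakPartial j f))

/-- `∑_{|∂| = 2} ‖∇∂f‖²`. -/
def gradSecondSq {d : ℕ} (f : Pt d → ℝ) : ℝ :=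
  ∑ i : Fin d, ∑ j ∈ Finset.Ici i, ∑ k : Fin d,
    l2Sq (weakPartial k (weakPartial i (weakPartial j f)))

/-- `‖∇³f‖²`, the squared `L²` norm of the full tensor of third derivatives. -/
def thirdSq {d : ℕ} (f : Pt d → ℝ) : ℝ :=
  ∑ i : Fin d, ∑ j : Fin d, ∑ k : Fin d,
    l2Sq (weakPartial k (weakPartial i (weakPartial j f)))

/-- `‖f‖²` in `H²((0, π)^d)`, that is `∑_{|α| ≤ 2} ‖∂^α f‖²`. -/
def h2Sq {d : ℕ} (f : Pt d → ℝ) : ℝ :=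
  l2Sq f + ∑ i : Fin d, l2Sq (weakPartial i f) + secondSq f

/-- The norm of the pair `[u, v]` in `H²((0, π)^d)`. -/
def h2Norm {d : ℕ} (u v : Pt d → ℝ) : ℝ := Real.sqrt (h2Sq u + h2Sq v)

/-- The Neumann condition `∂f/∂x_i = 0` at `x_i = 0, π` for `f ∈ H²((0, π)^d)`. The traces of
`∂_i f` vanish on these two faces exactly if integrating by parts in `x_i` against functions
that are smooth up to the boundary leaves no boundary term. -/
def Neumann {d : ℕ} (f : Pt d → ℝ) : Prop :=
  ∀ (i : Fin d) (φ : Pt d → ℝ), ContDiff ℝ ∞ φ →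
    ∫ x, weakPartial i f x * classicalPartial i φ x ∂(boxMeasure d) =
      -∫ x, weakPartial i (weakPartial i f) x * φ x ∂(boxMeasure d)

/-- Weak form on `[0, T)` of `∂z/∂t = ∇·(D(w + W̄) ∇z) + h(w + W̄)`, `w = [u, v]`, with no flux
through the boundary, for one component `z` of `w`. -/
def WeakEquation {d : ℕ} (D h : Plane → ℝ) (Wbar : Plane) (T : ℝ)
    (u v z : ℝ → Pt d → ℝ) : Prop :=
  ∀ φ : Pt d → ℝ, ContDiff ℝ ∞ φ → ∀ s t : ℝ, 0 ≤ s → s ≤ t → t < T →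
    ∫ x, z t x * φ x ∂(boxMeasure d) - ∫ x, z s x * φ x ∂(boxMeasure d) =
      ∫ τ in s..t, ∫ x,
        (-(D (!₂[u τ x, v τ x] + Wbar) *
            ∑ i : Fin d, weakPartial i (z τ) x * classicalPartial i φ x) +
          h (!₂[u τ x, v τ x] + Wbar) * φ x) ∂(boxMeasure d)

/-- One component of a solution has the regularity `C([0, T); H²) ∩ L²_loc([0, T); H³)` and
satisfies the Neumann boundary condition. -/
structure IsRegular {d : ℕ} (T : ℝ) (z : ℝ → Pt d → ℝ) : Prop where
  inH2 : ∀ t ∈ Ico 0 T, InH 2 (z t)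
  neumann : ∀ t ∈ Ico 0 T, Neumann (z t)
  continuous : ∀ s ∈ Ico 0 T,
    Tendsto (fun t => h2Sq (fun x => z t x - z s x)) (𝓝[Ico 0 T] s) (𝓝 0)
  inH3 : ∀ᵐ t ∂(volume.restrict (Ioo 0 T)), InH 3 (z t)
  integrable : ∀ b ∈ Ioo 0 T, IntegrableOn (fun t => thirdSq (z t)) (Ioo 0 b)

/-- `[u, v]` is a solution on `[0, T)` of the full reaction-diffusion system
`u_t = ∇·(D₁(w + W̄)∇u) + f(w + W̄)`, `v_t = ∇·(D₂(w + W̄)∇v) + g(w + W̄)`, `w = [u, v]`,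
in the box `(0, π)^d` with Neumann boundary conditions. -/
structure IsSolution {d : ℕ} (D₁ D₂ f g : Plane → ℝ) (Wbar : Plane) (T : ℝ)
    (u v : ℝ → Pt d → ℝ) : Prop where
  regular_u : IsRegular T u
  regular_v : IsRegular T v
  equation_u : WeakEquation D₁ f Wbar T u v u
  equation_v : WeakEquation D₂ g Wbar T u v v

/-- The partial derivative `∂h/∂u` of a function of `[u, v]`. -/
def derivU (h : Plane → ℝ) (z : Plane) : ℝ := fderiv ℝ h z (EuclideanSpace.single 0 1)

/-- The partial derivative `∂h/∂v` of a function of `[u, v]`. -/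
def derivV (h : Plane → ℝ) (z : Plane) : ℝ := fderiv ℝ h z (EuclideanSpace.single 1 1)

/-- The sum of the norms of `h` and its derivatives of order one and two at the point `z`. -/
def c2At (h : Plane → ℝ) (z : Plane) : ℝ := ∑ k ∈ Finset.range 3, ‖iteratedFDeriv ℝ k h z‖

/-- The constant `C_η`: the maximum over `|w| ≤ η` of the sum of the `C²` norms of
`D₁, D₂, f, g` at `W̄ + w`. -/
def cEta (D₁ D₂ f g : Plane → ℝ) (Wbar : Plane) (η : ℝ) : ℝ :=
  sSup ((fun w => c2At D₁ (Wbar + w) + c2At D₂ (Wbar + w) + c2At f (Wbar + w) +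
    c2At g (Wbar + w)) '' Metric.closedBall 0 η)

/-- The constant `C₂ = ((f̄_v + ḡ_u)² / (2|ḡ_v|) + f̄_u)³ / D̄₁²`. -/
def cTwo (D₁ f g : Plane → ℝ) (Wbar : Plane) : ℝ :=
  ((derivV f Wbar + derivU g Wbar) ^ 2 / (2 * |derivV g Wbar|) + derivU f Wbar) ^ 3 /
    D₁ Wbar ^ 2

/-- The second-order energy `∑_{|∂| = 2} ∫ (|∂u|² + |∂v|²)` at time `t`. -/
def energy {d : ℕ} (u v : ℝ → Pt d → ℝ) (t : ℝ) : ℝ := secondSq (u t) + secondSq (v t)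

end Turing

end

/-!
On the box `(0, π)^d` with Neumann conditions the cosines `trig ∅ k`, `k ∈ ℕ^d`, diagonalize the
problem. If `a_k` and `b_k` are the cosine coefficients of `u` and `v`, `s = |k|²`, and
`Λ = ∑_{i ≤ j} (k_i k_j)²`, then `secondSq u = ∑ Λ a_k²`, `gradSecondSq u = ∑ s Λ a_k²` and
`thirdSq u = ∑ s³ a_k²`. Testing the equation with `trig ∅ k` turns it into a system of ordinary
differential equations
`a_k' = -D̄₁ s a_k + f̄_u a_k + f̄_v b_k + ρ_k`, and likewise for `b_k` (`modeRate_eq`), where the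
remainder `ρ_k` collects what is superlinear in `w`. The energy `∑ Λ (a_k² + b_k²)` is then
differentiated mode by mode.

The inequality has two sources. In the linear part, the cross term `Λ (f̄_v + ḡ_u) a_k b_k` is split
by Young's inequality, which leaves `A Λ a_k²` with `A = (f̄_v + ḡ_u)² / (2|ḡ_v|) + f̄_u`. Since
`Λ ≤ s²`, it is at most
`(D̄₁ / 2) s Λ a_k² + (A³ / D̄₁²) a_k²` (`mul_le_half_diffusion`), and `A³ / D̄₁²` is the constant
`C₂`. For the remainder one needs `∑ Λ |a_k| |ρ_k| ≤ C C_η (1 + ‖w‖_{H²}) ‖w‖_{H²} ‖∇³w‖²`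
(`sum_freqQuad_mul_abs_remainder_le`). By Cauchy–Schwarz this is a bound for the second derivatives
of the flux `(D(w + W̄) - D̄) ∂_i u` and for the first derivatives of the quadratic part of the
reaction. Both are estimated for trigonometric polynomials, where the chain rule and integration by
parts are classical, and carried over to `w` by passing to the limit in finitely many coefficients.

The functions `D_i`, `f` and `g` are controlled only on the disc of radius `η`, so the Sobolev
inequality `sup |w|² ≤ (4/5) ‖w‖²_{H²}` is needed with a constant below one. It follows from a
bound for the lattice sum `∑_k wt k² / (1 + s + Λ)`, taken over the shells `max k_i = m`. As the inequality
is strict, solutions with `‖w(t)‖_{H²} ≤ η` stay in the disc for all times near `t`, which is what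
makes the derivative available at almost every such `t`.

Finally, the partial sums of `∑ Λ (2 a_k a_k' + 2 b_k b_k')` are dominated by a multiple of
`‖∇³w(t)‖²`, which is integrable in time. Hence the energy is the integral of its formal derivative
(`secondSq_sub_eq`); it is absolutely continuous, and Lebesgue's differentiation theorem gives the
derivative almost everywhere.
-/

noncomputable section

namespace Turing

variable {d : ℕ}

section

/-! ### The trigonometric system -/

/-- The product of `sin (k_i x_i)` over `i ∈ S` and of `cos (k_i x_i)` over `i ∉ S`. -/
def mode (S : Finset (Fin d)) (k : Fin d → ℕ) (x : Pt d) : ℝ :=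
  ∏ i, if i ∈ S then Real.sin (k i * x i) else Real.cos (k i * x i)

/-- The factor that makes `cos (m t)` a unit vector of `L²(0, π)`. -/
def nrm (m : ℕ) : ℝ := if m = 0 then √(1 / Real.pi) else √(2 / Real.pi)

/-- The factor that makes `mode S k`, unless it is zero, a unit vector of `L²((0, π)^d)`. -/
def wt (k : Fin d → ℕ) : ℝ := ∏ i, nrm (k i)

/-- The normalized modes: for each `S` the nonzero ones form an orthonormal basis of
`L²((0, π)^d)`. -/
def trig (S : Finset (Fin d)) (k : Fin d → ℕ) (x : Pt d) : ℝ := wt k * mode S k x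

/-- The Fourier coefficients of `f` with respect to the modes `trig S k`. -/
def coef (S : Finset (Fin d)) (f : Pt d → ℝ) (k : Fin d → ℕ) : ℝ :=
  ∫ x, f x * trig S k x ∂(boxMeasure d)

lemma nrm_pos (m : ℕ) : 0 < nrm m := by
  unfold nrm
  split_ifs <;> positivity

lemma wt_pos (k : Fin d → ℕ) : 0 < wt k := Finset.prod_pos fun i _ => nrm_pos (k i)

lemma contDiff_mode (S : Finset (Fin d)) (k : Fin d → ℕ) {n : WithTop ℕ∞} :
    ContDiff ℝ n (mode S k) := by
  unfold mode
  refine contDiff_prod fun i _ => ?_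
  split_ifs
  · exact Real.contDiff_sin.comp (contDiff_const.mul (contDiff_apply ℝ ℝ i))
  · exact Real.contDiff_cos.comp (contDiff_const.mul (contDiff_apply ℝ ℝ i))

lemma contDiff_trig (S : Finset (Fin d)) (k : Fin d → ℕ) {n : WithTop ℕ∞} :
    ContDiff ℝ n (trig S k) := contDiff_const.mul (contDiff_mode S k)

lemma continuous_trig (S : Finset (Fin d)) (k : Fin d → ℕ) : Continuous (trig S k) :=
  (contDiff_trig S k (n := 0)).continuous

lemma continuous_mode (S : Finset (Fin d)) (k : Fin d → ℕ) : Continuous (mode S k) :=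
  (contDiff_mode S k (n := 0)).continuous

lemma abs_mode_le (S : Finset (Fin d)) (k : Fin d → ℕ) (x : Pt d) : |mode S k x| ≤ 1 := by
  unfold mode
  rw [Finset.abs_prod]
  refine Finset.prod_le_one (fun _ _ => abs_nonneg _) fun i _ => ?_
  split_ifs
  · exact Real.abs_sin_le_one _
  · exact Real.abs_cos_le_one _

lemma abs_trig_le (S : Finset (Fin d)) (k : Fin d → ℕ) (x : Pt d) : |trig S k x| ≤ wt k := by
  unfold trig
  rw [abs_mul, abs_of_pos (wt_pos k)]
  exact mul_le_of_le_one_right (wt_pos k).le (abs_mode_le S k x)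

lemma mode_eq_zero {S : Finset (Fin d)} {k : Fin d → ℕ} {i : Fin d} (hi : i ∈ S) (hk : k i = 0)
    (x : Pt d) : mode S k x = 0 :=
  Finset.prod_eq_zero (Finset.mem_univ i) (by simp [hi, hk])

lemma trig_eq_zero {S : Finset (Fin d)} {k : Fin d → ℕ} {i : Fin d} (hi : i ∈ S) (hk : k i = 0)
    (x : Pt d) : trig S k x = 0 := by simp [trig, mode_eq_zero hi hk]

lemma coef_eq_zero {S : Finset (Fin d)} {k : Fin d → ℕ} {i : Fin d} (hi : i ∈ S) (hk : k i = 0)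
    (f : Pt d → ℝ) : coef S f k = 0 := by simp [coef, trig_eq_zero hi hk]

/-! ### The measure on the box -/

lemma boxMeasure_eq_pi :
    boxMeasure d = Measure.pi fun _ : Fin d => (volume : Measure ℝ).restrict (Ioo 0 Real.pi) := by
  rw [boxMeasure, box, volume_pi, Measure.restrict_pi_pi]

instance : IsFiniteMeasure (boxMeasure d) := by
  rw [boxMeasure_eq_pi]; infer_instance

lemma isOpen_box : IsOpen (box d) := isOpen_set_pi finite_univ fun _ _ => isOpen_Ioo

lemma ae_mem_box : ∀ᵐ x ∂(boxMeasure d), x ∈ box d :=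
  ae_restrict_mem isOpen_box.measurableSet

lemma memLp_of_continuous_bounded {f : Pt d → ℝ} (hf : Continuous f) (C : ℝ)
    (hC : ∀ x, |f x| ≤ C) (p : ENNReal) : MemLp f p (boxMeasure d) :=
  MemLp.of_bound hf.aestronglyMeasurable C (Eventually.of_forall hC)

lemma memLp_trig (S : Finset (Fin d)) (k : Fin d → ℕ) (p : ENNReal) :
    MemLp (trig S k) p (boxMeasure d) :=
  memLp_of_continuous_bounded (continuous_trig S k) _ (abs_trig_le S k) p

lemma integrable_mul_trig {f : Pt d → ℝ} (hf : Integrable f (boxMeasure d))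
    (S : Finset (Fin d)) (k : Fin d → ℕ) :
    Integrable (fun x => f x * trig S k x) (boxMeasure d) :=
  hf.mul_bdd (c := wt k) (continuous_trig S k).aestronglyMeasurable
    (Eventually.of_forall (abs_trig_le S k))

lemma integrable_mul_mode {f : Pt d → ℝ} (hf : Integrable f (boxMeasure d))
    (S : Finset (Fin d)) (k : Fin d → ℕ) :
    Integrable (fun x => f x * mode S k x) (boxMeasure d) :=
  hf.mul_bdd (c := 1) (continuous_mode S k).aestronglyMeasurable
    (Eventually.of_forall (abs_mode_le S k))

lemma _root_.MeasureTheory.MemLp.integrable_box {f : Pt d → ℝ} (hf : MemLp f 2 (boxMeasure d)) :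
    Integrable f (boxMeasure d) := hf.integrable (by norm_num)

/-! ### Completeness -/

lemma cos_mul_mode (S : Finset (Fin d)) {i : Fin d} (hi : i ∉ S) (k : Fin d → ℕ) :
    ∃ k' k'' : Fin d → ℕ, ∀ x, Real.cos (x i) * mode S k x = (mode S k' x + mode S k'' x) / 2 := by
  have key : ∀ (m : ℕ) (x : Pt d), mode S (Function.update k i m) x = Real.cos (m * x i) *
      ∏ j ∈ Finset.univ.erase i, if j ∈ S then Real.sin (k j * x j) else Real.cos (k j * x j) := by
    intro m x
    rw [mode, ← Finset.mul_prod_erase _ _ (Finset.mem_univ i)]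
    congr 1
    · simp [hi]
    · refine Finset.prod_congr rfl fun j hj => ?_
      rw [Function.update_of_ne (Finset.ne_of_mem_erase hj)]
  have key2 : ∀ x, mode S k x = Real.cos (k i * x i) *
      ∏ j ∈ Finset.univ.erase i, if j ∈ S then Real.sin (k j * x j) else Real.cos (k j * x j) := by
    intro x
    rw [mode, ← Finset.mul_prod_erase _ _ (Finset.mem_univ i)]
    simp [hi]
  rcases Nat.eq_zero_or_pos (k i) with h0 | h0
  · refine ⟨Function.update k i 1, Function.update k i 1, fun x => ?_⟩
    rw [key, key2, h0]
    simp
  · refine ⟨Function.update k i (k i + 1), Function.update k i (k i - 1), fun x => ?_⟩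
    rw [key, key, key2]
    have e1 : ((k i + 1 : ℕ) : ℝ) * x i = k i * x i + x i := by push_cast; ring
    have e2 : ((k i - 1 : ℕ) : ℝ) * x i = k i * x i - x i := by
      rw [Nat.cast_sub h0]; push_cast; ring
    rw [e1, e2, Real.cos_add, Real.cos_sub]
    ring

lemma sin_mul_mode (S : Finset (Fin d)) {i : Fin d} (hi : i ∉ S) (k : Fin d → ℕ) :
    ∃ (k' k'' : Fin d → ℕ) (a b : ℝ), ∀ x, Real.sin (x i) * mode S k x =
      a * mode (insert i S) k' x + b * mode (insert i S) k'' x := by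
  have key : ∀ (m : ℕ) (x : Pt d), mode (insert i S) (Function.update k i m) x =
      Real.sin (m * x i) *
      ∏ j ∈ Finset.univ.erase i, if j ∈ S then Real.sin (k j * x j) else Real.cos (k j * x j) := by
    intro m x
    rw [mode, ← Finset.mul_prod_erase _ _ (Finset.mem_univ i)]
    congr 1
    · simp
    · refine Finset.prod_congr rfl fun j hj => ?_
      rw [Function.update_of_ne (Finset.ne_of_mem_erase hj)]
      simp [Finset.ne_of_mem_erase hj]
  have key2 : ∀ x, mode S k x = Real.cos (k i * x i) *
      ∏ j ∈ Finset.univ.erase i, if j ∈ S then Real.sin (k j * x j) else Real.cos (k j * x j) := by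
    intro x
    rw [mode, ← Finset.mul_prod_erase _ _ (Finset.mem_univ i)]
    simp [hi]
  rcases Nat.eq_zero_or_pos (k i) with h0 | h0
  · refine ⟨Function.update k i 1, Function.update k i 1, 1, 0, fun x => ?_⟩
    rw [key, key2, h0]
    simp
  · refine ⟨Function.update k i (k i + 1), Function.update k i (k i - 1), 1 / 2, -(1 / 2),
      fun x => ?_⟩
    rw [key, key, key2]
    have e1 : ((k i + 1 : ℕ) : ℝ) * x i = k i * x i + x i := by push_cast; ring
    have e2 : ((k i - 1 : ℕ) : ℝ) * x i = k i * x i - x i := by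
      rw [Nat.cast_sub h0]; push_cast; ring
    rw [e1, e2, Real.sin_add, Real.sin_sub]
    ring

/-- The cosine modes span the polynomials in `cos x_1, …, cos x_d`, since the product of `cos x_i`
and a cosine mode is a combination of two cosine modes. -/
lemma integral_mul_polynomial_cos {f : Pt d → ℝ} (hf : Integrable f (boxMeasure d))
    (h : ∀ k, ∫ x, f x * mode ∅ k x ∂(boxMeasure d) = 0) (p : MvPolynomial (Fin d) ℝ) :
    ∀ k, Integrable (fun x => f x * MvPolynomial.eval (fun i => Real.cos (x i)) p * mode ∅ k x)
        (boxMeasure d) ∧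
      ∫ x, f x * MvPolynomial.eval (fun i => Real.cos (x i)) p * mode ∅ k x ∂(boxMeasure d) =
        0 := by
  induction p using MvPolynomial.induction_on with
  | C a =>
    intro k
    have e : (fun x => f x * MvPolynomial.eval (fun i => Real.cos (x i)) (MvPolynomial.C a) *
        mode ∅ k x) = fun x => a * (f x * mode ∅ k x) := by
      ext x; simp; ring
    rw [e, integral_const_mul, h, mul_zero]
    exact ⟨(integrable_mul_mode hf ∅ k).const_mul a, rfl⟩
  | add p q hp hq =>
    intro k
    have e : (fun x => f x * MvPolynomial.eval (fun i => Real.cos (x i)) (p + q) * mode ∅ k x) =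
        fun x => f x * MvPolynomial.eval (fun i => Real.cos (x i)) p * mode ∅ k x +
          f x * MvPolynomial.eval (fun i => Real.cos (x i)) q * mode ∅ k x := by
      ext x; simp; ring
    rw [e, integral_add (hp k).1 (hq k).1, (hp k).2, (hq k).2, add_zero]
    exact ⟨(hp k).1.add (hq k).1, rfl⟩
  | mul_X p i hp =>
    intro k
    obtain ⟨k', k'', hk⟩ := cos_mul_mode ∅ (Finset.notMem_empty i) k
    have e : (fun x => f x * MvPolynomial.eval (fun i => Real.cos (x i)) (p * MvPolynomial.X i) *
        mode ∅ k x) =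
        fun x => (f x * MvPolynomial.eval (fun i => Real.cos (x i)) p * mode ∅ k' x +
          f x * MvPolynomial.eval (fun i => Real.cos (x i)) p * mode ∅ k'' x) / 2 := by
      ext x
      have := hk x
      simp only [map_mul, MvPolynomial.eval_X]
      rw [mul_assoc, mul_assoc, this]; ring
    rw [e, integral_div, integral_add (hp k').1 (hp k'').1, (hp k').2, (hp k'').2]
    exact ⟨((hp k').1.add (hp k'').1).div_const 2, by simp⟩

/-- Polynomials in `cos x_1, …, cos x_d` are dense in the continuous functions on the closed box
by the Stone-Weierstrass theorem. -/
lemma exists_polynomial_cos_near {ψ : Pt d → ℝ} (hψ : Continuous ψ) {ε : ℝ} (hε : 0 < ε) :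
    ∃ p : MvPolynomial (Fin d) ℝ, ∀ x ∈ Icc (0 : Pt d) (fun _ => Real.pi),
      |MvPolynomial.eval (fun i => Real.cos (x i)) p - ψ x| < ε := by
  let K : Set (Pt d) := Icc (0 : Pt d) (fun _ => Real.pi)
  have : CompactSpace K := isCompact_iff_compactSpace.mp isCompact_Icc
  let c : Fin d → C(K, ℝ) := fun i =>
    ⟨fun x => Real.cos (x.1 i), Real.continuous_cos.comp
      ((continuous_apply i).comp continuous_subtype_val)⟩
  have hsep : (Algebra.adjoin ℝ (Set.range c)).SeparatesPoints := by
    intro x y hxy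
    obtain ⟨i, hi⟩ : ∃ i, x.1 i ≠ y.1 i := by
      by_contra! hcon
      exact hxy (Subtype.ext (funext hcon))
    refine ⟨_, ⟨c i, Algebra.subset_adjoin ⟨i, rfl⟩, rfl⟩, fun hc => hi ?_⟩
    exact Real.injOn_cos ⟨x.2.1 i, x.2.2 i⟩ ⟨y.2.1 i, y.2.2 i⟩ hc
  obtain ⟨⟨g, hg⟩, hgε⟩ :=
    ContinuousMap.exists_mem_subalgebra_near_continuous_of_separatesPoints _ hsep
      (fun x : K => ψ x.1) (hψ.comp continuous_subtype_val) ε hε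
  rw [Algebra.adjoin_range_eq_range_aeval] at hg
  obtain ⟨p, rfl⟩ := hg
  refine ⟨p, fun x hx => ?_⟩
  have := hgε ⟨x, hx⟩
  have e : (MvPolynomial.aeval c p : C(K, ℝ)) ⟨x, hx⟩ =
      MvPolynomial.eval (fun i => Real.cos (x i)) p := by
    clear this hgε hg
    induction p using MvPolynomial.induction_on with
    | C a => simp
    | add p q hp hq => simp [hp, hq]
    | mul_X p i hp => rw [map_mul, ContinuousMap.mul_apply, hp, MvPolynomial.aeval_X]; simp [c]
  rw [← e]
  exact this

lemma ae_eq_zero_of_cos {f : Pt d → ℝ} (hf : Integrable f (boxMeasure d))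
    (h : ∀ k, ∫ x, f x * mode ∅ k x ∂(boxMeasure d) = 0) : f =ᵐ[boxMeasure d] 0 := by
  have hz : ∀ ψ : Pt d → ℝ, Continuous ψ → HasCompactSupport ψ →
      ∫ x, ψ x • f x ∂(boxMeasure d) = 0 := by
    intro ψ hψ hc
    obtain ⟨B, hB⟩ := hc.exists_bound_of_continuous hψ
    have hint : Integrable (fun x => ψ x * f x) (boxMeasure d) :=
      hf.bdd_mul (c := B) hψ.aestronglyMeasurable (Eventually.of_forall hB)
    by_contra hne
    set I := ∫ x, ψ x • f x ∂(boxMeasure d) with hI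
    set N := ∫ x, |f x| ∂(boxMeasure d) with hN
    have hN0 : 0 ≤ N := integral_nonneg fun x => abs_nonneg _
    obtain ⟨p, hp⟩ := exists_polynomial_cos_near hψ
      (ε := |I| / (2 * (N + 1))) (by positivity)
    obtain ⟨hi, h0⟩ := integral_mul_polynomial_cos hf h p 0
    simp only [mode, Pi.zero_apply, Nat.cast_zero, zero_mul, Real.cos_zero, Finset.notMem_empty,
      if_false, Finset.prod_const_one, mul_one] at hi h0
    have h1 : |I| ≤ ∫ x, |I| / (2 * (N + 1)) * |f x| ∂(boxMeasure d) := by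
      have : I = ∫ x, (ψ x * f x - f x * MvPolynomial.eval (fun i => Real.cos (x i)) p)
          ∂(boxMeasure d) := by
        rw [integral_sub hint hi, h0, sub_zero]; rfl
      conv_lhs => rw [this]
      refine abs_integral_le_integral_abs.trans (integral_mono_ae ?_ ?_ ?_)
      · exact (hint.sub hi).abs
      · exact hf.abs.const_mul _
      · filter_upwards [ae_mem_box] with x hx
        have hx' := hp x ⟨fun i => (hx i trivial).1.le, fun i => (hx i trivial).2.le⟩
        rw [show ψ x * f x - f x * MvPolynomial.eval (fun i => Real.cos (x i)) p =
          -(MvPolynomial.eval (fun i => Real.cos (x i)) p - ψ x) * f x by ring, abs_mul, abs_neg]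
        exact mul_le_mul_of_nonneg_right hx'.le (abs_nonneg _)
    rw [integral_const_mul, ← hN] at h1
    have h2 : 0 < |I| := abs_pos.mpr hne
    rw [div_mul_eq_mul_div, le_div_iff₀ (by positivity)] at h1
    nlinarith
  have := ae_eq_zero_of_integral_contDiff_smul_eq_zero (μ := boxMeasure d) (f := f)
    hf.locallyIntegrable (fun g hg hc => hz g hg.continuous hc)
  exact this

/-- A function that is orthogonal to all sine modes in `x_i` is, after multiplication by
`sin x_i`, orthogonal to all cosine modes in `x_i`. -/
lemma ae_eq_zero_of_mode (S : Finset (Fin d)) : ∀ {f : Pt d → ℝ}, Integrable f (boxMeasure d) →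
    (∀ k, ∫ x, f x * mode S k x ∂(boxMeasure d) = 0) → f =ᵐ[boxMeasure d] 0 := by
  induction S using Finset.induction_on with
  | empty => exact fun hf h => ae_eq_zero_of_cos hf h
  | insert i S hi ih =>
    intro f hf h
    have hs : Integrable (fun x => f x * Real.sin (x i)) (boxMeasure d) :=
      hf.mul_bdd (c := 1) (Real.continuous_sin.comp (continuous_apply i)).aestronglyMeasurable
        (Eventually.of_forall fun x => Real.abs_sin_le_one _)
    have h0 := ih hs fun k => by
      obtain ⟨k', k'', a, b, hk⟩ := sin_mul_mode S hi k
      have e : (fun x => f x * Real.sin (x i) * mode S k x) =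
          fun x => a * (f x * mode (insert i S) k' x) + b * (f x * mode (insert i S) k'' x) := by
        ext x; rw [mul_assoc, hk]; ring
      rw [e, integral_add ((integrable_mul_mode hf _ _).const_mul _)
        ((integrable_mul_mode hf _ _).const_mul _), integral_const_mul, integral_const_mul, h, h]
      simp
    filter_upwards [h0, ae_mem_box] with x hx hb
    have : 0 < Real.sin (x i) := Real.sin_pos_of_mem_Ioo (hb i trivial)
    simpa [this.ne'] using hx

/-! ### Orthonormality and Parseval's identity -/

lemma integral_cos_nat_mul (m : ℕ) :
    ∫ t in (0 : ℝ)..Real.pi, Real.cos (m * t) = if m = 0 then Real.pi else 0 := by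
  split_ifs with h
  · simp [h]
  · have : (m : ℝ) ≠ 0 := Nat.cast_ne_zero.mpr h
    rw [intervalIntegral.integral_comp_mul_left (fun t => Real.cos t) this]
    simp [Real.sin_nat_mul_pi]

lemma integral_cos_sub_mul (m n : ℕ) :
    ∫ t in (0 : ℝ)..Real.pi, Real.cos (m * t - n * t) = if m = n then Real.pi else 0 := by
  wlog h : n ≤ m generalizing m n
  · simp only [eq_comm (a := m), ← this n m (by omega)]
    congr 1; ext t; rw [← Real.cos_neg]; congr 1; ring
  · have := integral_cos_nat_mul (m - n)
    rw [Nat.cast_sub h] at this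
    simp only [sub_mul] at this
    rw [this]
    exact if_congr (by omega) rfl rfl

lemma integral_factor (b : Prop) [Decidable b] (m n : ℕ) :
    ∫ t, (nrm m * (if b then Real.sin (m * t) else Real.cos (m * t))) *
        (nrm n * (if b then Real.sin (n * t) else Real.cos (n * t)))
        ∂((volume : Measure ℝ).restrict (Ioo 0 Real.pi)) =
      if m = n ∧ (b → m ≠ 0) then 1 else 0 := by
  rw [← integral_Ioc_eq_integral_Ioo, ← intervalIntegral.integral_of_le Real.pi_pos.le]
  have hs : IntervalIntegrable (fun t : ℝ => Real.cos (m * t - n * t)) volume 0 Real.pi :=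
    (Continuous.intervalIntegrable (by fun_prop) _ _)
  have ha : IntervalIntegrable (fun t : ℝ => Real.cos ((m + n : ℕ) * t)) volume 0 Real.pi :=
    (Continuous.intervalIntegrable (by fun_prop) _ _)
  have hpi := Real.pi_pos
  have e : ∀ t : ℝ, (nrm m * (if b then Real.sin (m * t) else Real.cos (m * t))) *
      (nrm n * (if b then Real.sin (n * t) else Real.cos (n * t))) =
      nrm m * nrm n / 2 * Real.cos (m * t - n * t) +
        (if b then -(nrm m * nrm n / 2) else nrm m * nrm n / 2) *
          Real.cos ((m + n : ℕ) * t) := by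
    intro t
    have : ((m + n : ℕ) : ℝ) * t = m * t + n * t := by push_cast; ring
    rw [this, Real.cos_add, Real.cos_sub]
    split_ifs <;> ring
  simp_rw [e]
  rw [intervalIntegral.integral_add (hs.const_mul _) (ha.const_mul _),
    intervalIntegral.integral_const_mul, intervalIntegral.integral_const_mul,
    integral_cos_sub_mul, integral_cos_nat_mul]
  by_cases hmn : m = n
  · subst hmn
    by_cases hm : m = 0
    · subst hm
      have : nrm 0 * nrm 0 = 1 / Real.pi := by
        simp only [nrm, if_true]; exact Real.mul_self_sqrt (by positivity)
      by_cases hb : b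
      · simp [hb]
      · simp [hb, this]; field_simp; norm_num
    · have : nrm m * nrm m = 2 / Real.pi := by
        simp only [nrm, hm, if_false]; exact Real.mul_self_sqrt (by positivity)
      simp [hm, this]; field_simp
  · rw [if_neg hmn, if_neg (show ¬ (m + n = 0) by omega)]
    simp [hmn]

lemma trig_eq_prod (S : Finset (Fin d)) (k : Fin d → ℕ) (x : Pt d) : trig S k x =
    ∏ i, nrm (k i) * (if i ∈ S then Real.sin (k i * x i) else Real.cos (k i * x i)) := by
  rw [trig, wt, mode, Finset.prod_mul_distrib]

open Classical in
lemma integral_trig_mul_trig (S : Finset (Fin d)) (k l : Fin d → ℕ) :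
    ∫ x, trig S k x * trig S l x ∂(boxMeasure d) =
      if k = l ∧ ∀ i ∈ S, k i ≠ 0 then 1 else 0 := by
  simp_rw [trig_eq_prod, ← Finset.prod_mul_distrib, boxMeasure_eq_pi]
  rw [integral_fintype_prod_eq_prod (𝕜 := ℝ) (f := fun i t =>
    nrm (k i) * (if i ∈ S then Real.sin (k i * t) else Real.cos (k i * t)) *
    (nrm (l i) * (if i ∈ S then Real.sin (l i * t) else Real.cos (l i * t))))]
  simp_rw [integral_factor]
  split_ifs with h
  · obtain ⟨rfl, h⟩ := h
    exact Finset.prod_eq_one fun i _ => by simpa using h i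
  · obtain ⟨i, hi⟩ : ∃ i, ¬ (k i = l i ∧ (i ∈ S → k i ≠ 0)) := by
      by_contra! hcon
      exact h ⟨funext fun i => (hcon i).1, fun i => (hcon i).2⟩
    exact Finset.prod_eq_zero (Finset.mem_univ i) (if_neg hi)

/-- The trigonometric polynomial with coefficients `c` and frequencies in `K`. -/
def trigPoly (S : Finset (Fin d)) (c : (Fin d → ℕ) → ℝ) (K : Finset (Fin d → ℕ)) (x : Pt d) : ℝ :=
  ∑ k ∈ K, c k * trig S k x

lemma contDiff_trigPoly (S : Finset (Fin d)) (c : (Fin d → ℕ) → ℝ) (K : Finset (Fin d → ℕ))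
    {n : WithTop ℕ∞} : ContDiff ℝ n (trigPoly S c K) :=
  ContDiff.sum fun k _ => contDiff_const.mul (contDiff_trig S k)

lemma continuous_trigPoly (S : Finset (Fin d)) (c : (Fin d → ℕ) → ℝ) (K : Finset (Fin d → ℕ)) :
    Continuous (trigPoly S c K) := (contDiff_trigPoly S c K (n := 0)).continuous

lemma abs_trigPoly_le (S : Finset (Fin d)) (c : (Fin d → ℕ) → ℝ) (K : Finset (Fin d → ℕ))
    (x : Pt d) : |trigPoly S c K x| ≤ ∑ k ∈ K, |c k| * wt k :=
  (Finset.abs_sum_le_sum_abs _ _).trans (Finset.sum_le_sum fun k _ => by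
    rw [abs_mul]; exact mul_le_mul_of_nonneg_left (abs_trig_le S k x) (abs_nonneg _))

lemma memLp_trigPoly (S : Finset (Fin d)) (c : (Fin d → ℕ) → ℝ) (K : Finset (Fin d → ℕ))
    (p : ENNReal) : MemLp (trigPoly S c K) p (boxMeasure d) :=
  memLp_of_continuous_bounded (continuous_trigPoly S c K) _ (abs_trigPoly_le S c K) p

open Classical in
lemma coef_trigPoly (S : Finset (Fin d)) (c : (Fin d → ℕ) → ℝ) (K : Finset (Fin d → ℕ))
    (k : Fin d → ℕ) : coef S (trigPoly S c K) k =
      if k ∈ K ∧ ∀ i ∈ S, k i ≠ 0 then c k else 0 := by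
  have e : ∀ x, trigPoly S c K x * trig S k x = ∑ l ∈ K, c l * (trig S l x * trig S k x) := by
    intro x; rw [trigPoly, Finset.sum_mul]; exact Finset.sum_congr rfl fun l _ => by ring
  simp_rw [coef, e]
  rw [integral_finsetSum _ fun l _ =>
    (integrable_mul_trig (memLp_trig S l 2).integrable_box S k).const_mul _]
  simp_rw [integral_const_mul, integral_trig_mul_trig]
  by_cases hk : k ∈ K ∧ ∀ i ∈ S, k i ≠ 0
  · rw [Finset.sum_eq_single k, if_pos ⟨rfl, hk.2⟩, if_pos hk, mul_one]
    · exact fun l _ hl => by rw [if_neg fun h => hl h.1, mul_zero]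
    · exact fun h => absurd hk.1 h
  · rw [if_neg hk]
    refine Finset.sum_eq_zero fun l hl => ?_
    rw [if_neg, mul_zero]
    rintro ⟨rfl, h⟩
    exact hk ⟨hl, h⟩

lemma l2Sq_congr {f g : Pt d → ℝ} (h : f =ᵐ[boxMeasure d] g) : l2Sq f = l2Sq g :=
  integral_congr_ae (by filter_upwards [h] with x hx; rw [hx])

lemma l2Sq_nonneg (f : Pt d → ℝ) : 0 ≤ l2Sq f := integral_nonneg fun _ => sq_nonneg _

lemma coef_sub {f g : Pt d → ℝ} (hf : Integrable f (boxMeasure d))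
    (hg : Integrable g (boxMeasure d)) (S : Finset (Fin d)) (k : Fin d → ℕ) :
    coef S (fun x => f x - g x) k = coef S f k - coef S g k := by
  simp_rw [coef, sub_mul]
  exact integral_sub (integrable_mul_trig hf S k) (integrable_mul_trig hg S k)

lemma ae_eq_of_coef_eq {S : Finset (Fin d)} {f g : Pt d → ℝ} (hf : Integrable f (boxMeasure d))
    (hg : Integrable g (boxMeasure d)) (h : ∀ k, coef S f k = coef S g k) :
    f =ᵐ[boxMeasure d] g := by
  have := ae_eq_zero_of_mode S (hf.sub hg) fun k => by
    have h1 := coef_sub hf hg S k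
    rw [h k, sub_self] at h1
    have e : ∀ x, (f x - g x) * trig S k x = wt k * ((f x - g x) * mode S k x) := by
      intro x; rw [trig]; ring
    simp_rw [coef, e, integral_const_mul] at h1
    exact (mul_eq_zero.1 h1).resolve_left (wt_pos k).ne'
  filter_upwards [this] with x hx
  exact sub_eq_zero.1 hx

lemma inner_toLp {f g : Pt d → ℝ} (hf : MemLp f 2 (boxMeasure d)) (hg : MemLp g 2 (boxMeasure d)) :
    inner ℝ (hf.toLp f) (hg.toLp g) = ∫ x, f x * g x ∂(boxMeasure d) := by
  rw [L2.inner_def]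
  refine integral_congr_ae ?_
  filter_upwards [hf.coeFn_toLp, hg.coeFn_toLp] with x h1 h2
  rw [h1, h2]; simp [mul_comm]

/-- Parseval's identity for the modes `trig S k`. -/
theorem hasSum_coef_sq (S : Finset (Fin d)) {f : Pt d → ℝ} (hf : MemLp f 2 (boxMeasure d)) :
    HasSum (fun k => coef S f k ^ 2) (l2Sq f) := by
  classical
  let ι := {k : Fin d → ℕ // ∀ i ∈ S, k i ≠ 0}
  let v : ι → Lp ℝ 2 (boxMeasure d) := fun k => (memLp_trig S k.1 2).toLp
  have hv : Orthonormal ℝ v := by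
    rw [orthonormal_iff_ite]
    intro k l
    rw [inner_toLp, integral_trig_mul_trig]
    exact if_congr ⟨fun h => Subtype.ext h.1, fun h => ⟨congrArg _ h, k.2⟩⟩ rfl rfl
  have hsp : (Submodule.span ℝ (Set.range v))ᗮ = ⊥ := by
    rw [Submodule.eq_bot_iff]
    intro g hg
    have hgm : MemLp g 2 (boxMeasure d) := Lp.memLp g
    have h0 : (g : Pt d → ℝ) =ᵐ[boxMeasure d] fun _ => 0 := by
      refine ae_eq_of_coef_eq (S := S) hgm.integrable_box (integrable_zero _ _ _) fun k => ?_
      rw [show coef S (fun _ : Pt d => (0 : ℝ)) k = 0 by simp [coef]]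
      by_cases hk : ∀ i ∈ S, k i ≠ 0
      · have h1 : inner ℝ (v ⟨k, hk⟩) g = 0 :=
          (Submodule.mem_orthogonal _ _).1 hg _ (Submodule.subset_span ⟨_, rfl⟩)
        rw [← Lp.toLp_coeFn g hgm, inner_toLp] at h1
        rw [coef, ← h1]
        exact integral_congr_ae (Eventually.of_forall fun x => mul_comm _ _)
      · push Not at hk
        obtain ⟨i, hi, hk⟩ := hk
        exact coef_eq_zero hi hk _
    exact (Lp.eq_zero_iff_ae_eq_zero).2 h0
  let b := HilbertBasis.mkOfOrthogonalEqBot hv hsp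
  have hb : ∀ k, b k = v k := fun k => by
    rw [show b = HilbertBasis.mkOfOrthogonalEqBot hv hsp from rfl,
      HilbertBasis.coe_mkOfOrthogonalEqBot]
  have hs := b.hasSum_inner_mul_inner (hf.toLp f) (hf.toLp f)
  have e : (fun k : ι => coef S f k.1 ^ 2) =
      fun k => inner ℝ (hf.toLp f) (b k) * inner ℝ (b k) (hf.toLp f) := by
    ext k
    rw [hb, inner_toLp, real_inner_comm, inner_toLp, sq]; rfl
  rw [← e, inner_toLp] at hs
  have hl : ∫ x, f x * f x ∂(boxMeasure d) = l2Sq f := by simp_rw [l2Sq, sq]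
  rw [hl] at hs
  refine (hasSum_subtype_iff_of_support_subset (f := fun k => coef S f k ^ 2)
    (s := {k | ∀ i ∈ S, k i ≠ 0}) ?_).1 hs
  intro k hk i hi h0
  exact hk (by simp [coef_eq_zero hi h0])

lemma sum_coef_sq_le (S : Finset (Fin d)) {f : Pt d → ℝ} (hf : MemLp f 2 (boxMeasure d))
    (K : Finset (Fin d → ℕ)) : ∑ k ∈ K, coef S f k ^ 2 ≤ l2Sq f :=
  sum_le_hasSum K (fun _ _ => sq_nonneg _) (hasSum_coef_sq S hf)

lemma l2Sq_trigPoly_le (S : Finset (Fin d)) (c : (Fin d → ℕ) → ℝ) (K : Finset (Fin d → ℕ)) :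
    l2Sq (trigPoly S c K) ≤ ∑ k ∈ K, c k ^ 2 := by
  classical
  refine hasSum_le_of_sum_le (hasSum_coef_sq S (memLp_trigPoly S c K 2)) fun L => ?_
  simp_rw [coef_trigPoly]
  calc ∑ k ∈ L, (if k ∈ K ∧ ∀ i ∈ S, k i ≠ 0 then c k else 0) ^ 2
      ≤ ∑ k ∈ L, (if k ∈ K then c k ^ 2 else 0) := Finset.sum_le_sum fun k _ => by
        by_cases h : k ∈ K
        · by_cases h' : ∀ i ∈ S, k i ≠ 0
          · rw [if_pos ⟨h, h'⟩, if_pos h]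
          · rw [if_neg fun hc => h' hc.2, if_pos h]; simpa using sq_nonneg (c k)
        · simp [h]
    _ = ∑ k ∈ L ∩ K, c k ^ 2 := by rw [Finset.sum_ite_mem]
    _ ≤ ∑ k ∈ K, c k ^ 2 :=
        Finset.sum_le_sum_of_subset_of_nonneg Finset.inter_subset_right
          fun _ _ _ => sq_nonneg _

/-- The Fourier partial sums converge in `L²`. -/
theorem tendsto_l2Sq_sub_trigPoly (S : Finset (Fin d)) {f : Pt d → ℝ}
    (hf : MemLp f 2 (boxMeasure d)) :
    Tendsto (fun K => l2Sq fun x => f x - trigPoly S (coef S f) K x) atTop (𝓝 0) := by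
  classical
  have hs := hasSum_coef_sq S hf
  have e : ∀ K, l2Sq (fun x => f x - trigPoly S (coef S f) K x) =
      l2Sq f - ∑ k ∈ K, coef S f k ^ 2 := by
    intro K
    have h1 := hasSum_coef_sq S (hf.sub (memLp_trigPoly S (coef S f) K 2))
    have h2 : (fun k => coef S (f - trigPoly S (coef S f) K) k ^ 2) =
        fun k => coef S f k ^ 2 - if k ∈ K then coef S f k ^ 2 else 0 := by
      ext k
      have : coef S (f - trigPoly S (coef S f) K) k = _ :=
        coef_sub hf.integrable_box (memLp_trigPoly S (coef S f) K 2).integrable_box S k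
      rw [this, coef_trigPoly]
      by_cases hk : ∀ i ∈ S, k i ≠ 0
      · by_cases h : k ∈ K
        · rw [if_pos ⟨h, hk⟩, if_pos h]; ring
        · rw [if_neg fun hc => h hc.1, if_neg h]; ring
      · have h0 : coef S f k = 0 := by
          push Not at hk
          obtain ⟨i, hi, hk⟩ := hk
          exact coef_eq_zero hi hk _
        simp [h0]
    have h3 : HasSum (fun k => if k ∈ K then coef S f k ^ 2 else 0) (∑ k ∈ K, coef S f k ^ 2) := by
      have : HasSum (fun k => if k ∈ K then coef S f k ^ 2 else 0)
          (∑ k ∈ K, if k ∈ K then coef S f k ^ 2 else 0) :=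
        hasSum_sum_of_ne_finset_zero fun k hk => if_neg hk
      rwa [Finset.sum_congr rfl fun k hk => if_pos hk] at this
    rw [h2] at h1
    exact h1.unique (hs.sub h3)
  simp_rw [e]
  have hs' : Tendsto (fun K => ∑ k ∈ K, coef S f k ^ 2) atTop (𝓝 (l2Sq f)) := hs
  have := (tendsto_const_nhds (x := l2Sq f)).sub hs'
  rwa [sub_self] at this

end

section

/-! ### Partial derivatives of products and of the modes -/

lemma hasFDerivAt_prod_apply {g : Fin d → ℝ → ℝ} {g' : Fin d → ℝ} {x : Pt d}
    (hg : ∀ j, HasDerivAt (g j) (g' j) (x j)) :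
    HasFDerivAt (fun x : Pt d => ∏ j, g j (x j))
      (∑ i, (∏ j ∈ Finset.univ.erase i, g j (x j)) •
        (g' i • (ContinuousLinearMap.proj i : Pt d →L[ℝ] ℝ))) x := by
  refine HasFDerivAt.finsetProd (g := fun j (x : Pt d) => g j (x j)) fun j _ => ?_
  exact (hg j).comp_hasFDerivAt x (ContinuousLinearMap.proj j : Pt d →L[ℝ] ℝ).hasFDerivAt

lemma classicalPartial_prod_apply {g : Fin d → ℝ → ℝ} {g' : Fin d → ℝ} {x : Pt d}
    (hg : ∀ j, HasDerivAt (g j) (g' j) (x j)) (i : Fin d) :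
    classicalPartial i (fun x : Pt d => ∏ j, g j (x j)) x =
      g' i * ∏ j ∈ Finset.univ.erase i, g j (x j) := by
  rw [classicalPartial, (hasFDerivAt_prod_apply hg).fderiv]
  simp only [sum_apply, smul_apply,
    ContinuousLinearMap.proj_apply, smul_eq_mul]
  rw [Finset.sum_eq_single i]
  · simp [mul_comm]
  · intro j _ hj
    simp [hj]
  · simp

lemma hasDerivAt_factor (b : Prop) [Decidable b] (m : ℕ) (t : ℝ) :
    HasDerivAt (fun t : ℝ => if b then Real.sin (m * t) else Real.cos (m * t))
      (if b then m * Real.cos (m * t) else -(m * Real.sin (m * t))) t := by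
  have h : HasDerivAt (fun t : ℝ => (m : ℝ) * t) m t := by
    simpa using (hasDerivAt_id t).const_mul (m : ℝ)
  split_ifs
  · simpa [mul_comm] using h.sin
  · convert h.cos using 1; ring

lemma classicalPartial_mode_of_mem {S : Finset (Fin d)} {i : Fin d} (hi : i ∈ S)
    (k : Fin d → ℕ) (x : Pt d) :
    classicalPartial i (mode S k) x = k i * mode (S.erase i) k x := by
  have := classicalPartial_prod_apply (x := x)
    (g := fun j t => if j ∈ S then Real.sin (k j * t) else Real.cos (k j * t))
    (fun j => hasDerivAt_factor (j ∈ S) (k j) (x j)) i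
  rw [show classicalPartial i (mode S k) x = _ from this, if_pos hi, mode,
    ← Finset.mul_prod_erase _ _ (Finset.mem_univ i), if_neg (Finset.notMem_erase i S), mul_assoc]
  congr 2
  refine Finset.prod_congr rfl fun j hj => ?_
  simp [Finset.ne_of_mem_erase hj]

lemma classicalPartial_mode_of_notMem {S : Finset (Fin d)} {i : Fin d} (hi : i ∉ S)
    (k : Fin d → ℕ) (x : Pt d) :
    classicalPartial i (mode S k) x = -(k i * mode (insert i S) k x) := by
  have := classicalPartial_prod_apply (x := x)
    (g := fun j t => if j ∈ S then Real.sin (k j * t) else Real.cos (k j * t))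
    (fun j => hasDerivAt_factor (j ∈ S) (k j) (x j)) i
  rw [show classicalPartial i (mode S k) x = _ from this, if_neg hi, mode,
    ← Finset.mul_prod_erase _ _ (Finset.mem_univ i), if_pos (Finset.mem_insert_self i S),
    neg_mul, mul_assoc]
  congr 3
  refine Finset.prod_congr rfl fun j hj => ?_
  simp [Finset.ne_of_mem_erase hj]

lemma classicalPartial_const_mul (i : Fin d) (c : ℝ) {φ : Pt d → ℝ} {x : Pt d}
    (hφ : DifferentiableAt ℝ φ x) :
    classicalPartial i (fun x => c * φ x) x = c * classicalPartial i φ x := by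
  simp [classicalPartial, fderiv_const_mul hφ]

lemma classicalPartial_trig_of_mem {S : Finset (Fin d)} {i : Fin d} (hi : i ∈ S)
    (k : Fin d → ℕ) (x : Pt d) :
    classicalPartial i (trig S k) x = k i * trig (S.erase i) k x := by
  have := classicalPartial_const_mul i (wt k) (x := x)
    ((contDiff_mode S k (n := 1)).differentiable one_ne_zero x)
  rw [show classicalPartial i (trig S k) x = _ from this, classicalPartial_mode_of_mem hi, trig]
  ring

lemma classicalPartial_trig_of_notMem {S : Finset (Fin d)} {i : Fin d} (hi : i ∉ S)
    (k : Fin d → ℕ) (x : Pt d) :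
    classicalPartial i (trig S k) x = -(k i * trig (insert i S) k x) := by
  have := classicalPartial_const_mul i (wt k) (x := x)
    ((contDiff_mode S k (n := 1)).differentiable one_ne_zero x)
  rw [show classicalPartial i (trig S k) x = _ from this, classicalPartial_mode_of_notMem hi, trig]
  ring

/-! ### Cut-off functions and sine modes as test functions -/

/-- A smooth function that vanishes for `y ≤ 1` and equals `1` for `y ≥ 2`. -/
def ramp (y : ℝ) : ℝ := Real.smoothTransition (y - 1)

lemma contDiff_ramp {n : ℕ∞} : ContDiff ℝ n ramp :=
  Real.smoothTransition.contDiff.comp (contDiff_id.sub contDiff_const)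

lemma ramp_of_le {y : ℝ} (h : y ≤ 1) : ramp y = 0 :=
  Real.smoothTransition.zero_of_nonpos (by linarith)

lemma ramp_of_ge {y : ℝ} (h : 2 ≤ y) : ramp y = 1 :=
  Real.smoothTransition.one_of_one_le (by linarith)

lemma abs_ramp_le (y : ℝ) : |ramp y| ≤ 1 := by
  rw [ramp, abs_of_nonneg (Real.smoothTransition.nonneg _)]
  exact Real.smoothTransition.le_one _

lemma hasDerivAt_ramp (y : ℝ) : HasDerivAt ramp (deriv ramp y) y :=
  ((contDiff_ramp (n := 1)).differentiable one_ne_zero y).hasDerivAt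

lemma deriv_ramp_of_gt {y : ℝ} (h : 2 < y) : deriv ramp y = 0 := by
  have : ramp =ᶠ[𝓝 y] fun _ => 1 := by
    filter_upwards [lt_mem_nhds h] with z hz using ramp_of_ge hz.le
  rw [this.deriv_eq, deriv_const]

lemma exists_abs_mul_deriv_ramp_le : ∃ C, 0 ≤ C ∧ ∀ y, |y * deriv ramp y| ≤ C := by
  have hc : Continuous fun y => y * deriv ramp y :=
    continuous_id.mul ((contDiff_ramp (n := 1)).continuous_deriv le_rfl)
  obtain ⟨C, hC⟩ := (isCompact_Icc (a := (1 : ℝ)) (b := 2)).exists_bound_of_continuousOn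
    hc.continuousOn
  refine ⟨max C 0, le_max_right _ _, fun y => ?_⟩
  rcases lt_or_ge y 1 with h1 | h1
  · have : ramp =ᶠ[𝓝 y] fun _ => 0 := by
      filter_upwards [gt_mem_nhds h1] with z hz using ramp_of_le hz.le
    rw [this.deriv_eq, deriv_const]; simp
  · rcases le_or_gt y 2 with h2 | h2
    · exact (hC y ⟨h1, h2⟩).trans (le_max_left _ _)
    · rw [deriv_ramp_of_gt h2]; simp

/-- Cut-off functions in `(0, π)`: smooth, equal to `1` at distance at least `2 / n` from the
ends, and `0` within distance `1 / n` of them. -/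
def cutoff (n : ℕ) (t : ℝ) : ℝ := ramp (n * t) * ramp (n * (Real.pi - t))

/-- The derivative of `cutoff n`. -/
def cutoffDeriv (n : ℕ) (t : ℝ) : ℝ :=
  n * deriv ramp (n * t) * ramp (n * (Real.pi - t)) -
    ramp (n * t) * (n * deriv ramp (n * (Real.pi - t)))

lemma contDiff_cutoff (n : ℕ) : ContDiff ℝ ∞ (cutoff n) :=
  (contDiff_ramp.comp (contDiff_const.mul contDiff_id)).mul
    (contDiff_ramp.comp (contDiff_const.mul (contDiff_const.sub contDiff_id)))

lemma hasDerivAt_cutoff (n : ℕ) (t : ℝ) : HasDerivAt (cutoff n) (cutoffDeriv n t) t := by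
  have h1 : HasDerivAt (fun t : ℝ => (n : ℝ) * t) n t := by
    simpa using (hasDerivAt_id t).const_mul (n : ℝ)
  have h2 : HasDerivAt (fun t : ℝ => (n : ℝ) * (Real.pi - t)) (-n) t := by
    simpa using ((hasDerivAt_id t).const_sub Real.pi).const_mul (n : ℝ)
  have := ((hasDerivAt_ramp _).comp t h1).mul ((hasDerivAt_ramp _).comp t h2)
  refine this.congr_deriv ?_
  simp only [cutoffDeriv, Function.comp]
  ring

lemma abs_cutoff_le (n : ℕ) (t : ℝ) : |cutoff n t| ≤ 1 := by
  rw [cutoff, abs_mul]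
  exact mul_le_one₀ (abs_ramp_le _) (abs_nonneg _) (abs_ramp_le _)

lemma eventually_cutoff_eq {t : ℝ} (ht : t ∈ Ioo 0 Real.pi) :
    ∀ᶠ n : ℕ in atTop, cutoff n t = 1 ∧ cutoffDeriv n t = 0 := by
  have h1 : Tendsto (fun n : ℕ => (n : ℝ) * t) atTop atTop :=
    tendsto_natCast_atTop_atTop.atTop_mul_const ht.1
  have h2 : Tendsto (fun n : ℕ => (n : ℝ) * (Real.pi - t)) atTop atTop :=
    tendsto_natCast_atTop_atTop.atTop_mul_const (sub_pos.2 ht.2)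
  filter_upwards [h1.eventually_gt_atTop 2, h2.eventually_gt_atTop 2] with n hn1 hn2
  rw [cutoff, cutoffDeriv, deriv_ramp_of_gt hn1, deriv_ramp_of_gt hn2, ramp_of_ge hn1.le,
    ramp_of_ge hn2.le]
  simp

/-- The derivative of the cut-off is of size `n` near the ends, where `sin (m t)` is of size
`1 / n`. -/
lemma exists_abs_sin_mul_cutoffDeriv_le (m : ℕ) :
    ∃ C, ∀ n : ℕ, ∀ t ∈ Ioo 0 Real.pi, |Real.sin (m * t) * cutoffDeriv n t| ≤ C := by
  obtain ⟨C, hC0, hC⟩ := exists_abs_mul_deriv_ramp_le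
  refine ⟨m * (C + C), fun n t ht => ?_⟩
  have hs1 : |Real.sin (m * t)| ≤ m * t := by
    refine Real.abs_sin_le_abs.trans_eq (abs_of_nonneg ?_)
    have := ht.1.le; positivity
  have hs2 : |Real.sin (m * t)| ≤ m * (Real.pi - t) := by
    have h0 : 0 ≤ (m : ℝ) * (Real.pi - t) := mul_nonneg (Nat.cast_nonneg m) (sub_nonneg.2 ht.2.le)
    have : |Real.sin (m * t)| = |Real.sin (m * (Real.pi - t))| := by
      rw [mul_sub, Real.sin_nat_mul_pi_sub]
      rcases neg_one_pow_eq_or ℝ m with h | h <;> simp [h]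
    rw [this]
    exact Real.abs_sin_le_abs.trans_eq (abs_of_nonneg h0)
  have a1 : |Real.sin (m * t) * (n * deriv ramp (n * t) * ramp (n * (Real.pi - t)))| ≤ m * C := by
    rw [abs_mul, abs_mul, ← mul_assoc]
    refine (mul_le_of_le_one_right (by positivity) (abs_ramp_le _)).trans ?_
    calc |Real.sin (m * t)| * |(n : ℝ) * deriv ramp (n * t)|
        ≤ m * t * |(n : ℝ) * deriv ramp (n * t)| := by gcongr
      _ = m * |n * t * deriv ramp (n * t)| := by
        rw [abs_mul, abs_mul, abs_mul, abs_of_pos ht.1]; ring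
      _ ≤ m * C := by gcongr; exact hC _
  have a2 : |Real.sin (m * t) * (ramp (n * t) * (n * deriv ramp (n * (Real.pi - t))))| ≤
      m * C := by
    rw [abs_mul, abs_mul, mul_left_comm]
    refine (mul_le_of_le_one_left (by positivity) (abs_ramp_le _)).trans ?_
    calc |Real.sin (m * t)| * |(n : ℝ) * deriv ramp (n * (Real.pi - t))|
        ≤ m * (Real.pi - t) * |(n : ℝ) * deriv ramp (n * (Real.pi - t))| := by gcongr
      _ = m * |n * (Real.pi - t) * deriv ramp (n * (Real.pi - t))| := by
        rw [abs_mul, abs_mul, abs_mul, abs_of_pos (sub_pos.2 ht.2)]; ring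
      _ ≤ m * C := by gcongr; exact hC _
  rw [cutoffDeriv, mul_sub, mul_add]
  exact (abs_sub _ _).trans (add_le_add a1 a2)

lemma tsupport_prod_cutoff_subset (g : Fin d → ℝ → ℝ) {n : ℕ} (hn : 0 < n) :
    tsupport (fun x : Pt d => ∏ j, g j (x j) * cutoff n (x j)) ⊆
      Icc (fun _ => 1 / (n : ℝ)) (fun _ => Real.pi - 1 / n) := by
  have hn' : (0 : ℝ) < n := Nat.cast_pos.2 hn
  refine closure_minimal (fun x hx => ?_) isClosed_Icc
  have h : ∀ j, cutoff n (x j) ≠ 0 := fun j h0 =>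
    hx (Finset.prod_eq_zero (Finset.mem_univ j) (by rw [h0, mul_zero]))
  refine ⟨fun j => ?_, fun j => ?_⟩
  · by_contra! hlt
    refine h j ?_
    rw [cutoff, ramp_of_le, zero_mul]
    rw [lt_div_iff₀ hn'] at hlt
    linarith
  · by_contra! hlt
    refine h j ?_
    rw [cutoff, ramp_of_le (y := n * (Real.pi - x j)), mul_zero]
    have : Real.pi - x j < 1 / n := by linarith
    rw [lt_div_iff₀ hn'] at this
    linarith

/-- Modes that are sines in `x_i` vanish on the faces `x_i = 0, π`, so they are admissible
test functions for a weak derivative in `x_i`. -/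
lemma IsWeakPartial.integral_mode {i : Fin d} {f g : Pt d → ℝ} (h : IsWeakPartial i f g)
    (hf : Integrable f (boxMeasure d)) {S : Finset (Fin d)} (hi : i ∈ S) (k : Fin d → ℕ) :
    ∫ x, f x * (k i * mode (S.erase i) k x) ∂(boxMeasure d) =
      -∫ x, g x * mode S k x ∂(boxMeasure d) := by
  obtain ⟨C, hC⟩ := exists_abs_sin_mul_cutoffDeriv_le (k i)
  let τ : Fin d → ℝ → ℝ := fun j t => if j ∈ S then Real.sin (k j * t) else Real.cos (k j * t)
  let τ' : Fin d → ℝ → ℝ := fun j t =>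
    if j ∈ S then k j * Real.cos (k j * t) else -(k j * Real.sin (k j * t))
  have hτ : ∀ j t, HasDerivAt (τ j) (τ' j t) t := fun j t => hasDerivAt_factor (j ∈ S) (k j) t
  have hτ1 : ∀ j t, |τ j t| ≤ 1 := by
    intro j t
    simp only [τ]
    split_ifs
    · exact Real.abs_sin_le_one _
    · exact Real.abs_cos_le_one _
  have hτc : ∀ j, ContDiff ℝ ∞ (τ j) := by
    intro j
    by_cases hj : j ∈ S
    · simp only [τ, hj, if_true]; exact Real.contDiff_sin.comp (contDiff_const.mul contDiff_id)
    · simp only [τ, hj, if_false]; exact Real.contDiff_cos.comp (contDiff_const.mul contDiff_id)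
  let φ : ℕ → Pt d → ℝ := fun n x => ∏ j, τ j (x j) * cutoff n (x j)
  have hφd : ∀ n x, classicalPartial i (φ n) x =
      (τ' i (x i) * cutoff n (x i) + τ i (x i) * cutoffDeriv n (x i)) *
        ∏ j ∈ Finset.univ.erase i, τ j (x j) * cutoff n (x j) := fun n x =>
    classicalPartial_prod_apply (g := fun j t => τ j t * cutoff n t)
      (g' := fun j => τ' j (x j) * cutoff n (x j) + τ j (x j) * cutoffDeriv n (x j))
      (fun j => (hτ j _).mul (hasDerivAt_cutoff n _)) i
  have hφs : ∀ n, ContDiff ℝ ∞ (φ n) := fun n => contDiff_prod fun j _ =>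
    ((hτc j).comp (contDiff_apply ℝ ℝ j)).mul ((contDiff_cutoff n).comp (contDiff_apply ℝ ℝ j))
  have hfac : ∀ n j t, |τ j t * cutoff n t| ≤ 1 := fun n j t => by
    rw [abs_mul]; exact mul_le_one₀ (hτ1 j t) (abs_nonneg _) (abs_cutoff_le n t)
  have hφ1 : ∀ n x, |φ n x| ≤ 1 := fun n x => by
    simp only [φ, Finset.abs_prod]
    exact Finset.prod_le_one (fun _ _ => abs_nonneg _) fun j _ => hfac n j _
  have hτi : ∀ t, |τ' i t| ≤ k i := fun t => by
    simp only [τ', hi, if_true, abs_mul, Nat.abs_cast]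
    exact mul_le_of_le_one_right (Nat.cast_nonneg _) (Real.abs_cos_le_one _)
  have hφ2 : ∀ n, ∀ x ∈ box d, |classicalPartial i (φ n) x| ≤ k i + C := fun n x hx => by
    rw [hφd, abs_mul, Finset.abs_prod]
    have h1 : |τ' i (x i) * cutoff n (x i)| ≤ k i := by
      rw [abs_mul]
      exact (mul_le_of_le_one_right (abs_nonneg _) (abs_cutoff_le n _)).trans (hτi _)
    have h2 : |τ i (x i) * cutoffDeriv n (x i)| ≤ C := by
      simpa only [τ, hi, if_true] using hC n (x i) (hx i trivial)
    refine (mul_le_of_le_one_right (abs_nonneg _) (Finset.prod_le_one (fun _ _ => abs_nonneg _)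
      fun j _ => hfac n j _)).trans ((abs_add_le _ _).trans (add_le_add h1 h2))
  have hev : ∀ x ∈ box d, ∀ᶠ n in atTop, φ n x = mode S k x ∧
      classicalPartial i (φ n) x = k i * mode (S.erase i) k x := by
    intro x hx
    have : ∀ᶠ n : ℕ in atTop, ∀ j, cutoff n (x j) = 1 ∧ cutoffDeriv n (x j) = 0 :=
      eventually_all.2 fun j => eventually_cutoff_eq (hx j trivial)
    filter_upwards [this] with n hn
    have hm := classicalPartial_prod_apply (x := x) (g := τ) (fun j => hτ j (x j)) i
    rw [← classicalPartial_mode_of_mem hi, show classicalPartial i (mode S k) x = _ from hm, hφd]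
    simp only [φ, (hn _).1, (hn _).2, mul_one, mul_zero, add_zero, mode, τ, and_self]
  have hl : Tendsto (fun n => ∫ x, f x * classicalPartial i (φ n) x ∂(boxMeasure d)) atTop
      (𝓝 (∫ x, f x * (k i * mode (S.erase i) k x) ∂(boxMeasure d))) := by
    refine tendsto_integral_of_dominated_convergence (fun x => |f x| * (k i + C)) (fun n => ?_)
      (hf.abs.mul_const _) (fun n => ?_) ?_
    · refine hf.aestronglyMeasurable.mul (Continuous.aestronglyMeasurable ?_)
      exact ((hφs n).continuous_fderiv (by simp)).clm_apply continuous_const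
    · filter_upwards [ae_mem_box] with x hx
      rw [norm_mul]
      exact mul_le_mul_of_nonneg_left (hφ2 n x hx) (norm_nonneg _)
    · filter_upwards [ae_mem_box] with x hx
      refine tendsto_const_nhds.congr' ?_
      filter_upwards [hev x hx] with n hn
      rw [hn.2]
  have hr : Tendsto (fun n => -∫ x, g x * φ n x ∂(boxMeasure d)) atTop
      (𝓝 (-∫ x, g x * mode S k x ∂(boxMeasure d))) := by
    refine (tendsto_integral_of_dominated_convergence (fun x => |g x|) (fun n => ?_)
      h.1.integrable_box.abs (fun n => ?_) ?_).neg
    · exact h.1.aestronglyMeasurable.mul (hφs n).continuous.aestronglyMeasurable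
    · refine Eventually.of_forall fun x => ?_
      rw [norm_mul]
      exact mul_le_of_le_one_right (norm_nonneg _) (hφ1 n x)
    · filter_upwards [ae_mem_box] with x hx
      refine tendsto_const_nhds.congr' ?_
      filter_upwards [hev x hx] with n hn
      rw [hn.1]
  refine tendsto_nhds_unique (hl.congr' ?_) hr
  filter_upwards [eventually_gt_atTop 0] with n hn
  have hsub := tsupport_prod_cutoff_subset τ hn
  refine h.2 (φ n) (hφs n) (HasCompactSupport.of_support_subset_isCompact isCompact_Icc
    ((subset_tsupport _).trans hsub)) (hsub.trans fun x hx j _ => ?_)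
  have hn' : (0 : ℝ) < 1 / n := one_div_pos.2 (Nat.cast_pos.2 hn)
  exact ⟨hn'.trans_le (hx.1 j), (hx.2 j).trans_lt (by linarith)⟩

lemma integral_mul_const_mul_trig (f : Pt d → ℝ) (c : ℝ) (S : Finset (Fin d)) (k : Fin d → ℕ) :
    ∫ x, f x * (c * trig S k x) ∂(boxMeasure d) = c * coef S f k := by
  rw [coef, ← integral_const_mul]
  exact integral_congr_ae (Eventually.of_forall fun x => by ring)

lemma IsWeakPartial.coef_eq {i : Fin d} {f g : Pt d → ℝ} (h : IsWeakPartial i f g)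
    (hf : Integrable f (boxMeasure d)) {S : Finset (Fin d)} (hi : i ∈ S) (k : Fin d → ℕ) :
    coef S g k = -(k i * coef (S.erase i) f k) := by
  have h1 := h.integral_mode hf hi k
  have e1 : ∀ x, f x * (k i * mode (S.erase i) k x) =
      k i * (f x * mode (S.erase i) k x) := fun x => by ring
  simp_rw [e1, integral_const_mul] at h1
  have e2 : ∀ (T : Finset (Fin d)) (F : Pt d → ℝ), coef T F k =
      wt k * ∫ x, F x * mode T k x ∂(boxMeasure d) := by
    intro T F
    rw [coef, ← integral_const_mul]
    exact integral_congr_ae (Eventually.of_forall fun x => by simp only [trig]; ring)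
  rw [e2, e2]
  linear_combination wt k * h1

/-! ### Calculus of weak derivatives -/

lemma IsWeakPartial.congr {i : Fin d} {f f' g g' : Pt d → ℝ} (h : IsWeakPartial i f g)
    (hf : f =ᵐ[boxMeasure d] f') (hg : g =ᵐ[boxMeasure d] g') : IsWeakPartial i f' g' := by
  refine ⟨h.1.ae_eq hg, fun φ h1 h2 h3 => ?_⟩
  have := h.2 φ h1 h2 h3
  rw [integral_congr_ae (g := fun x => f' x * classicalPartial i φ x)
      (by filter_upwards [hf] with x hx; rw [hx]),
    integral_congr_ae (μ := boxMeasure d) (f := fun x => g x * φ x) (g := fun x => g' x * φ x)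
      (by filter_upwards [hg] with x hx; rw [hx])] at this
  exact this

/-- Weak derivatives are unique: their coefficients with respect to the pure sine modes are
determined. -/
lemma IsWeakPartial.unique {i : Fin d} {f g g' : Pt d → ℝ} (hf : Integrable f (boxMeasure d))
    (h : IsWeakPartial i f g) (h' : IsWeakPartial i f g') : g =ᵐ[boxMeasure d] g' :=
  ae_eq_of_coef_eq (S := Finset.univ) h.1.integrable_box h'.1.integrable_box fun k => by
    rw [h.coef_eq hf (Finset.mem_univ i), h'.coef_eq hf (Finset.mem_univ i)]

lemma isWeakPartial_weakPartial {i : Fin d} {f : Pt d → ℝ} (h : ∃ g, IsWeakPartial i f g) :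
    IsWeakPartial i f (weakPartial i f) := by
  rw [weakPartial, dif_pos h]; exact h.choose_spec

lemma weakPartial_congr {i : Fin d} {f f' : Pt d → ℝ} (h : f =ᵐ[boxMeasure d] f') :
    weakPartial i f = weakPartial i f' := by
  have : IsWeakPartial i f = IsWeakPartial i f' := funext fun g => propext
    ⟨fun hg => hg.congr h EventuallyEq.rfl, fun hg => hg.congr h.symm EventuallyEq.rfl⟩
  have key : ∀ P Q : (Pt d → ℝ) → Prop, P = Q → ∀ (hP : Decidable (∃ g, P g))
      (hQ : Decidable (∃ g, Q g)), (if h : ∃ g, P g then h.choose else 0) =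
        if h : ∃ g, Q g then h.choose else 0 := by
    rintro P _ rfl hP hQ
    congr
  exact key _ _ this _ _

lemma integrable_mul_of_hasCompactSupport {f φ : Pt d → ℝ} (hf : Integrable f (boxMeasure d))
    (hφ : Continuous φ) (hc : HasCompactSupport φ) :
    Integrable (fun x => f x * φ x) (boxMeasure d) := by
  obtain ⟨B, hB⟩ := hc.exists_bound_of_continuous hφ
  exact hf.mul_bdd (c := B) hφ.aestronglyMeasurable (Eventually.of_forall hB)

lemma contDiff_classicalPartial (i : Fin d) {φ : Pt d → ℝ} (hφ : ContDiff ℝ ∞ φ) :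
    ContDiff ℝ ∞ (classicalPartial i φ) :=
  (hφ.fderiv_right (m := ∞) (by simp)).clm_apply contDiff_const

lemma tsupport_classicalPartial_subset (i : Fin d) (φ : Pt d → ℝ) :
    tsupport (classicalPartial i φ) ⊆ tsupport φ :=
  tsupport_fderiv_apply_subset ℝ _

lemma hasCompactSupport_classicalPartial (i : Fin d) {φ : Pt d → ℝ} (hφ : HasCompactSupport φ) :
    HasCompactSupport (classicalPartial i φ) :=
  hφ.fderiv_apply ℝ _

lemma classicalPartial_comm (i j : Fin d) {φ : Pt d → ℝ} (hφ : ContDiff ℝ ∞ φ) (x : Pt d) :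
    classicalPartial i (classicalPartial j φ) x = classicalPartial j (classicalPartial i φ) x := by
  have hd : DifferentiableAt ℝ (fderiv ℝ φ) x :=
    (hφ.fderiv_right (m := 1)
      (WithTop.coe_le_coe.2 (le_top (a := (1 + 1 : ℕ∞))))).differentiable one_ne_zero x
  have key : ∀ a b : Fin d, classicalPartial a (classicalPartial b φ) x =
      fderiv ℝ (fderiv ℝ φ) x (Pi.single a 1) (Pi.single b 1) := by
    intro a b
    have : HasFDerivAt (classicalPartial b φ) _ x :=
      hd.hasFDerivAt.clm_apply (hasFDerivAt_const (Pi.single b (1 : ℝ) : Pt d) x)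
    rw [classicalPartial, this.fderiv]
    simp
  rw [key, key]
  exact ((hφ.of_le (m := 2) ENat.LEInfty.out).contDiffAt.isSymmSndFDerivAt (by simp)) _ _

lemma IsWeakPartial.sub {i : Fin d} {f f' g g' : Pt d → ℝ} (hf : Integrable f (boxMeasure d))
    (hf' : Integrable f' (boxMeasure d)) (h : IsWeakPartial i f g) (h' : IsWeakPartial i f' g') :
    IsWeakPartial i (fun x => f x - f' x) (fun x => g x - g' x) := by
  refine ⟨h.1.sub h'.1, fun φ h1 h2 h3 => ?_⟩
  have c1 := h1.continuous
  have c2 := (contDiff_classicalPartial i h1).continuous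
  have s2 := hasCompactSupport_classicalPartial i h2
  simp_rw [sub_mul]
  rw [integral_sub (integrable_mul_of_hasCompactSupport hf c2 s2)
      (integrable_mul_of_hasCompactSupport hf' c2 s2),
    integral_sub (integrable_mul_of_hasCompactSupport h.1.integrable_box c1 h2)
      (integrable_mul_of_hasCompactSupport h'.1.integrable_box c1 h2),
    h.2 φ h1 h2 h3, h'.2 φ h1 h2 h3]
  ring

/-- Weak derivatives commute as soon as those on one side exist. -/
lemma IsWeakPartial.comm {i j : Fin d} {f fi fj fij : Pt d → ℝ}
    (hi : IsWeakPartial i f fi) (hj : IsWeakPartial j f fj) (hij : IsWeakPartial i fj fij) :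
    IsWeakPartial j fi fij := by
  refine ⟨hij.1, fun φ h1 h2 h3 => ?_⟩
  rw [← hij.2 φ h1 h2 h3]
  have a1 := hi.2 _ (contDiff_classicalPartial j h1) (hasCompactSupport_classicalPartial j h2)
    ((tsupport_classicalPartial_subset j φ).trans h3)
  have a2 := hj.2 _ (contDiff_classicalPartial i h1) (hasCompactSupport_classicalPartial i h2)
    ((tsupport_classicalPartial_subset i φ).trans h3)
  simp_rw [classicalPartial_comm i j h1] at a1
  rw [a2] at a1
  linarith

end

section

/-! ### Sobolev norms in terms of cosine coefficients -/

/-- `|k|²`, the eigenvalue of `-Δ` for the frequency `k`. -/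
def freqSq (k : Fin d → ℕ) : ℝ := ∑ i, (k i : ℝ) ^ 2

/-- `∑_{i ≤ j} k_i² k_j²`, the symbol of the sum of the squares of the second derivatives. -/
def freqQuad (k : Fin d → ℕ) : ℝ := ∑ i, ∑ j ∈ Finset.Ici i, ((k i : ℝ) * k j) ^ 2

lemma InH.memLp {n : ℕ} {f : Pt d → ℝ} (h : InH n f) : MemLp f 2 (boxMeasure d) := by
  cases n
  · exact h
  · exact h.1

lemma InH.isWeakPartial {n : ℕ} {f : Pt d → ℝ} (h : InH (n + 1) f) (i : Fin d) :
    IsWeakPartial i f (weakPartial i f) := isWeakPartial_weakPartial (h.2 i).1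

lemma InH.weakPartial {n : ℕ} {f : Pt d → ℝ} (h : InH (n + 1) f) (i : Fin d) :
    InH n (weakPartial i f) := (h.2 i).2

lemma InH.of_succ {n : ℕ} : ∀ {f : Pt d → ℝ}, InH (n + 1) f → InH n f := by
  induction n with
  | zero => exact fun h => h.1
  | succ n ih => exact fun h => ⟨h.1, fun i => ⟨(h.2 i).1, ih (h.2 i).2⟩⟩

lemma coef_weakPartial {f : Pt d → ℝ} (h : InH 1 f) {S : Finset (Fin d)} {i : Fin d} (hi : i ∉ S)
    (k : Fin d → ℕ) : coef (insert i S) (weakPartial i f) k = -(k i * coef S f k) := by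
  rw [(h.isWeakPartial i).coef_eq h.memLp.integrable_box (Finset.mem_insert_self i S),
    Finset.erase_insert hi]

/-- For functions that satisfy the Neumann condition the first derivative in `x_i`, a sine series
in `x_i`, may be differentiated term by term once more in the same variable. -/
lemma coef_weakPartial_self {f : Pt d → ℝ} (h : InH 2 f) (hN : Neumann f) (i : Fin d)
    (k : Fin d → ℕ) : coef ∅ (weakPartial i (weakPartial i f)) k = -(k i ^ 2 * coef ∅ f k) := by
  have h1 := hN i (trig ∅ k) (contDiff_trig ∅ k)
  simp_rw [classicalPartial_trig_of_notMem (Finset.notMem_empty i), ← neg_mul] at h1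
  rw [integral_mul_const_mul_trig, coef_weakPartial h.of_succ (Finset.notMem_empty i)] at h1
  rw [coef]
  linear_combination h1

lemma coef_weakPartial_weakPartial_of_ne {f : Pt d → ℝ} (h : InH 2 f) {i j : Fin d} (hij : i ≠ j)
    (k : Fin d → ℕ) :
    coef {i, j} (weakPartial i (weakPartial j f)) k = k i * k j * coef ∅ f k := by
  rw [coef_weakPartial (h.weakPartial j) (by simpa using hij)]
  have := coef_weakPartial h.of_succ (Finset.notMem_empty j) k
  rw [insert_empty_eq] at this
  rw [this]; ring

lemma weakPartial_comm {f : Pt d → ℝ} {i j : Fin d} (hi : ∃ g, IsWeakPartial i f g)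
    (hj : ∃ g, IsWeakPartial j f g) (hij : ∃ g, IsWeakPartial i (weakPartial j f) g) :
    (∃ g, IsWeakPartial j (weakPartial i f) g) ∧
      weakPartial i (weakPartial j f) =ᵐ[boxMeasure d] weakPartial j (weakPartial i f) := by
  have h := (isWeakPartial_weakPartial hi).comm (isWeakPartial_weakPartial hj)
    (isWeakPartial_weakPartial hij)
  exact ⟨⟨_, h⟩, h.unique (isWeakPartial_weakPartial hi).1.integrable_box
    (isWeakPartial_weakPartial ⟨_, h⟩)⟩

lemma hasSum_l2Sq_weakPartial {f : Pt d → ℝ} (h : InH 1 f) (i : Fin d) :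
    HasSum (fun k => (k i * coef ∅ f k) ^ 2) (l2Sq (weakPartial i f)) := by
  have := hasSum_coef_sq (insert i ∅) (h.isWeakPartial i).1
  simpa only [coef_weakPartial h (Finset.notMem_empty i), neg_sq] using this

lemma hasSum_l2Sq_second {f : Pt d → ℝ} (h : InH 2 f) (hN : Neumann f) (i j : Fin d) :
    HasSum (fun k => (k i * k j * coef ∅ f k) ^ 2) (l2Sq (weakPartial i (weakPartial j f))) := by
  have hm : MemLp (weakPartial i (weakPartial j f)) 2 (boxMeasure d) :=
    ((h.weakPartial j).isWeakPartial i).1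
  by_cases hij : i = j
  · subst hij
    have := hasSum_coef_sq ∅ hm
    simp only [coef_weakPartial_self h hN, neg_sq] at this
    simpa only [sq (Nat.cast _)] using this
  · have := hasSum_coef_sq {i, j} hm
    simpa only [coef_weakPartial_weakPartial_of_ne h hij] using this

lemma hasSum_l2Sq_third {f : Pt d → ℝ} (h : InH 3 f) (hN : Neumann f) (l i j : Fin d) :
    HasSum (fun k => (k l * k i * k j * coef ∅ f k) ^ 2)
      (l2Sq (weakPartial l (weakPartial i (weakPartial j f)))) := by
  have h2 : InH 2 f := h.of_succ
  have key : ∀ (l i : Fin d), HasSum (fun k => (k l * (k i ^ 2) * coef ∅ f k) ^ 2)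
      (l2Sq (weakPartial l (weakPartial i (weakPartial i f)))) := by
    intro l i
    have := hasSum_coef_sq (insert l ∅) (((h.weakPartial i).weakPartial i).isWeakPartial l).1
    simp only [coef_weakPartial ((h.weakPartial i).weakPartial i) (Finset.notMem_empty l),
      coef_weakPartial_self h2 hN] at this
    convert this using 2 with k
    ring
  by_cases hij : i = j
  · subst hij
    convert key l i using 2 with k
    ring
  have hc := weakPartial_comm (h.2 i).1 (h.2 j).1 ((h.weakPartial j).2 i).1
  by_cases hli : l = i
  · subst hli
    -- `∂_l ∂_l ∂_j f = ∂_l ∂_j ∂_l f = ∂_j ∂_l ∂_l f`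
    have hc2 := weakPartial_comm ((h.weakPartial l).2 l).1 ((h.weakPartial l).2 j).1
      (((h.weakPartial l).weakPartial j).2 l).1
    rw [weakPartial_congr hc.2, l2Sq_congr hc2.2]
    convert key j l using 2 with k
    ring
  by_cases hlj : l = j
  · subst hlj
    -- `∂_l ∂_i ∂_l f = ∂_i ∂_l ∂_l f`
    have hc2 := weakPartial_comm ((h.weakPartial l).2 l).1 ((h.weakPartial l).2 i).1
      (((h.weakPartial l).weakPartial i).2 l).1
    rw [l2Sq_congr hc2.2]
    convert key i l using 2 with k
    ring
  have := hasSum_coef_sq (insert l {i, j}) (((h.weakPartial j).weakPartial i).isWeakPartial l).1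
  simp only [coef_weakPartial ((h.weakPartial j).weakPartial i)
    (show l ∉ ({i, j} : Finset (Fin d)) by simp [hli, hlj]),
      coef_weakPartial_weakPartial_of_ne h2 hij] at this
  convert this using 2 with k
  ring

lemma hasSum_secondSq {f : Pt d → ℝ} (h : InH 2 f) (hN : Neumann f) :
    HasSum (fun k => freqQuad k * coef ∅ f k ^ 2) (secondSq f) := by
  have : HasSum _ (secondSq f) := hasSum_sum (s := Finset.univ) fun (i : Fin d) _ =>
    hasSum_sum (s := Finset.Ici i) fun j _ => hasSum_l2Sq_second h hN i j
  convert this using 2 with k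
  simp only [freqQuad, Finset.sum_mul, mul_pow]

lemma hasSum_l2Sq {f : Pt d → ℝ} (h : MemLp f 2 (boxMeasure d)) :
    HasSum (fun k => coef ∅ f k ^ 2) (l2Sq f) := hasSum_coef_sq ∅ h

lemma hasSum_h2Sq {f : Pt d → ℝ} (h : InH 2 f) (hN : Neumann f) :
    HasSum (fun k => (1 + freqSq k + freqQuad k) * coef ∅ f k ^ 2) (h2Sq f) := by
  have : HasSum _ (h2Sq f) := ((hasSum_l2Sq h.memLp).add
    (hasSum_sum (s := Finset.univ) fun (i : Fin d) _ =>
      hasSum_l2Sq_weakPartial h.of_succ i)).add (hasSum_secondSq h hN)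
  convert this using 2 with k
  simp only [freqSq, add_mul, Finset.sum_mul, mul_pow, one_mul]

lemma hasSum_gradSecondSq {f : Pt d → ℝ} (h : InH 3 f) (hN : Neumann f) :
    HasSum (fun k => freqSq k * freqQuad k * coef ∅ f k ^ 2) (gradSecondSq f) := by
  have : HasSum _ (gradSecondSq f) := hasSum_sum (s := Finset.univ) fun (i : Fin d) _ =>
    hasSum_sum (s := Finset.Ici i) fun j _ =>
    hasSum_sum (s := Finset.univ) fun l _ => hasSum_l2Sq_third h hN l i j
  convert this using 2 with k
  simp only [freqSq, freqQuad, Finset.sum_mul, Finset.mul_sum]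
  refine Finset.sum_congr rfl fun i _ => Finset.sum_congr rfl fun j _ =>
    Finset.sum_congr rfl fun l _ => by ring

lemma hasSum_thirdSq {f : Pt d → ℝ} (h : InH 3 f) (hN : Neumann f) :
    HasSum (fun k => freqSq k ^ 3 * coef ∅ f k ^ 2) (thirdSq f) := by
  have : HasSum _ (thirdSq f) := hasSum_sum (s := Finset.univ) fun (i : Fin d) _ =>
    hasSum_sum (s := Finset.univ) fun j _ =>
    hasSum_sum (s := Finset.univ) fun l _ => hasSum_l2Sq_third h hN l i j
  convert this using 2 with k
  simp only [freqSq, pow_succ, pow_zero, one_mul, Finset.sum_mul, Finset.mul_sum]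
  refine Finset.sum_congr rfl fun i _ => Finset.sum_congr rfl fun j _ =>
    Finset.sum_congr rfl fun l _ => by ring

lemma freqSq_nonneg (k : Fin d → ℕ) : 0 ≤ freqSq k := Finset.sum_nonneg fun _ _ => sq_nonneg _

lemma freqQuad_nonneg (k : Fin d → ℕ) : 0 ≤ freqQuad k :=
  Finset.sum_nonneg fun _ _ => Finset.sum_nonneg fun _ _ => sq_nonneg _

lemma sq_le_freqSq (k : Fin d → ℕ) (i : Fin d) : (k i : ℝ) ^ 2 ≤ freqSq k :=
  Finset.single_le_sum (f := fun i => (k i : ℝ) ^ 2) (fun _ _ => sq_nonneg _) (Finset.mem_univ i)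

lemma freqQuad_le (k : Fin d → ℕ) : freqQuad k ≤ freqSq k ^ 2 := by
  rw [freqQuad, freqSq, sq, Finset.sum_mul_sum]
  refine Finset.sum_le_sum fun i _ => ?_
  simp_rw [mul_pow]
  exact Finset.sum_le_sum_of_subset_of_nonneg (Finset.subset_univ _) fun _ _ _ => by positivity

lemma pow_four_le_freqQuad (k : Fin d → ℕ) (i : Fin d) : (k i : ℝ) ^ 4 ≤ freqQuad k := by
  have h1 := Finset.single_le_sum (f := fun i => ∑ j ∈ Finset.Ici i, ((k i : ℝ) * k j) ^ 2)
    (fun _ _ => Finset.sum_nonneg fun _ _ => sq_nonneg _) (Finset.mem_univ i)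
  have h2 := Finset.single_le_sum (f := fun j => ((k i : ℝ) * k j) ^ 2) (s := Finset.Ici i)
    (fun _ _ => sq_nonneg _) (Finset.mem_Ici.2 le_rfl)
  calc (k i : ℝ) ^ 4 = ((k i : ℝ) * k i) ^ 2 := by ring
    _ ≤ _ := h2.trans h1

/-- Every nonzero frequency has `|k|² ≥ 1`. -/
lemma freqSq_eq_zero_or_one_le (k : Fin d → ℕ) : k = 0 ∨ 1 ≤ freqSq k := by
  by_cases h : k = 0
  · exact Or.inl h
  · right
    obtain ⟨i, hi⟩ : ∃ i, k i ≠ 0 := by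
      by_contra! hcon
      exact h (funext hcon)
    refine le_trans ?_ (sq_le_freqSq k i)
    exact one_le_pow₀ (by exact_mod_cast Nat.one_le_iff_ne_zero.2 hi)

lemma freqSq_pow_le (k : Fin d → ℕ) {m n : ℕ} (hm : 0 < m) (h : m ≤ n) :
    freqSq k ^ m ≤ freqSq k ^ n := by
  rcases freqSq_eq_zero_or_one_le k with rfl | h1
  · simp [freqSq, hm.ne', (hm.trans_le h).ne']
  · exact pow_le_pow_right₀ h1 h

end

section

/-! ### Lattice sums and the supremum of trigonometric polynomials -/

/-- The frequencies with all entries at most `M`. -/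
def cube (d M : ℕ) : Finset (Fin d → ℕ) := Fintype.piFinset fun _ => Finset.range (M + 1)

lemma mem_cube {M : ℕ} {k : Fin d → ℕ} : k ∈ cube d M ↔ ∀ i, k i ≤ M := by
  simp [cube]

lemma nrm_sq (m : ℕ) : nrm m ^ 2 = if m = 0 then 1 / Real.pi else 2 / Real.pi := by
  have := Real.pi_pos
  unfold nrm
  split_ifs <;> exact Real.sq_sqrt (by positivity)

lemma sum_wt_sq_cube (d M : ℕ) :
    ∑ k ∈ cube d M, wt k ^ 2 = ((2 * M + 1) / Real.pi) ^ d := by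
  have h1 : ∑ m ∈ Finset.range (M + 1), nrm m ^ 2 = (2 * M + 1) / Real.pi := by
    induction M with
    | zero => simp [nrm_sq]
    | succ M ih => rw [Finset.sum_range_succ, ih, nrm_sq, if_neg (by omega)]; push_cast; ring
  have h2 := Finset.prod_univ_sum (fun _ : Fin d => Finset.range (M + 1))
    (fun _ m => nrm m ^ 2)
  rw [Finset.prod_const, h1, Finset.card_univ, Fintype.card_fin] at h2
  simp_rw [wt, ← Finset.prod_pow]
  exact h2.symm

lemma cube_subset (d M : ℕ) : cube d M ⊆ cube d (M + 1) := fun _ hk =>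
  mem_cube.2 fun i => (mem_cube.1 hk i).trans (Nat.le_succ M)

lemma exists_subset_cube (K : Finset (Fin d → ℕ)) : ∃ M, K ⊆ cube d M :=
  ⟨K.sup fun k => Finset.univ.sup k, fun k hk => mem_cube.2 fun i =>
    (Finset.le_sup (f := k) (Finset.mem_univ i)).trans
      (Finset.le_sup (f := fun k : Fin d → ℕ => Finset.univ.sup k) hk)⟩

/-- Passing from one cube of frequencies to the next, with the weight estimated by its largest
value on the shell between them. -/
lemma sum_cube_succ_le {ϱ : (Fin d → ℕ) → ℝ} {c : ℝ} (M : ℕ)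
    (h : ∀ k : Fin d → ℕ, (∃ i, k i = M + 1) → ϱ k ≤ c) :
    ∑ k ∈ cube d (M + 1), wt k ^ 2 * ϱ k ≤ ∑ k ∈ cube d M, wt k ^ 2 * ϱ k +
      (((2 * M + 3) / Real.pi) ^ d - ((2 * M + 1) / Real.pi) ^ d) * c := by
  rw [← Finset.sum_sdiff (cube_subset d M), add_comm]
  refine add_le_add le_rfl ?_
  have h1 : ∑ k ∈ cube d (M + 1) \ cube d M, wt k ^ 2 =
      ((2 * M + 3) / Real.pi) ^ d - ((2 * M + 1) / Real.pi) ^ d := by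
    have := Finset.sum_sdiff (cube_subset d M) (f := fun k => wt k ^ 2)
    rw [sum_wt_sq_cube, sum_wt_sq_cube] at this
    rw [eq_sub_iff_add_eq, this]
    push_cast; ring
  rw [← h1, Finset.sum_mul]
  refine Finset.sum_le_sum fun k hk => mul_le_mul_of_nonneg_left (h k ?_) (sq_nonneg _)
  rw [Finset.mem_sdiff, mem_cube, mem_cube] at hk
  obtain ⟨h2, h3⟩ := hk
  push Not at h3
  obtain ⟨i, hi⟩ := h3
  exact ⟨i, le_antisymm (h2 i) hi⟩

lemma sum_cube_zero (d : ℕ) (ϱ : (Fin d → ℕ) → ℝ) :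
    ∑ k ∈ cube d 0, wt k ^ 2 * ϱ k = (1 / Real.pi) ^ d * ϱ 0 := by
  have : cube d 0 = {0} := by
    ext k
    simp [mem_cube, funext_iff]
  have h := sum_wt_sq_cube d 0
  rw [this, Finset.sum_singleton] at h ⊢
  rw [h]; simp

lemma one_add_freq_inv_le {m : ℕ} (k : Fin d → ℕ) (h : ∃ i, k i = m) :
    (1 + freqSq k + freqQuad k)⁻¹ ≤ 1 / (1 + (m : ℝ) ^ 2 + (m : ℝ) ^ 4) := by
  obtain ⟨i, rfl⟩ := h
  rw [← one_div]
  exact one_div_le_one_div_of_le (by positivity)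
    (by linarith [sq_le_freqSq k i, pow_four_le_freqQuad k i])

/-- The Sobolev constant of the box in dimensions one to three: the square of the norm of the
embedding `H² ⊂ L^∞` is at most `4 / 5`. That it is less than `1` keeps the values of a function
with small `H²` norm in the disc where the nonlinearities are smooth. -/
lemma sum_wt_sq_inv_le (h1 : 1 ≤ d) (h3 : d ≤ 3) (K : Finset (Fin d → ℕ)) :
    ∑ k ∈ K, wt k ^ 2 * (1 + freqSq k + freqQuad k)⁻¹ ≤ 4 / 5 := by
  have hpi := Real.pi_pos
  have hpi3 := Real.pi_gt_d2
  obtain ⟨M, hM⟩ := exists_subset_cube K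
  refine (Finset.sum_le_sum_of_subset_of_nonneg hM fun k _ _ => mul_nonneg (sq_nonneg _)
    (inv_nonneg.2 (by have := freqSq_nonneg k; have := freqQuad_nonneg k; positivity))).trans ?_
  clear hM
  set ϱ : (Fin d → ℕ) → ℝ := fun k => (1 + freqSq k + freqQuad k)⁻¹ with hϱ
  have h0 : ∑ k ∈ cube d 0, wt k ^ 2 * ϱ k = 1 / Real.pi ^ d := by
    rw [sum_cube_zero]; simp [hϱ, freqSq, freqQuad]
  have hs : ∀ M : ℕ, ∑ k ∈ cube d (M + 1), wt k ^ 2 * ϱ k ≤ ∑ k ∈ cube d M, wt k ^ 2 * ϱ k +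
      ((2 * M + 3) ^ d - (2 * M + 1) ^ d) / (1 + ((M : ℝ) + 1) ^ 2 + ((M : ℝ) + 1) ^ 4) /
        Real.pi ^ d := by
    intro M
    refine (sum_cube_succ_le M fun k hk => one_add_freq_inv_le k hk).trans_eq ?_
    push_cast
    rw [div_pow, div_pow]
    ring
  -- The denominators factor, so that in dimensions one and two the shells are bounded by
  -- telescoping sums, with totals `2 / π` and `5 / π²`. In dimension three the cube with entries
  -- at most `2` is computed, and the rest is compared with `∑ 24 / ((m - 1/2) (m + 1/2))`; the
  -- total is at most `24 / π³`.
  have hfac : ∀ M : ℝ, 1 + (M + 1) ^ 2 + (M + 1) ^ 4 =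
      (M ^ 2 + M + 1) * ((M + 1) ^ 2 + (M + 1) + 1) := fun M => by ring
  obtain rfl | rfl | rfl : d = 1 ∨ d = 2 ∨ d = 3 := by omega
  · have hb : ∀ M : ℕ, ∑ k ∈ cube 1 M, wt k ^ 2 * ϱ k ≤
        (2 - 1 / ((M : ℝ) ^ 2 + M + 1)) / Real.pi ^ 1 := by
      intro M
      induction M with
      | zero => rw [h0]; norm_num
      | succ M ih =>
        refine (hs M).trans ((add_le_add ih le_rfl).trans ?_)
        rw [← add_div]
        refine div_le_div_of_nonneg_right ?_ (by positivity)
        rw [hfac]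
        have e : (1 : ℝ) / (M ^ 2 + M + 1) - 1 / ((M + 1) ^ 2 + (M + 1) + 1) =
            2 * (M + 1) / ((M ^ 2 + M + 1) * ((M + 1) ^ 2 + (M + 1) + 1)) := by
          field_simp; ring
        have e2 : ((2 * (M : ℝ) + 3) ^ 1 - (2 * M + 1) ^ 1) /
            ((M ^ 2 + M + 1) * ((M + 1) ^ 2 + (M + 1) + 1)) ≤
            2 * (M + 1) / ((M ^ 2 + M + 1) * ((M + 1) ^ 2 + (M + 1) + 1)) :=
          div_le_div_of_nonneg_right (by nlinarith [Nat.cast_nonneg (α := ℝ) M]) (by positivity)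
        push_cast
        linarith
    refine (hb M).trans ?_
    rw [div_le_iff₀ (by positivity)]
    have : 0 ≤ 1 / ((M : ℝ) ^ 2 + M + 1) := by positivity
    nlinarith
  · have hb : ∀ M : ℕ, ∑ k ∈ cube 2 M, wt k ^ 2 * ϱ k ≤
        (5 - 4 / ((M : ℝ) ^ 2 + M + 1)) / Real.pi ^ 2 := by
      intro M
      induction M with
      | zero => rw [h0]; norm_num
      | succ M ih =>
        refine (hs M).trans ((add_le_add ih le_rfl).trans ?_)
        rw [← add_div]
        refine div_le_div_of_nonneg_right ?_ (by positivity)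
        rw [hfac]
        have e : (4 : ℝ) / (M ^ 2 + M + 1) - 4 / ((M + 1) ^ 2 + (M + 1) + 1) =
            ((2 * (M : ℝ) + 3) ^ 2 - (2 * M + 1) ^ 2) /
              ((M ^ 2 + M + 1) * ((M + 1) ^ 2 + (M + 1) + 1)) := by
          field_simp; ring
        push_cast
        linarith
    refine (hb M).trans ?_
    rw [div_le_iff₀ (by positivity)]
    have : 0 ≤ 4 / ((M : ℝ) ^ 2 + M + 1) := by positivity
    nlinarith
  · have hpi30 : 30 ≤ Real.pi ^ 3 := by
      have : (3.14 : ℝ) ^ 3 ≤ Real.pi ^ 3 := pow_le_pow_left₀ (by norm_num) hpi3.le 3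
      norm_num at this ⊢; linarith
    have hb : ∀ M : ℕ, ∑ k ∈ cube 3 (M + 2), wt k ^ 2 * ϱ k ≤
        (24 - 24 / ((M : ℝ) + 5 / 2)) / Real.pi ^ 3 := by
      intro M
      induction M with
      | zero =>
        refine (hs 1).trans ((add_le_add (hs 0) le_rfl).trans ?_)
        rw [h0, ← add_div, ← add_div]
        refine div_le_div_of_nonneg_right ?_ (by positivity)
        norm_num
      | succ M ih =>
        refine (hs (M + 2)).trans ((add_le_add ih le_rfl).trans ?_)
        rw [← add_div]
        refine div_le_div_of_nonneg_right ?_ (by positivity)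
        push_cast
        have e : (24 : ℝ) / (M + 5 / 2) - 24 / (M + 1 + 5 / 2) =
            24 / ((M + 5 / 2) * (M + 1 + 5 / 2)) := by
          field_simp; ring
        have e2 : ((2 * ((M : ℝ) + 2) + 3) ^ 3 - (2 * (M + 2) + 1) ^ 3) /
            (1 + ((M : ℝ) + 2 + 1) ^ 2 + (M + 2 + 1) ^ 4) ≤
            24 / ((M + 5 / 2) * (M + 1 + 5 / 2)) := by
          rw [div_le_div_iff₀ (by positivity) (by positivity)]
          have hM := Nat.cast_nonneg (α := ℝ) M
          nlinarith [mul_nonneg hM hM]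
        linarith
    refine (Finset.sum_le_sum_of_subset_of_nonneg
      ((cube_subset 3 M).trans (cube_subset 3 (M + 1))) fun k _ _ => mul_nonneg (sq_nonneg _)
      (inv_nonneg.2 (by
        have := freqSq_nonneg k; have := freqQuad_nonneg k; positivity))).trans ((hb M).trans ?_)
    rw [div_le_iff₀ (by positivity)]
    have : 0 ≤ 24 / ((M : ℝ) + 5 / 2) := by positivity
    nlinarith

/-- The lattice sum behind `∇ : H³ → L^∞`. The frequency `0` does not contribute, because
`0⁻¹ = 0`. -/
lemma sum_wt_sq_div_freqSq_sq_le (h1 : 1 ≤ d) (h3 : d ≤ 3) (K : Finset (Fin d → ℕ)) :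
    ∑ k ∈ K, wt k ^ 2 * (freqSq k ^ 2)⁻¹ ≤ 52 := by
  have hpi := Real.pi_pos
  have hpi3 := Real.pi_gt_three
  obtain ⟨M, hM⟩ := exists_subset_cube K
  refine (Finset.sum_le_sum_of_subset_of_nonneg hM fun k _ _ => by positivity).trans ?_
  clear hM
  have hb : ∑ k ∈ cube d M, wt k ^ 2 * (freqSq k ^ 2)⁻¹ ≤ 52 - 26 / ((M : ℝ) + 1 / 2) := by
    induction M with
    | zero => rw [sum_cube_zero]; simp [freqSq]; norm_num
    | succ M ih =>
      have hs := sum_cube_succ_le (ϱ := fun k : Fin d → ℕ => (freqSq k ^ 2)⁻¹)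
        (c := 1 / ((M : ℝ) + 1) ^ 4) M fun k ⟨i, hi⟩ => by
          have := sq_le_freqSq k i
          rw [hi] at this
          push_cast at this
          rw [← one_div]
          refine one_div_le_one_div_of_le (by positivity) ?_
          calc ((M : ℝ) + 1) ^ 4 = (((M : ℝ) + 1) ^ 2) ^ 2 := by ring
            _ ≤ freqSq k ^ 2 := pow_le_pow_left₀ (by positivity) this 2
      refine hs.trans ((add_le_add ih le_rfl).trans ?_)
      have hM := Nat.cast_nonneg (α := ℝ) M
      have e : (26 : ℝ) / (M + 1 / 2) - 26 / (M + 1 + 1 / 2) =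
          26 / ((M + 1 / 2) * (M + 1 + 1 / 2)) := by
        field_simp; ring
      have e1 : ((2 * (M : ℝ) + 3) / Real.pi) ^ d - ((2 * M + 1) / Real.pi) ^ d ≤
          26 * ((M : ℝ) + 1) ^ 2 := by
        have a1 : ((2 * (M : ℝ) + 3) / Real.pi) ^ d - ((2 * M + 1) / Real.pi) ^ d =
            ((2 * (M : ℝ) + 3) ^ d - (2 * M + 1) ^ d) / Real.pi ^ d := by
          rw [div_pow, div_pow, sub_div]
        rw [a1]
        refine (div_le_self ?_ (one_le_pow₀ (by linarith))).trans ?_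
        · exact sub_nonneg.2 (pow_le_pow_left₀ (by positivity) (by linarith) d)
        · obtain rfl | rfl | rfl : d = 1 ∨ d = 2 ∨ d = 3 := by omega
          all_goals nlinarith [mul_nonneg hM hM]
      have e2 : (((2 * (M : ℝ) + 3) / Real.pi) ^ d - ((2 * M + 1) / Real.pi) ^ d) *
          (1 / ((M : ℝ) + 1) ^ 4) ≤ 26 / ((M + 1 / 2) * (M + 1 + 1 / 2)) := by
        refine (mul_le_mul_of_nonneg_right e1 (by positivity)).trans ?_
        rw [mul_one_div, div_le_div_iff₀ (by positivity) (by positivity)]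
        nlinarith [mul_nonneg hM hM, mul_nonneg (mul_nonneg hM hM) hM,
          mul_nonneg (mul_nonneg hM hM) (mul_nonneg hM hM)]
      push_cast
      linarith
  have : 0 ≤ 26 / ((M : ℝ) + 1 / 2) := by positivity
  linarith

/-- Sobolev's inequality `H² ⊂ L^∞`, in terms of coefficients. -/
lemma sq_sum_abs_mul_wt_le (h1 : 1 ≤ d) (h3 : d ≤ 3) (a : (Fin d → ℕ) → ℝ)
    (K : Finset (Fin d → ℕ)) :
    (∑ k ∈ K, |a k| * wt k) ^ 2 ≤
      4 / 5 * ∑ k ∈ K, (1 + freqSq k + freqQuad k) * a k ^ 2 := by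
  have hp : ∀ k : Fin d → ℕ, 0 < 1 + freqSq k + freqQuad k := fun k => by
    have := freqSq_nonneg k; have := freqQuad_nonneg k; positivity
  have := Finset.sum_sq_le_sum_mul_sum_of_sq_le_mul K (r := fun k => |a k| * wt k)
    (f := fun k => (1 + freqSq k + freqQuad k) * a k ^ 2)
    (g := fun k => wt k ^ 2 * (1 + freqSq k + freqQuad k)⁻¹)
    (fun k _ => mul_nonneg (hp k).le (sq_nonneg _))
    (fun k _ => mul_nonneg (sq_nonneg _) (inv_nonneg.2 (hp k).le)) (fun k _ => by
      have := (hp k).ne'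
      refine le_of_eq ?_
      rw [mul_pow, sq_abs]; field_simp)
  refine this.trans ?_
  rw [mul_comm]
  exact mul_le_mul_of_nonneg_right (sum_wt_sq_inv_le h1 h3 K)
    (Finset.sum_nonneg fun k _ => mul_nonneg (hp k).le (sq_nonneg _))

/-- Sobolev's inequality `∇ : H³ → L^∞`, in terms of coefficients. -/
lemma sq_sum_freq_mul_abs_mul_wt_le (h1 : 1 ≤ d) (h3 : d ≤ 3) (a : (Fin d → ℕ) → ℝ)
    (K : Finset (Fin d → ℕ)) (i : Fin d) :
    (∑ k ∈ K, k i * |a k| * wt k) ^ 2 ≤ 52 * ∑ k ∈ K, freqSq k ^ 3 * a k ^ 2 := by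
  have h0 : ∑ k ∈ K, k i * |a k| * wt k ≤ ∑ k ∈ K, √(freqSq k) * |a k| * wt k :=
    Finset.sum_le_sum fun k _ => by
      have := (wt_pos k).le
      gcongr
      exact Real.le_sqrt_of_sq_le (sq_le_freqSq k i)
  have := Finset.sum_sq_le_sum_mul_sum_of_sq_le_mul K (r := fun k => √(freqSq k) * |a k| * wt k)
    (f := fun k => freqSq k ^ 3 * a k ^ 2)
    (g := fun k => wt k ^ 2 * (freqSq k ^ 2)⁻¹)
    (fun k _ => mul_nonneg (pow_nonneg (freqSq_nonneg k) 3) (sq_nonneg _))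
    (fun k _ => by positivity) (fun k _ => by
      refine le_of_eq ?_
      rw [mul_pow, mul_pow, sq_abs, Real.sq_sqrt (freqSq_nonneg k)]
      rcases (freqSq_nonneg k).eq_or_lt with h | h
      · simp [← h]
      · field_simp)
  refine (pow_le_pow_left₀ (Finset.sum_nonneg fun k _ => ?_) h0 2).trans (this.trans ?_)
  · have := (wt_pos k).le
    positivity
  rw [mul_comm]
  exact mul_le_mul_of_nonneg_right (sum_wt_sq_div_freqSq_sq_le h1 h3 K)
    (Finset.sum_nonneg fun k _ => mul_nonneg (pow_nonneg (freqSq_nonneg k) 3) (sq_nonneg _))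

end

section

/-! ### Integration by parts on the box -/

lemma box_subset_Icc : box d ⊆ Icc (0 : Pt d) (fun _ => Real.pi) := fun _ hx =>
  ⟨fun i => (hx i trivial).1.le, fun i => (hx i trivial).2.le⟩

lemma integrable_of_continuous {f : Pt d → ℝ} (hf : Continuous f) :
    Integrable f (boxMeasure d) :=
  (hf.integrableOn_Icc (a := (0 : Pt d)) (b := fun _ => Real.pi)).mono_set box_subset_Icc

lemma memLp_of_continuous {f : Pt d → ℝ} (hf : Continuous f) : MemLp f 2 (boxMeasure d) :=
  (memLp_two_iff_integrable_sq hf.aestronglyMeasurable).2 (integrable_of_continuous (hf.pow 2))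

lemma continuous_classicalPartial (i : Fin d) {f : Pt d → ℝ} (hf : ContDiff ℝ 1 f) :
    Continuous (classicalPartial i f) :=
  (hf.continuous_fderiv one_ne_zero).clm_apply continuous_const

/-- The divergence theorem for a field that vanishes on the two faces where `x_i = 0, π`. -/
lemma integral_classicalPartial_eq_zero {f : Pt d → ℝ} (hf : ContDiff ℝ 1 f) (i : Fin d)
    (h0 : ∀ x : Pt d, x i = 0 ∨ x i = Real.pi → f x = 0) :
    ∫ x, classicalPartial i f x ∂(boxMeasure d) = 0 := by
  obtain ⟨n, rfl⟩ : ∃ n, d = n + 1 := ⟨d - 1, by have := i.pos; omega⟩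
  have hle : (0 : Pt (n + 1)) ≤ fun _ => Real.pi := fun _ => Real.pi_pos.le
  have hsum : ∀ x : Pt (n + 1),
      ∑ j, (if j = i then fderiv ℝ f x else 0) (Pi.single j 1) = classicalPartial i f x := by
    intro x
    rw [Finset.sum_eq_single i]
    · simp [classicalPartial]
    · intro j _ hj; simp [hj]
    · simp
  have := integral_divergence_of_hasFDerivAt_off_countable' (0 : Pt (n + 1)) (fun _ => Real.pi) hle
    (fun j x => if j = i then f x else 0) (fun j x => if j = i then fderiv ℝ f x else 0) ∅
    countable_empty (fun j => ?_) (fun x _ j => ?_) ?_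
  · simp_rw [hsum] at this
    rw [boxMeasure, ← setIntegral_congr_set (s := Icc (0 : Pt (n + 1)) (fun _ => Real.pi))
      (by rw [volume_pi]; exact (Measure.univ_pi_Ioo_ae_eq_Icc (f := 0)
            (g := fun _ : Fin (n + 1) => Real.pi)).symm)]
    rw [this]
    refine Finset.sum_eq_zero fun j _ => ?_
    by_cases hj : j = i
    · subst hj
      have h1 : ∀ y, f (j.insertNth Real.pi y) = 0 := fun y => h0 _ (Or.inr (by simp))
      have h2 : ∀ y, f (j.insertNth 0 y) = 0 := fun y => h0 _ (Or.inl (by simp))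
      simp [h1, h2]
    · simp [hj]
  · by_cases hj : j = i
    · simpa [hj] using hf.continuous.continuousOn
    · simpa [hj] using continuousOn_const
  · by_cases hj : j = i
    · simpa [hj] using (hf.differentiable one_ne_zero x).hasFDerivAt
    · simpa [hj] using hasFDerivAt_const (0 : ℝ) x
  · simp_rw [hsum]
    exact (continuous_classicalPartial i hf).integrableOn_Icc

lemma classicalPartial_mul (i : Fin d) {f g : Pt d → ℝ} {x : Pt d} (hf : DifferentiableAt ℝ f x)
    (hg : DifferentiableAt ℝ g x) : classicalPartial i (fun x => f x * g x) x =
      classicalPartial i f x * g x + f x * classicalPartial i g x := by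
  rw [classicalPartial, (hf.hasFDerivAt.fun_mul hg.hasFDerivAt).fderiv]
  simp only [classicalPartial, add_apply, smul_apply, smul_eq_mul]
  ring

lemma integral_classicalPartial_mul {f g : Pt d → ℝ} (hf : ContDiff ℝ 1 f) (hg : ContDiff ℝ 1 g)
    (i : Fin d) (h0 : ∀ x : Pt d, x i = 0 ∨ x i = Real.pi → f x * g x = 0) :
    ∫ x, classicalPartial i f x * g x ∂(boxMeasure d) =
      -∫ x, f x * classicalPartial i g x ∂(boxMeasure d) := by
  have := integral_classicalPartial_eq_zero (hf.mul hg) i h0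
  have e : ∀ x, classicalPartial i (fun x => f x * g x) x =
      classicalPartial i f x * g x + f x * classicalPartial i g x := fun x =>
    classicalPartial_mul i (hf.differentiable one_ne_zero x) (hg.differentiable one_ne_zero x)
  simp_rw [e] at this
  have i1 : Integrable (fun x => classicalPartial i f x * g x) (boxMeasure d) :=
    integrable_of_continuous ((continuous_classicalPartial i hf).mul hg.continuous)
  have i2 : Integrable (fun x => f x * classicalPartial i g x) (boxMeasure d) :=
    integrable_of_continuous (hf.continuous.mul (continuous_classicalPartial i hg))
  rw [integral_add i1 i2] at this
  linarith

lemma contDiff_classicalPartial_of_succ (i : Fin d) {m n : WithTop ℕ∞} {f : Pt d → ℝ}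
    (hf : ContDiff ℝ n f) (h : m + 1 ≤ n) : ContDiff ℝ m (classicalPartial i f) :=
  (hf.fderiv_right h).clm_apply contDiff_const

lemma trig_eq_zero_of_face {S : Finset (Fin d)} {i : Fin d} (hi : i ∈ S) (k : Fin d → ℕ)
    {x : Pt d} (hx : x i = 0 ∨ x i = Real.pi) : trig S k x = 0 := by
  have : mode S k x = 0 := Finset.prod_eq_zero (Finset.mem_univ i) (by
    rcases hx with hx | hx <;> simp [hi, hx, Real.sin_nat_mul_pi])
  rw [trig, this, mul_zero]

lemma trigPoly_eq_zero_of_face {S : Finset (Fin d)} {i : Fin d} (hi : i ∈ S)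
    (c : (Fin d → ℕ) → ℝ) (K : Finset (Fin d → ℕ)) {x : Pt d} (hx : x i = 0 ∨ x i = Real.pi) :
    trigPoly S c K x = 0 :=
  Finset.sum_eq_zero fun k _ => by rw [trig_eq_zero_of_face hi k hx, mul_zero]

lemma classicalPartial_trigPoly (i : Fin d) (S : Finset (Fin d)) (c : (Fin d → ℕ) → ℝ)
    (K : Finset (Fin d → ℕ)) (x : Pt d) :
    classicalPartial i (trigPoly S c K) x = ∑ k ∈ K, c k * classicalPartial i (trig S k) x := by
  have h : HasFDerivAt (trigPoly S c K) (∑ k ∈ K, c k • fderiv ℝ (trig S k) x) x := by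
    have := HasFDerivAt.fun_sum (u := K) (A := fun k x => c k * trig S k x)
      (A' := fun k => c k • fderiv ℝ (trig S k) x) (x := x) fun k _ =>
      (((contDiff_trig S k (n := 1)).differentiable one_ne_zero x).hasFDerivAt.const_mul (c k))
    exact this
  rw [classicalPartial, h.fderiv]
  simp [classicalPartial]

lemma classicalPartial_trigPoly_of_mem {S : Finset (Fin d)} {i : Fin d} (hi : i ∈ S)
    (c : (Fin d → ℕ) → ℝ) (K : Finset (Fin d → ℕ)) :
    classicalPartial i (trigPoly S c K) = trigPoly (S.erase i) (fun k => k i * c k) K := by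
  ext x
  rw [classicalPartial_trigPoly, trigPoly]
  exact Finset.sum_congr rfl fun k _ => by rw [classicalPartial_trig_of_mem hi]; ring

lemma classicalPartial_trigPoly_of_notMem {S : Finset (Fin d)} {i : Fin d} (hi : i ∉ S)
    (c : (Fin d → ℕ) → ℝ) (K : Finset (Fin d → ℕ)) :
    classicalPartial i (trigPoly S c K) = trigPoly (insert i S) (fun k => -(k i * c k)) K := by
  ext x
  rw [classicalPartial_trigPoly, trigPoly]
  exact Finset.sum_congr rfl fun k _ => by rw [classicalPartial_trig_of_notMem hi]; ring

lemma classicalPartial_classicalPartial_trig (i : Fin d) (S : Finset (Fin d)) (k : Fin d → ℕ)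
    (x : Pt d) :
    classicalPartial i (classicalPartial i (trig S k)) x = -(k i ^ 2 * trig S k x) := by
  by_cases hi : i ∈ S
  · have e : classicalPartial i (trig S k) = fun x => k i * trig (S.erase i) k x :=
      funext (classicalPartial_trig_of_mem hi k)
    rw [e, classicalPartial_const_mul i _
        ((contDiff_trig _ k (n := 1)).differentiable one_ne_zero x),
      classicalPartial_trig_of_notMem (Finset.notMem_erase i S), Finset.insert_erase hi]
    ring
  · have e : classicalPartial i (trig S k) = fun x => -(k i : ℝ) * trig (insert i S) k x :=
      funext fun x => by rw [classicalPartial_trig_of_notMem hi]; ring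
    rw [e, classicalPartial_const_mul i _
        ((contDiff_trig _ k (n := 1)).differentiable one_ne_zero x),
      classicalPartial_trig_of_mem (Finset.mem_insert_self i S), Finset.erase_insert hi]
    ring

/-- Green's formula against a mode. The mode is a sine or a cosine in `x_j`, and `p` or `∂_j p`
respectively has to vanish on the faces. -/
lemma coef_classicalPartial_classicalPartial {p : Pt d → ℝ} (hp : ContDiff ℝ 2 p)
    {S : Finset (Fin d)} (j : Fin d)
    (h0 : ∀ x : Pt d, x j = 0 ∨ x j = Real.pi →
      if j ∈ S then p x = 0 else classicalPartial j p x = 0) (k : Fin d → ℕ) :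
    coef S (classicalPartial j (classicalPartial j p)) k = -(k j ^ 2 * coef S p k) := by
  have hp1 : ContDiff ℝ 1 (classicalPartial j p) :=
    contDiff_classicalPartial_of_succ j hp (by norm_num)
  have ht : ContDiff ℝ 1 (classicalPartial j (trig S k)) :=
    contDiff_classicalPartial_of_succ j (contDiff_trig S k (n := 2)) (by norm_num)
  have hz : ∀ x : Pt d, x j = 0 ∨ x j = Real.pi → classicalPartial j p x * trig S k x = 0 ∧
      p x * classicalPartial j (trig S k) x = 0 := by
    intro x hx
    have := h0 x hx
    by_cases hj : j ∈ S
    · rw [if_pos hj] at this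
      rw [this, trig_eq_zero_of_face hj k hx]; simp
    · rw [if_neg hj] at this
      rw [this, classicalPartial_trig_of_notMem hj,
        trig_eq_zero_of_face (Finset.mem_insert_self j S) k hx]; simp
  rw [coef, integral_classicalPartial_mul hp1 (contDiff_trig S k) j fun x hx => (hz x hx).1,
    integral_classicalPartial_mul (hp.of_le (by norm_num)) ht j fun x hx => (hz x hx).2]
  simp_rw [classicalPartial_classicalPartial_trig, ← neg_mul]
  rw [integral_mul_const_mul_trig, neg_neg, neg_mul]

lemma coef_classicalPartial_insert {p : Pt d → ℝ} (hp : ContDiff ℝ 1 p) {S : Finset (Fin d)}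
    {j : Fin d} (hj : j ∉ S) (k : Fin d → ℕ) :
    coef (insert j S) (classicalPartial j p) k = -(k j * coef S p k) := by
  rw [coef, integral_classicalPartial_mul hp (contDiff_trig _ k) j fun x hx => by
    rw [trig_eq_zero_of_face (Finset.mem_insert_self j S) k hx, mul_zero]]
  simp_rw [classicalPartial_trig_of_mem (Finset.mem_insert_self j S), Finset.erase_insert hj]
  rw [integral_mul_const_mul_trig]

/-- A Gagliardo-Nirenberg inequality, `‖∂_j f‖_4² ≤ 3 ‖f‖_∞ ‖∂_j² f‖`, for functions with vanishing
normal derivative: integrate `∂_j (f (∂_j f)³)`. -/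
lemma integral_classicalPartial_pow_four_le {f : Pt d → ℝ} (hf : ContDiff ℝ 2 f) (j : Fin d)
    (h0 : ∀ x : Pt d, x j = 0 ∨ x j = Real.pi → classicalPartial j f x = 0) {α : ℝ}
    (hα : ∀ x, f x ^ 2 ≤ α) :
    ∫ x, classicalPartial j f x ^ 4 ∂(boxMeasure d) ≤
      9 * α * l2Sq (classicalPartial j (classicalPartial j f)) := by
  have hf1 : ContDiff ℝ 1 (classicalPartial j f) :=
    contDiff_classicalPartial_of_succ j hf (by norm_num)
  have hf2 : Continuous (classicalPartial j (classicalPartial j f)) :=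
    continuous_classicalPartial j hf1
  have h1 := integral_classicalPartial_mul (hf.of_le (by norm_num : (1 : WithTop ℕ∞) ≤ 2))
    (hf1.pow 3) j fun x hx => by rw [h0 x hx]; ring
  have e : ∀ x, classicalPartial j (fun x => classicalPartial j f x ^ 3) x =
      3 * classicalPartial j f x ^ 2 * classicalPartial j (classicalPartial j f) x := by
    intro x
    rw [classicalPartial, ((hf1.differentiable one_ne_zero x).hasFDerivAt.pow 3).fderiv]
    simp [classicalPartial]
  simp_rw [e] at h1
  have e2 : ∀ x, classicalPartial j f x * classicalPartial j f x ^ 3 =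
      classicalPartial j f x ^ 4 := fun x => by ring
  simp_rw [e2] at h1
  have i1 : Integrable (fun x => classicalPartial j f x ^ 4) (boxMeasure d) :=
    integrable_of_continuous (hf1.continuous.pow 4)
  have i2 : Integrable (fun x => classicalPartial j (classicalPartial j f) x ^ 2) (boxMeasure d) :=
    integrable_of_continuous (hf2.pow 2)
  have h2 : -∫ x, f x * (3 * classicalPartial j f x ^ 2 *
      classicalPartial j (classicalPartial j f) x) ∂(boxMeasure d) ≤
      ∫ x, (1 / 2 * classicalPartial j f x ^ 4 + 9 / 2 * α *
        classicalPartial j (classicalPartial j f) x ^ 2) ∂(boxMeasure d) := by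
    rw [← integral_neg]
    refine integral_mono (integrable_of_continuous ?_) ((i1.const_mul _).add (i2.const_mul _))
      fun x => ?_
    · exact (hf.continuous.mul ((continuous_const.mul (hf1.continuous.pow 2)).mul hf2)).neg
    · have := mul_le_mul_of_nonneg_right (hα x)
        (sq_nonneg (classicalPartial j (classicalPartial j f) x))
      have := sq_nonneg (classicalPartial j f x ^ 2 +
        3 * (f x * classicalPartial j (classicalPartial j f) x))
      simp only
      nlinarith
  rw [← h1, integral_add (i1.const_mul _) (i2.const_mul _), integral_const_mul,
    integral_const_mul] at h2
  rw [l2Sq]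
  linarith

end

section

/-! ### Nonlinear functions of trigonometric polynomials -/

/-- `h` is of class `C²` at the points of the disc of radius `η` around `W`, where `M` bounds its
value and the norms of its first two derivatives. -/
structure C2BoundOn (h : Plane → ℝ) (W : Plane) (η M : ℝ) : Prop where
  contDiffAt : ∀ z ∈ Metric.closedBall W η, ContDiffAt ℝ 2 h z
  abs_le : ∀ z ∈ Metric.closedBall W η, |h z| ≤ M
  norm_fderiv_le : ∀ z ∈ Metric.closedBall W η, ‖fderiv ℝ h z‖ ≤ M
  norm_fderiv_fderiv_le : ∀ z ∈ Metric.closedBall W η, ‖fderiv ℝ (fderiv ℝ h) z‖ ≤ M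

lemma norm_pair_le (a b : ℝ) : ‖(!₂[a, b] : Plane)‖ ≤ |a| + |b| := by
  rw [EuclideanSpace.norm_eq]
  refine Real.sqrt_le_iff.2 ⟨by positivity, ?_⟩
  simp only [Fin.sum_univ_two, Real.norm_eq_abs, sq_abs]
  simp
  nlinarith [sq_abs a, sq_abs b, mul_nonneg (abs_nonneg a) (abs_nonneg b)]

lemma norm_pair_sq (a b : ℝ) : ‖(!₂[a, b] : Plane)‖ ^ 2 = a ^ 2 + b ^ 2 := by
  rw [EuclideanSpace.norm_sq_eq]
  simp

lemma pair_add_mem_closedBall {a b η : ℝ} {W : Plane} (hη : 0 ≤ η) (h : a ^ 2 + b ^ 2 ≤ η ^ 2) :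
    !₂[a, b] + W ∈ Metric.closedBall W η := by
  rw [mem_closedBall_iff_norm, add_sub_cancel_right]
  exact abs_le_of_sq_le_sq' (by rwa [norm_pair_sq]) hη |>.2

lemma pair_eq (a b : ℝ) : (!₂[a, b] : Plane) =
    a • EuclideanSpace.single 0 1 + b • EuclideanSpace.single 1 1 := by
  ext i
  fin_cases i <;> simp

lemma contDiff_pair {n : WithTop ℕ∞} {U V : Pt d → ℝ} (hU : ContDiff ℝ n U) (hV : ContDiff ℝ n V) :
    ContDiff ℝ n fun x => (!₂[U x, V x] : Plane) := by
  simp_rw [pair_eq]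
  exact (hU.smul contDiff_const).add (hV.smul contDiff_const)

lemma fderiv_pair {U V : Pt d → ℝ} {x : Pt d} (hU : DifferentiableAt ℝ U x)
    (hV : DifferentiableAt ℝ V x) (j : Fin d) :
    ∃ L : Pt d →L[ℝ] Plane, HasFDerivAt (fun x => (!₂[U x, V x] : Plane)) L x ∧
      L (Pi.single j 1) = !₂[classicalPartial j U x, classicalPartial j V x] := by
  simp_rw [pair_eq]
  exact ⟨_, (hU.hasFDerivAt.smul_const _).add (hV.hasFDerivAt.smul_const _), by
    simp [classicalPartial]⟩

variable {D : Plane → ℝ} {W : Plane} {η M : ℝ} {U V : Pt d → ℝ}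

lemma C2BoundOn.nonneg (hD : C2BoundOn D W η M) (hη : 0 ≤ η) : 0 ≤ M :=
  (abs_nonneg _).trans (hD.abs_le W (Metric.mem_closedBall_self hη))

lemma C2BoundOn.differentiableAt (hD : C2BoundOn D W η M) {z : Plane}
    (hz : z ∈ Metric.closedBall W η) : DifferentiableAt ℝ D z :=
  (hD.contDiffAt z hz).differentiableAt (by norm_num)

lemma C2BoundOn.differentiableAt_fderiv (hD : C2BoundOn D W η M) {z : Plane}
    (hz : z ∈ Metric.closedBall W η) : DifferentiableAt ℝ (fderiv ℝ D) z :=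
  ((hD.contDiffAt z hz).fderiv_right (m := 1) (by norm_num)).differentiableAt (by norm_num)

lemma C2BoundOn.abs_sub_le (hD : C2BoundOn D W η M) {z z' : Plane}
    (hz : z ∈ Metric.closedBall W η) (hz' : z' ∈ Metric.closedBall W η) :
    |D z - D z'| ≤ M * ‖z - z'‖ :=
  (convex_closedBall W η).norm_image_sub_le_of_norm_fderiv_le
    (fun _ h => hD.differentiableAt h) hD.norm_fderiv_le hz' hz

lemma C2BoundOn.norm_fderiv_sub_le (hD : C2BoundOn D W η M) {z z' : Plane}
    (hz : z ∈ Metric.closedBall W η) (hz' : z' ∈ Metric.closedBall W η) :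
    ‖fderiv ℝ D z - fderiv ℝ D z'‖ ≤ M * ‖z - z'‖ :=
  (convex_closedBall W η).norm_image_sub_le_of_norm_fderiv_le
    (fun _ h => hD.differentiableAt_fderiv h) hD.norm_fderiv_fderiv_le hz' hz

lemma C2BoundOn.contDiff_comp (hD : C2BoundOn D W η M) (hU : ContDiff ℝ 2 U) (hV : ContDiff ℝ 2 V)
    (hw : ∀ x, !₂[U x, V x] + W ∈ Metric.closedBall W η) :
    ContDiff ℝ 2 fun x => D (!₂[U x, V x] + W) :=
  contDiff_iff_contDiffAt.2 fun x => (hD.contDiffAt _ (hw x)).comp x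
    ((contDiff_pair hU hV).add contDiff_const).contDiffAt

lemma C2BoundOn.classicalPartial_comp (hD : C2BoundOn D W η M) {x : Pt d}
    (hU : DifferentiableAt ℝ U x) (hV : DifferentiableAt ℝ V x)
    (hw : !₂[U x, V x] + W ∈ Metric.closedBall W η) (j : Fin d) :
    classicalPartial j (fun x => D (!₂[U x, V x] + W)) x =
      fderiv ℝ D (!₂[U x, V x] + W) !₂[classicalPartial j U x, classicalPartial j V x] := by
  obtain ⟨L, hL, hLj⟩ := fderiv_pair hU hV j
  have := (hD.differentiableAt hw).hasFDerivAt.comp x (hL.add_const W)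
  rw [classicalPartial, show fderiv ℝ (fun x => D (!₂[U x, V x] + W)) x = _ from this.fderiv,
    ContinuousLinearMap.comp_apply, hLj]

lemma C2BoundOn.classicalPartial_classicalPartial_comp (hD : C2BoundOn D W η M)
    (hU : ContDiff ℝ 2 U) (hV : ContDiff ℝ 2 V)
    (hw : ∀ x, !₂[U x, V x] + W ∈ Metric.closedBall W η) (j : Fin d) (x : Pt d) :
    classicalPartial j (classicalPartial j fun x => D (!₂[U x, V x] + W)) x =
      fderiv ℝ (fderiv ℝ D) (!₂[U x, V x] + W) !₂[classicalPartial j U x, classicalPartial j V x]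
        !₂[classicalPartial j U x, classicalPartial j V x] +
      fderiv ℝ D (!₂[U x, V x] + W) !₂[classicalPartial j (classicalPartial j U) x,
        classicalPartial j (classicalPartial j V) x] := by
  have dU : Differentiable ℝ U := hU.differentiable (by norm_num)
  have dV : Differentiable ℝ V := hV.differentiable (by norm_num)
  have dU' : Differentiable ℝ (classicalPartial j U) :=
    (contDiff_classicalPartial_of_succ j hU (m := 1) (by norm_num)).differentiable (by norm_num)
  have dV' : Differentiable ℝ (classicalPartial j V) :=
    (contDiff_classicalPartial_of_succ j hV (m := 1) (by norm_num)).differentiable (by norm_num)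
  have e : (classicalPartial j fun x => D (!₂[U x, V x] + W)) = fun x =>
      fderiv ℝ D (!₂[U x, V x] + W) !₂[classicalPartial j U x, classicalPartial j V x] :=
    funext fun x => hD.classicalPartial_comp (dU x) (dV x) (hw x) j
  rw [e]
  obtain ⟨L, hL, hLj⟩ := fderiv_pair (dU x) (dV x) j
  obtain ⟨L', hL', hLj'⟩ := fderiv_pair (dU' x) (dV' x) j
  have h1 : HasFDerivAt (fun x => fderiv ℝ D (!₂[U x, V x] + W)) _ x :=
    (hD.differentiableAt_fderiv (hw x)).hasFDerivAt.comp x (hL.add_const W)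
  rw [classicalPartial, (h1.clm_apply hL').fderiv]
  simp only [add_apply, ContinuousLinearMap.comp_apply, ContinuousLinearMap.flip_apply, hLj, hLj']
  ring

lemma sq_add_three_le (x y z : ℝ) : (x + y + z) ^ 2 ≤ 3 * (x ^ 2 + y ^ 2 + z ^ 2) := by
  nlinarith [sq_nonneg (x - y), sq_nonneg (x - z), sq_nonneg (y - z)]

lemma sq_add_two_le (x y : ℝ) : (x + y) ^ 2 ≤ 2 * (x ^ 2 + y ^ 2) := by
  nlinarith [sq_nonneg (x - y)]

lemma classicalPartial_add (i : Fin d) {f g : Pt d → ℝ} {x : Pt d} (hf : DifferentiableAt ℝ f x)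
    (hg : DifferentiableAt ℝ g x) : classicalPartial i (fun x => f x + g x) x =
      classicalPartial i f x + classicalPartial i g x := by
  simp [classicalPartial, fderiv_fun_add hf hg]

/-- The pointwise form of the estimate of `∂_j² ((D(w + W) - D(W)) P)`. -/
lemma C2BoundOn.sq_second_partial_mul_le (hD : C2BoundOn D W η M) (hη : 0 ≤ η)
    (hU : ContDiff ℝ 2 U) (hV : ContDiff ℝ 2 V)
    (hw : ∀ x, !₂[U x, V x] + W ∈ Metric.closedBall W η) {P : Pt d → ℝ} (hP : ContDiff ℝ 2 P)
    (j : Fin d) {α β : ℝ} {x : Pt d} (hα : U x ^ 2 + V x ^ 2 ≤ α) (hPβ : P x ^ 2 ≤ β)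
    (hβ : classicalPartial j U x ^ 2 + classicalPartial j V x ^ 2 ≤ β) :
    classicalPartial j (classicalPartial j fun x => (D (!₂[U x, V x] + W) - D W) * P x) x ^ 2 ≤
      3 * M ^ 2 * (4 * β * (classicalPartial j U x ^ 4 + classicalPartial j V x ^ 4 +
          classicalPartial j (classicalPartial j U) x ^ 2 +
          classicalPartial j (classicalPartial j V) x ^ 2) +
        8 * β * classicalPartial j P x ^ 2 +
        2 * α * classicalPartial j (classicalPartial j P) x ^ 2) := by
  have hM := hD.nonneg hη
  have hQ : ContDiff ℝ 2 fun x => D (!₂[U x, V x] + W) - D W :=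
    (hD.contDiff_comp hU hV hw).sub contDiff_const
  have dQ := hQ.differentiable (by norm_num)
  have dP := hP.differentiable (by norm_num)
  have dQ' := (contDiff_classicalPartial_of_succ j hQ (m := 1) (by norm_num)).differentiable
    (by norm_num)
  have dP' := (contDiff_classicalPartial_of_succ j hP (m := 1) (by norm_num)).differentiable
    (by norm_num)
  have hsub : (classicalPartial j fun x => D (!₂[U x, V x] + W) - D W) =
      classicalPartial j fun x => D (!₂[U x, V x] + W) := by
    ext y
    exact congrArg (fun L : Pt d →L[ℝ] ℝ => L (Pi.single j 1))
      (fderiv_sub_const (f := fun x => D (!₂[U x, V x] + W)) (D W))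
  have e1 : (classicalPartial j fun x => (D (!₂[U x, V x] + W) - D W) * P x) = fun x =>
      (classicalPartial j fun x => D (!₂[U x, V x] + W) - D W) x * P x +
        (D (!₂[U x, V x] + W) - D W) * classicalPartial j P x :=
    funext fun y => classicalPartial_mul j (dQ y) (dP y)
  have e2 : classicalPartial j (classicalPartial j fun x => (D (!₂[U x, V x] + W) - D W) * P x) x =
      (classicalPartial j (classicalPartial j fun x => D (!₂[U x, V x] + W) - D W)) x * P x +
      2 * ((classicalPartial j fun x => D (!₂[U x, V x] + W) - D W) x * classicalPartial j P x) +
      (D (!₂[U x, V x] + W) - D W) * classicalPartial j (classicalPartial j P) x := by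
    rw [e1, classicalPartial_add j ((dQ' x).fun_mul (dP x)) ((dQ x).fun_mul (dP' x)),
      classicalPartial_mul j (dQ' x) (dP x), classicalPartial_mul j (dQ x) (dP' x)]
    ring
  rw [e2, hsub, hD.classicalPartial_classicalPartial_comp hU hV hw,
    hD.classicalPartial_comp (hU.differentiable (by norm_num) x)
      (hV.differentiable (by norm_num) x) (hw x)]
  set ψ : Plane := !₂[classicalPartial j U x, classicalPartial j V x] with hψ
  set χ : Plane := !₂[classicalPartial j (classicalPartial j U) x,
    classicalPartial j (classicalPartial j V) x] with hχ
  have hψ2 : ‖ψ‖ ^ 2 = _ := norm_pair_sq _ _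
  have hχ2 : ‖χ‖ ^ 2 = _ := norm_pair_sq _ _
  have b1 : |fderiv ℝ (fderiv ℝ D) (!₂[U x, V x] + W) ψ ψ| ≤ M * ‖ψ‖ ^ 2 := by
    rw [sq, ← mul_assoc, ← Real.norm_eq_abs]
    exact ContinuousLinearMap.le_of_opNorm_le _
      (ContinuousLinearMap.le_of_opNorm_le _ (hD.norm_fderiv_fderiv_le _ (hw x)) ψ) ψ
  have b2 : ∀ y : Plane, |fderiv ℝ D (!₂[U x, V x] + W) y| ≤ M * ‖y‖ := fun y =>
    ContinuousLinearMap.le_of_opNorm_le _ (hD.norm_fderiv_le _ (hw x)) y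
  have b3 : |D (!₂[U x, V x] + W) - D W| ≤ M * ‖(!₂[U x, V x] : Plane)‖ := by
    simpa using hD.abs_sub_le (hw x) (Metric.mem_closedBall_self hη)
  have c1 : (fderiv ℝ (fderiv ℝ D) (!₂[U x, V x] + W) ψ ψ) ^ 2 ≤ M ^ 2 * (‖ψ‖ ^ 2) ^ 2 := by
    rw [← mul_pow, ← sq_abs]; exact pow_le_pow_left₀ (abs_nonneg _) b1 2
  have c2 : ∀ y : Plane, (fderiv ℝ D (!₂[U x, V x] + W) y) ^ 2 ≤ M ^ 2 * ‖y‖ ^ 2 := fun y => by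
    rw [← mul_pow, ← sq_abs]; exact pow_le_pow_left₀ (abs_nonneg _) (b2 y) 2
  have c3 : (D (!₂[U x, V x] + W) - D W) ^ 2 ≤ M ^ 2 * (U x ^ 2 + V x ^ 2) := by
    rw [← norm_pair_sq, ← mul_pow, ← sq_abs]; exact pow_le_pow_left₀ (abs_nonneg _) b3 2
  have hβ0 : 0 ≤ β := (sq_nonneg _).trans hPβ
  have d1 : ((fderiv ℝ (fderiv ℝ D) (!₂[U x, V x] + W) ψ ψ +
      fderiv ℝ D (!₂[U x, V x] + W) χ) * P x) ^ 2 ≤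
      M ^ 2 * (4 * β * (classicalPartial j U x ^ 4 + classicalPartial j V x ^ 4 +
          classicalPartial j (classicalPartial j U) x ^ 2 +
          classicalPartial j (classicalPartial j V) x ^ 2)) := by
    have s1 := sq_add_two_le (fderiv ℝ (fderiv ℝ D) (!₂[U x, V x] + W) ψ ψ)
      (fderiv ℝ D (!₂[U x, V x] + W) χ)
    have s2 := c2 χ
    rw [hχ2] at s2
    rw [hψ2] at c1
    have s3 := sq_add_two_le (classicalPartial j U x ^ 2) (classicalPartial j V x ^ 2)
    have s4 : (fderiv ℝ (fderiv ℝ D) (!₂[U x, V x] + W) ψ ψ +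
        fderiv ℝ D (!₂[U x, V x] + W) χ) ^ 2 ≤ M ^ 2 * (4 * (classicalPartial j U x ^ 4 +
          classicalPartial j V x ^ 4 + classicalPartial j (classicalPartial j U) x ^ 2 +
          classicalPartial j (classicalPartial j V) x ^ 2)) := by
      have := mul_le_mul_of_nonneg_left s3 (sq_nonneg M)
      nlinarith [mul_nonneg (sq_nonneg M) (sq_nonneg (classicalPartial j (classicalPartial j U) x)),
        mul_nonneg (sq_nonneg M) (sq_nonneg (classicalPartial j (classicalPartial j V) x))]
    rw [mul_pow]
    refine (mul_le_mul s4 hPβ (sq_nonneg _) (by positivity)).trans_eq (by ring)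
  have d2 : (2 * (fderiv ℝ D (!₂[U x, V x] + W) ψ * classicalPartial j P x)) ^ 2 ≤
      M ^ 2 * (8 * β * classicalPartial j P x ^ 2) := by
    have s2 := c2 ψ
    rw [hψ2] at s2
    have s3 := s2.trans (mul_le_mul_of_nonneg_left hβ (sq_nonneg M))
    have s4 := mul_le_mul_of_nonneg_right s3 (sq_nonneg (classicalPartial j P x))
    have s5 : 0 ≤ M ^ 2 * β * classicalPartial j P x ^ 2 := by positivity
    rw [mul_pow, mul_pow]
    linarith
  have d3 : ((D (!₂[U x, V x] + W) - D W) * classicalPartial j (classicalPartial j P) x) ^ 2 ≤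
      M ^ 2 * (2 * α * classicalPartial j (classicalPartial j P) x ^ 2) := by
    have s3 := c3.trans (mul_le_mul_of_nonneg_left hα (sq_nonneg M))
    have s4 := mul_le_mul_of_nonneg_right s3
      (sq_nonneg (classicalPartial j (classicalPartial j P) x))
    have s5 : 0 ≤ M ^ 2 * α * classicalPartial j (classicalPartial j P) x ^ 2 := by
      have : 0 ≤ α := le_trans (by positivity) hα
      positivity
    rw [mul_pow]
    linarith
  have := sq_add_three_le ((fderiv ℝ (fderiv ℝ D) (!₂[U x, V x] + W) ψ ψ +
      fderiv ℝ D (!₂[U x, V x] + W) χ) * P x)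
    (2 * (fderiv ℝ D (!₂[U x, V x] + W) ψ * classicalPartial j P x))
    ((D (!₂[U x, V x] + W) - D W) * classicalPartial j (classicalPartial j P) x)
  linarith

end

section

/-! ### Energy estimates for trigonometric polynomials -/

lemma mul_sq_le_freqQuad (k : Fin d → ℕ) (i j : Fin d) : ((k i : ℝ) * k j) ^ 2 ≤ freqQuad k := by
  wlog h : i ≤ j generalizing i j
  · rw [mul_comm]; exact this j i (le_of_not_ge h)
  have h1 := Finset.single_le_sum (f := fun i => ∑ j ∈ Finset.Ici i, ((k i : ℝ) * k j) ^ 2)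
    (fun _ _ => Finset.sum_nonneg fun _ _ => sq_nonneg _) (Finset.mem_univ i)
  exact (Finset.single_le_sum (f := fun j => ((k i : ℝ) * k j) ^ 2) (s := Finset.Ici i)
    (fun _ _ => sq_nonneg _) (Finset.mem_Ici.2 h)).trans h1

lemma classicalPartial_classicalPartial_trigPoly (j : Fin d) (S : Finset (Fin d))
    (c : (Fin d → ℕ) → ℝ) (K : Finset (Fin d → ℕ)) :
    classicalPartial j (classicalPartial j (trigPoly S c K)) =
      trigPoly S (fun k => -(k j ^ 2 * c k)) K := by
  by_cases hj : j ∈ S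
  · rw [classicalPartial_trigPoly_of_mem hj,
      classicalPartial_trigPoly_of_notMem (Finset.notMem_erase j S), Finset.insert_erase hj]
    congr 1; ext k; ring
  · rw [classicalPartial_trigPoly_of_notMem hj,
      classicalPartial_trigPoly_of_mem (Finset.mem_insert_self j S), Finset.erase_insert hj]
    congr 1; ext k; ring

section bounds

lemma sq_trigPoly_le (h1 : 1 ≤ d) (h3 : d ≤ 3) (a : (Fin d → ℕ) → ℝ) (K : Finset (Fin d → ℕ))
    (x : Pt d) : trigPoly ∅ a K x ^ 2 ≤
    4 / 5 * ∑ k ∈ K, (1 + freqSq k + freqQuad k) * a k ^ 2 := by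
  rw [← sq_abs]
  exact (pow_le_pow_left₀ (abs_nonneg _) (abs_trigPoly_le ∅ a K x) 2).trans
    (sq_sum_abs_mul_wt_le h1 h3 a K)

lemma sq_classicalPartial_trigPoly_le (h1 : 1 ≤ d) (h3 : d ≤ 3) (a : (Fin d → ℕ) → ℝ)
    (K : Finset (Fin d → ℕ)) (i : Fin d) (x : Pt d) :
    classicalPartial i (trigPoly ∅ a K) x ^ 2 ≤ 52 * ∑ k ∈ K, freqSq k ^ 3 * a k ^ 2 := by
  rw [← sq_abs, classicalPartial_trigPoly_of_notMem (Finset.notMem_empty i)]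
  refine (pow_le_pow_left₀ (abs_nonneg _) (abs_trigPoly_le _ _ K x) 2).trans ?_
  simp_rw [abs_neg, abs_mul, Nat.abs_cast]
  exact sq_sum_freq_mul_abs_mul_wt_le h1 h3 a K i

variable (a : (Fin d → ℕ) → ℝ) (K : Finset (Fin d → ℕ))

lemma l2Sq_classicalPartial_trigPoly_le (i : Fin d) :
    l2Sq (classicalPartial i (trigPoly ∅ a K)) ≤ ∑ k ∈ K, freqSq k ^ 3 * a k ^ 2 := by
  rw [classicalPartial_trigPoly_of_notMem (Finset.notMem_empty i)]
  refine (l2Sq_trigPoly_le _ _ K).trans (Finset.sum_le_sum fun k _ => ?_)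
  rw [neg_sq, mul_pow]
  refine mul_le_mul_of_nonneg_right ((sq_le_freqSq k i).trans ?_) (sq_nonneg _)
  simpa using freqSq_pow_le k (m := 1) (n := 3) one_pos (by norm_num)

lemma l2Sq_second_trigPoly_le (i j : Fin d) :
    l2Sq (classicalPartial j (classicalPartial i (trigPoly ∅ a K))) ≤
      ∑ k ∈ K, (1 + freqSq k + freqQuad k) * a k ^ 2 := by
  have key : ∀ k : Fin d → ℕ, (k j * (k i * a k)) ^ 2 ≤
      (1 + freqSq k + freqQuad k) * a k ^ 2 := by
    intro k
    rw [← mul_assoc, mul_pow]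
    have := freqSq_nonneg k
    exact mul_le_mul_of_nonneg_right ((mul_sq_le_freqQuad k j i).trans (by linarith)) (sq_nonneg _)
  rw [classicalPartial_trigPoly_of_notMem (Finset.notMem_empty i)]
  by_cases h : j ∈ insert i (∅ : Finset (Fin d))
  · rw [classicalPartial_trigPoly_of_mem h]
    refine (l2Sq_trigPoly_le _ _ K).trans (Finset.sum_le_sum fun k _ => ?_)
    rw [mul_neg, neg_sq]
    exact key k
  · rw [classicalPartial_trigPoly_of_notMem h]
    refine (l2Sq_trigPoly_le _ _ K).trans (Finset.sum_le_sum fun k _ => ?_)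
    rw [mul_neg, neg_neg]
    exact key k

lemma l2Sq_third_trigPoly_le (i j : Fin d) :
    l2Sq (classicalPartial j (classicalPartial j (classicalPartial i (trigPoly ∅ a K)))) ≤
      ∑ k ∈ K, freqSq k ^ 3 * a k ^ 2 := by
  rw [classicalPartial_trigPoly_of_notMem (Finset.notMem_empty i),
    classicalPartial_classicalPartial_trigPoly]
  refine (l2Sq_trigPoly_le _ _ K).trans (Finset.sum_le_sum fun k _ => ?_)
  rw [mul_neg, neg_neg, ← mul_assoc, mul_pow]
  refine mul_le_mul_of_nonneg_right ?_ (sq_nonneg _)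
  calc ((k j : ℝ) ^ 2 * k i) ^ 2 = (k j : ℝ) ^ 2 * (k j : ℝ) ^ 2 * (k i : ℝ) ^ 2 := by ring
    _ ≤ freqSq k * freqSq k * freqSq k := by
        have := freqSq_nonneg k
        gcongr <;> exact sq_le_freqSq k _
    _ = freqSq k ^ 3 := by ring

lemma classicalPartial_trigPoly_face (j : Fin d) {x : Pt d} (hx : x j = 0 ∨ x j = Real.pi) :
    classicalPartial j (trigPoly ∅ a K) x = 0 := by
  rw [classicalPartial_trigPoly_of_notMem (Finset.notMem_empty j)]
  exact trigPoly_eq_zero_of_face (Finset.mem_insert_self j ∅) _ K hx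

lemma classicalPartial_classicalPartial_trigPoly_face {i j : Fin d} (hij : j ≠ i) {x : Pt d}
    (hx : x j = 0 ∨ x j = Real.pi) :
    classicalPartial j (classicalPartial i (trigPoly ∅ a K)) x = 0 := by
  rw [classicalPartial_trigPoly_of_notMem (Finset.notMem_empty i),
    classicalPartial_trigPoly_of_notMem (by simpa using hij)]
  exact trigPoly_eq_zero_of_face (Finset.mem_insert_self j _) _ K hx

end bounds

/-- The `H²` and `H³` sums of the coefficients of a pair of trigonometric polynomials are at most
`X₂` and `X₃`. -/
structure CoeffBound (a b : (Fin d → ℕ) → ℝ) (K : Finset (Fin d → ℕ)) (X₂ X₃ : ℝ) : Prop where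
  two : ∑ k ∈ K, (1 + freqSq k + freqQuad k) * a k ^ 2 +
    ∑ k ∈ K, (1 + freqSq k + freqQuad k) * b k ^ 2 ≤ X₂
  three : ∑ k ∈ K, freqSq k ^ 3 * a k ^ 2 + ∑ k ∈ K, freqSq k ^ 3 * b k ^ 2 ≤ X₃

lemma sum_two_nonneg (a : (Fin d → ℕ) → ℝ) (K : Finset (Fin d → ℕ)) :
    0 ≤ ∑ k ∈ K, (1 + freqSq k + freqQuad k) * a k ^ 2 := Finset.sum_nonneg fun k _ => by
  have := freqSq_nonneg k
  have := freqQuad_nonneg k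
  positivity

lemma sum_three_nonneg (a : (Fin d → ℕ) → ℝ) (K : Finset (Fin d → ℕ)) :
    0 ≤ ∑ k ∈ K, freqSq k ^ 3 * a k ^ 2 := Finset.sum_nonneg fun k _ => by
  have := freqSq_nonneg k
  positivity

lemma integral_linear_combination {f₁ f₂ f₃ f₄ f₅ f₆ : Pt d → ℝ}
    (h₁ : Integrable f₁ (boxMeasure d)) (h₂ : Integrable f₂ (boxMeasure d))
    (h₃ : Integrable f₃ (boxMeasure d)) (h₄ : Integrable f₄ (boxMeasure d))
    (h₅ : Integrable f₅ (boxMeasure d)) (h₆ : Integrable f₆ (boxMeasure d)) (m p q r : ℝ) :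
    Integrable (fun x => m * (p * (f₁ x + f₂ x + f₃ x + f₄ x) + q * f₅ x + r * f₆ x))
      (boxMeasure d) ∧
    ∫ x, m * (p * (f₁ x + f₂ x + f₃ x + f₄ x) + q * f₅ x + r * f₆ x) ∂(boxMeasure d) =
      m * (p * (∫ x, f₁ x ∂(boxMeasure d) + ∫ x, f₂ x ∂(boxMeasure d) +
        ∫ x, f₃ x ∂(boxMeasure d) + ∫ x, f₄ x ∂(boxMeasure d)) +
        q * ∫ x, f₅ x ∂(boxMeasure d) + r * ∫ x, f₆ x ∂(boxMeasure d)) := by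
  have i2 : Integrable (fun x => f₁ x + f₂ x) (boxMeasure d) := h₁.add h₂
  have i3 : Integrable (fun x => f₁ x + f₂ x + f₃ x) (boxMeasure d) := i2.add h₃
  have i4 : Integrable (fun x => f₁ x + f₂ x + f₃ x + f₄ x) (boxMeasure d) := i3.add h₄
  have i5 : Integrable (fun x => p * (f₁ x + f₂ x + f₃ x + f₄ x) + q * f₅ x) (boxMeasure d) :=
    (i4.const_mul p).add (h₅.const_mul q)
  refine ⟨(i5.add (h₆.const_mul r)).const_mul m, ?_⟩
  rw [integral_const_mul, integral_add i5 (h₆.const_mul r), integral_add (i4.const_mul p)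
    (h₅.const_mul q), integral_const_mul, integral_const_mul, integral_const_mul,
    integral_add i3 h₄, integral_add i2 h₃, integral_add h₁ h₂]

section nonlinear

variable {D : Plane → ℝ} {W : Plane} {η M X₂ X₃ : ℝ} {a b c : (Fin d → ℕ) → ℝ}
  {K : Finset (Fin d → ℕ)}

lemma CoeffBound.mem_closedBall (h : CoeffBound a b K X₂ X₃) (h1 : 1 ≤ d) (h3 : d ≤ 3)
    (hη : 0 ≤ η) (hX : 4 / 5 * X₂ ≤ η ^ 2) (x : Pt d) :
    !₂[trigPoly ∅ a K x, trigPoly ∅ b K x] + W ∈ Metric.closedBall W η :=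
  pair_add_mem_closedBall hη (by
    linarith [sq_trigPoly_le h1 h3 a K x, sq_trigPoly_le h1 h3 b K x, h.two])

/-- The flux is bounded in `H²` by `‖w‖_{H²} (1 + ‖w‖_{H²}) ‖∇³w‖`: Sobolev's inequality bounds `w`
by `‖w‖_{H²}` and `∇w` by `‖∇³w‖`, and the Gagliardo-Nirenberg inequality `(∂_j w)²` by
`‖w‖_{H²}²`. -/
lemma l2Sq_second_partial_flux_le (h1 : 1 ≤ d) (h3 : d ≤ 3) (hη : 0 ≤ η)
    (hD : C2BoundOn D W η M) (hX : 4 / 5 * X₂ ≤ η ^ 2) (h : CoeffBound a b K X₂ X₃)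
    (hc : c = a ∨ c = b) (i j : Fin d) :
    l2Sq (classicalPartial j (classicalPartial j fun x =>
      (D (!₂[trigPoly ∅ a K x, trigPoly ∅ b K x] + W) - D W) *
        classicalPartial i (trigPoly ∅ c K) x)) ≤ 5700 * M ^ 2 * ((1 + X₂) * X₂ * X₃) := by
  have ha2 := sum_two_nonneg a K
  have hb2 := sum_two_nonneg b K
  have ha3 := sum_three_nonneg a K
  have hb3 := sum_three_nonneg b K
  have hX2 : 0 ≤ X₂ := by linarith [h.two]
  have hX3 : 0 ≤ X₃ := by linarith [h.three]
  have hc2 : ∑ k ∈ K, (1 + freqSq k + freqQuad k) * c k ^ 2 ≤ X₂ := by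
    rcases hc with rfl | rfl <;> linarith [h.two]
  have hc3 : ∑ k ∈ K, freqSq k ^ 3 * c k ^ 2 ≤ X₃ := by
    rcases hc with rfl | rfl <;> linarith [h.three]
  have hw := fun x => h.mem_closedBall (W := W) h1 h3 hη hX x
  have hs : ∀ (a : (Fin d → ℕ) → ℝ), ContDiff ℝ ∞ (trigPoly ∅ a K) := fun a =>
    contDiff_trigPoly ∅ a K
  have hs' : ∀ (a : (Fin d → ℕ) → ℝ), ContDiff ℝ 2 (trigPoly ∅ a K) := fun a =>
    contDiff_trigPoly ∅ a K
  set U := trigPoly ∅ a K with hU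
  set V := trigPoly ∅ b K with hV
  set P := classicalPartial i (trigPoly ∅ c K) with hP
  have hPs : ContDiff ℝ ∞ P := contDiff_classicalPartial i (hs c)
  have hpt := fun x => hD.sq_second_partial_mul_le hη (hs' a) (hs' b) hw
    (hPs.of_le ENat.LEInfty.out) j (α := X₂) (β := 52 * X₃) (x := x)
    (by linarith [sq_trigPoly_le h1 h3 a K x, sq_trigPoly_le h1 h3 b K x, h.two])
    (by linarith [sq_classicalPartial_trigPoly_le h1 h3 c K i x])
    (by linarith [sq_classicalPartial_trigPoly_le h1 h3 a K j x,
      sq_classicalPartial_trigPoly_le h1 h3 b K j x, h.three])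
  have gU := integral_classicalPartial_pow_four_le (hs' a) j
    (fun x hx => classicalPartial_trigPoly_face a K j hx) (α := X₂)
    (fun x => by linarith [sq_trigPoly_le h1 h3 a K x, h.two])
  have gV := integral_classicalPartial_pow_four_le (hs' b) j
    (fun x hx => classicalPartial_trigPoly_face b K j hx) (α := X₂)
    (fun x => by linarith [sq_trigPoly_le h1 h3 b K x, h.two])
  have cont : ∀ {f : Pt d → ℝ}, ContDiff ℝ ∞ f → ∀ n : ℕ,
      Integrable (fun x => f x ^ n) (boxMeasure d) := fun hf n =>
    integrable_of_continuous (hf.continuous.pow n)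
  have sp : ∀ {f : Pt d → ℝ}, ContDiff ℝ ∞ f → ContDiff ℝ ∞ (classicalPartial j f) := fun hf =>
    contDiff_classicalPartial j hf
  have iU1 := cont (sp (hs a)) 4
  have iV1 := cont (sp (hs b)) 4
  have iU2 := cont (sp (sp (hs a))) 2
  have iV2 := cont (sp (sp (hs b))) 2
  have iP1 := cont (sp hPs) 2
  have iP2 := cont (sp (sp hPs)) 2
  have hint : l2Sq (classicalPartial j (classicalPartial j fun x =>
      (D (!₂[U x, V x] + W) - D W) * P x)) ≤
      3 * M ^ 2 * (4 * (52 * X₃) * (∫ x, classicalPartial j U x ^ 4 ∂(boxMeasure d) +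
        ∫ x, classicalPartial j V x ^ 4 ∂(boxMeasure d) +
          l2Sq (classicalPartial j (classicalPartial j U)) +
          l2Sq (classicalPartial j (classicalPartial j V))) +
        8 * (52 * X₃) * l2Sq (classicalPartial j P) +
        2 * X₂ * l2Sq (classicalPartial j (classicalPartial j P))) := by
    have hi := integral_linear_combination iU1 iV1 iU2 iV2 iP1 iP2 (3 * M ^ 2) (4 * (52 * X₃))
      (8 * (52 * X₃)) (2 * X₂)
    simp only [l2Sq]
    exact (integral_mono_of_nonneg (Eventually.of_forall fun x => sq_nonneg _) hi.1
      (Eventually.of_forall hpt)).trans_eq hi.2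
  refine hint.trans ?_
  have q1 := l2Sq_second_trigPoly_le a K j j
  have q2 := l2Sq_second_trigPoly_le b K j j
  have q3 := (l2Sq_second_trigPoly_le c K i j).trans hc2
  have q4 := (l2Sq_third_trigPoly_le c K i j).trans hc3
  have q5 : l2Sq (classicalPartial j (classicalPartial j U)) +
      l2Sq (classicalPartial j (classicalPartial j V)) ≤ X₂ := by linarith [h.two]
  have q6 : ∫ x, classicalPartial j U x ^ 4 ∂(boxMeasure d) +
        ∫ x, classicalPartial j V x ^ 4 ∂(boxMeasure d) ≤ 9 * X₂ * X₂ := by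
    have := mul_le_mul_of_nonneg_left q5 (by positivity : 0 ≤ 9 * X₂)
    linarith
  have r1 := mul_le_mul_of_nonneg_left (add_le_add q6 q5) (by positivity : 0 ≤ 4 * (52 * X₃))
  have r2 := mul_le_mul_of_nonneg_left q3 (by positivity : 0 ≤ 8 * (52 * X₃))
  have r3 := mul_le_mul_of_nonneg_left q4 (by positivity : 0 ≤ 2 * X₂)
  have r4 : 0 ≤ X₂ * X₃ := by positivity
  have r5 : 0 ≤ X₂ * X₂ * X₃ := by positivity
  calc _ ≤ 3 * M ^ 2 * (1900 * ((1 + X₂) * X₂ * X₃)) := by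
        refine mul_le_mul_of_nonneg_left ?_ (by positivity)
        nlinarith
    _ = _ := by ring

/-- The flux `(D(w + W) - D(W)) ∂_i z` of a component `z` of `w` is in `H²` with the right
boundary conditions for its sine series in `x_i`. -/
lemma sum_sq_freqSq_mul_coef_flux_le (h1 : 1 ≤ d) (h3 : d ≤ 3) (hη : 0 ≤ η)
    (hD : C2BoundOn D W η M) (hX : 4 / 5 * X₂ ≤ η ^ 2) (h : CoeffBound a b K X₂ X₃)
    (hc : c = a ∨ c = b) (i : Fin d) (L : Finset (Fin d → ℕ)) :
    ∑ k ∈ L, (freqSq k * coef {i} (fun x =>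
      (D (!₂[trigPoly ∅ a K x, trigPoly ∅ b K x] + W) - D W) *
        classicalPartial i (trigPoly ∅ c K) x) k) ^ 2 ≤
      52000 * M ^ 2 * ((1 + X₂) * X₂ * X₃) := by
  have hw := fun x => h.mem_closedBall (W := W) h1 h3 hη hX x
  have hs : ∀ (a : (Fin d → ℕ) → ℝ), ContDiff ℝ 2 (trigPoly ∅ a K) := fun a =>
    contDiff_trigPoly ∅ a K
  have hPs : ContDiff ℝ 2 (classicalPartial i (trigPoly ∅ c K)) :=
    (contDiff_classicalPartial i (contDiff_trigPoly ∅ c K)).of_le ENat.LEInfty.out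
  have hQ : ContDiff ℝ 2 fun x => D (!₂[trigPoly ∅ a K x, trigPoly ∅ b K x] + W) - D W :=
    (hD.contDiff_comp (hs a) (hs b) hw).sub contDiff_const
  set p : Pt d → ℝ := fun x => (D (!₂[trigPoly ∅ a K x, trigPoly ∅ b K x] + W) - D W) *
        classicalPartial i (trigPoly ∅ c K) x with hp
  have hps : ContDiff ℝ 2 p := hQ.mul hPs
  have hbd : ∀ j (x : Pt d), x j = 0 ∨ x j = Real.pi →
      if j ∈ ({i} : Finset (Fin d)) then p x = 0 else classicalPartial j p x = 0 := by
    intro j x hx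
    by_cases hij : j = i
    · subst hij
      rw [if_pos (Finset.mem_singleton_self j), hp]
      simp only [classicalPartial_trigPoly_face c K j hx, mul_zero]
    · rw [if_neg (by simpa using hij), hp, classicalPartial_mul j
        (hQ.differentiable (by norm_num) x) (hPs.differentiable (by norm_num) x),
        classicalPartial_classicalPartial_trigPoly_face c K hij hx]
      have : (classicalPartial j fun x =>
          D (!₂[trigPoly ∅ a K x, trigPoly ∅ b K x] + W) - D W) x = 0 := by
        have e := congrArg (fun L : Pt d →L[ℝ] ℝ => L (Pi.single j 1)) (fderiv_sub_const
          (f := fun x => D (!₂[trigPoly ∅ a K x, trigPoly ∅ b K x] + W)) (x := x) (D W))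
        refine e.trans ?_
        refine (hD.classicalPartial_comp ((hs a).differentiable (by norm_num) x)
          ((hs b).differentiable (by norm_num) x) (hw x) j).trans ?_
        rw [classicalPartial_trigPoly_face a K j hx, classicalPartial_trigPoly_face b K j hx]
        rw [show (!₂[(0 : ℝ), 0] : Plane) = 0 by rw [pair_eq]; simp, map_zero]
      rw [this]; simp
  have hj : ∀ j, ∑ k ∈ L, (k j ^ 2 * coef {i} p k) ^ 2 ≤
      5700 * M ^ 2 * ((1 + X₂) * X₂ * X₃) := by
    intro j
    have hm : MemLp (classicalPartial j (classicalPartial j p)) 2 (boxMeasure d) :=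
      memLp_of_continuous (continuous_classicalPartial j
        (contDiff_classicalPartial_of_succ j hps (by norm_num)))
    have := sum_coef_sq_le {i} hm L
    simp_rw [coef_classicalPartial_classicalPartial hps j (hbd j), neg_sq] at this
    exact this.trans (l2Sq_second_partial_flux_le h1 h3 hη hD hX h hc i j)
  have hB : 0 ≤ 5700 * M ^ 2 * ((1 + X₂) * X₂ * X₃) :=
    (Finset.sum_nonneg fun _ _ => sq_nonneg _).trans (hj i)
  calc ∑ k ∈ L, (freqSq k * coef {i} p k) ^ 2
      ≤ ∑ k ∈ L, 3 * ∑ j, (k j ^ 2 * coef {i} p k) ^ 2 := Finset.sum_le_sum fun k _ => by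
        rw [freqSq, Finset.sum_mul]
        refine sq_sum_le_card_mul_sum_sq.trans ?_
        rw [Finset.card_univ, Fintype.card_fin]
        exact mul_le_mul_of_nonneg_right (by exact_mod_cast h3)
          (Finset.sum_nonneg fun _ _ => sq_nonneg _)
    _ = 3 * ∑ j, ∑ k ∈ L, (k j ^ 2 * coef {i} p k) ^ 2 := by
        rw [← Finset.mul_sum, Finset.sum_comm]
    _ ≤ 3 * ∑ _j : Fin d, 5700 * M ^ 2 * ((1 + X₂) * X₂ * X₃) := by
        gcongr with j; exact hj j
    _ = 3 * (d * (5700 * M ^ 2 * ((1 + X₂) * X₂ * X₃))) := by simp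
    _ ≤ 3 * (3 * (5700 * M ^ 2 * ((1 + X₂) * X₂ * X₃))) := by
        gcongr; exact_mod_cast h3
    _ ≤ _ := by linarith

/-- The superlinear part of the reaction term is quadratic in `w`. -/
lemma sum_sq_freq_mul_coef_reaction_le (h1 : 1 ≤ d) (h3 : d ≤ 3) (hη : 0 ≤ η)
    (hD : C2BoundOn D W η M) (hX : 4 / 5 * X₂ ≤ η ^ 2) (h : CoeffBound a b K X₂ X₃)
    (j : Fin d) (L : Finset (Fin d → ℕ)) :
    ∑ k ∈ L, (k j * coef ∅ (fun x =>
      D (!₂[trigPoly ∅ a K x, trigPoly ∅ b K x] + W) - D W -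
        fderiv ℝ D W !₂[trigPoly ∅ a K x, trigPoly ∅ b K x]) k) ^ 2 ≤
      2 * M ^ 2 * (X₂ * X₃) := by
  have hw := fun x => h.mem_closedBall (W := W) h1 h3 hη hX x
  have hM := hD.nonneg hη
  have hs : ∀ (a : (Fin d → ℕ) → ℝ), ContDiff ℝ 2 (trigPoly ∅ a K) := fun a =>
    contDiff_trigPoly ∅ a K
  have hs1 : ∀ (a : (Fin d → ℕ) → ℝ), Continuous (classicalPartial j (trigPoly ∅ a K)) := fun a =>
    continuous_classicalPartial j ((hs a).of_le (by norm_num))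
  have ha2 := sum_two_nonneg a K
  have hb2 := sum_two_nonneg b K
  have hX2 : 0 ≤ X₂ := by linarith [h.two]
  have bU := fun x => sq_trigPoly_le h1 h3 a K x
  have bV := fun x => sq_trigPoly_le h1 h3 b K x
  have lU := l2Sq_classicalPartial_trigPoly_le a K j
  have lV := l2Sq_classicalPartial_trigPoly_le b K j
  set U := trigPoly ∅ a K with hU
  set V := trigPoly ∅ b K with hV
  have hl : ContDiff ℝ 2 fun x => fderiv ℝ D W !₂[U x, V x] :=
    (fderiv ℝ D W).contDiff.comp (contDiff_pair (hs a) (hs b))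
  have hDs := (hD.contDiff_comp (hs a) (hs b) hw).sub (contDiff_const (c := D W))
  set F : Pt d → ℝ := fun x => D (!₂[U x, V x] + W) - D W - fderiv ℝ D W !₂[U x, V x] with hF
  have hFs : ContDiff ℝ 2 F := hDs.sub hl
  have hFj : ∀ x, classicalPartial j F x =
      (fderiv ℝ D (!₂[U x, V x] + W) - fderiv ℝ D W)
        !₂[classicalPartial j U x, classicalPartial j V x] := by
    intro x
    obtain ⟨A, hA, hAj⟩ := fderiv_pair ((hs a).differentiable (by norm_num) x)
      ((hs b).differentiable (by norm_num) x) j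
    have := (((hD.differentiableAt (hw x)).hasFDerivAt.comp x (hA.add_const W)).sub_const
      (D W)).sub ((fderiv ℝ D W).hasFDerivAt.comp x hA)
    rw [classicalPartial, show fderiv ℝ F x = _ from this.fderiv]
    simp [hAj, hU, hV]
  have hpt : ∀ x, classicalPartial j F x ^ 2 ≤
      2 * M ^ 2 * X₂ * (classicalPartial j U x ^ 2 + classicalPartial j V x ^ 2) := by
    intro x
    have e1 := hD.norm_fderiv_sub_le (hw x) (Metric.mem_closedBall_self hη)
    rw [add_sub_cancel_right] at e1
    have e2 := ContinuousLinearMap.le_of_opNorm_le _ e1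
      !₂[classicalPartial j U x, classicalPartial j V x]
    rw [← hFj, Real.norm_eq_abs] at e2
    have e3 := pow_le_pow_left₀ (abs_nonneg _) e2 2
    rw [sq_abs, mul_pow, mul_pow, norm_pair_sq, norm_pair_sq] at e3
    refine e3.trans (mul_le_mul_of_nonneg_right ?_ (by positivity))
    have : U x ^ 2 + V x ^ 2 ≤ 2 * X₂ := by linarith [bU x, bV x, h.two]
    nlinarith [mul_le_mul_of_nonneg_left this (sq_nonneg M)]
  have hFc : Continuous (classicalPartial j F) :=
    continuous_classicalPartial j (hFs.of_le (by norm_num))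
  have hint : l2Sq (classicalPartial j F) ≤ 2 * M ^ 2 * X₂ *
      (l2Sq (classicalPartial j U) + l2Sq (classicalPartial j V)) := by
    have iU : Integrable (fun x => classicalPartial j U x ^ 2) (boxMeasure d) :=
      integrable_of_continuous ((hs1 a).pow 2)
    have iV : Integrable (fun x => classicalPartial j V x ^ 2) (boxMeasure d) :=
      integrable_of_continuous ((hs1 b).pow 2)
    simp only [l2Sq]
    rw [← integral_add iU iV, ← integral_const_mul]
    exact integral_mono (integrable_of_continuous (hFc.pow 2)) ((iU.add iV).const_mul _) hpt
  have := sum_coef_sq_le (insert j ∅) (memLp_of_continuous hFc) L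
  simp_rw [coef_classicalPartial_insert (hFs.of_le (by norm_num : (1 : WithTop ℕ∞) ≤ 2))
    (Finset.notMem_empty j), neg_sq] at this
  refine this.trans (hint.trans ?_)
  calc _ ≤ 2 * M ^ 2 * X₂ * X₃ := by
        gcongr; linarith [h.three]
    _ = _ := by ring

end nonlinear

end

section

/-! ### Passage to the limit in the nonlinear terms -/

lemma norm_toLp_eq_sqrt_l2Sq {f : Pt d → ℝ} (hf : MemLp f 2 (boxMeasure d)) :
    ‖hf.toLp f‖ = √(l2Sq f) := by
  rw [norm_eq_sqrt_real_inner, inner_toLp]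
  simp_rw [l2Sq, sq]

/-- The Cauchy-Schwarz inequality. -/
lemma integral_abs_mul_le {f g : Pt d → ℝ} (hf : MemLp f 2 (boxMeasure d))
    (hg : MemLp g 2 (boxMeasure d)) :
    ∫ x, |f x| * |g x| ∂(boxMeasure d) ≤ √(l2Sq f) * √(l2Sq g) := by
  have h := real_inner_le_norm (hf.abs.toLp _) (hg.abs.toLp _)
  rw [inner_toLp, norm_toLp_eq_sqrt_l2Sq, norm_toLp_eq_sqrt_l2Sq] at h
  have e : ∀ f : Pt d → ℝ, l2Sq (|f|) = l2Sq f := fun f => by simp [l2Sq]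
  rw [e, e] at h
  exact h

lemma integrable_abs_mul {f g : Pt d → ℝ} (hf : MemLp f 2 (boxMeasure d))
    (hg : MemLp g 2 (boxMeasure d)) : Integrable (fun x => |f x| * |g x|) (boxMeasure d) :=
  hf.abs.integrable_mul hg.abs

/-- A function on the plane that on the disc of radius `η` around `W` is bounded by `B` and
Lipschitz with constant `B`. -/
structure LipBoundOn (G : Plane → ℝ) (W : Plane) (η B : ℝ) : Prop where
  abs_sub_le : ∀ z ∈ Metric.closedBall W η, ∀ z' ∈ Metric.closedBall W η,
    |G z - G z'| ≤ B * ‖z - z'‖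
  abs_le : ∀ z ∈ Metric.closedBall W η, |G z| ≤ B

/-- The pair `(u, v)` takes its values in the disc of radius `η`. -/
def InDisc (η : ℝ) (u v : Pt d → ℝ) : Prop := ∀ᵐ x ∂(boxMeasure d), u x ^ 2 + v x ^ 2 ≤ η ^ 2

variable {G : Plane → ℝ} {W : Plane} {η B : ℝ} {u v P : Pt d → ℝ}

lemma LipBoundOn.nonneg (hG : LipBoundOn G W η B) (hη : 0 ≤ η) : 0 ≤ B :=
  (abs_nonneg _).trans (hG.abs_le W (Metric.mem_closedBall_self hη))

lemma LipBoundOn.aestronglyMeasurable (hG : LipBoundOn G W η B) (hη : 0 ≤ η)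
    (hu : AEStronglyMeasurable u (boxMeasure d)) (hv : AEStronglyMeasurable v (boxMeasure d))
    (h : InDisc η u v) :
    AEStronglyMeasurable (fun x => G (!₂[u x, v x] + W)) (boxMeasure d) := by
  have hB := hG.nonneg hη
  have hL : LipschitzOnWith ⟨B, hB⟩ G (Metric.closedBall W η) :=
    LipschitzOnWith.of_dist_le_mul fun z hz z' hz' => by
      rw [Real.dist_eq, dist_eq_norm]; exact hG.abs_sub_le z hz z' hz'
  obtain ⟨g, hg, hgG⟩ := hL.extend_real
  have hm : AEStronglyMeasurable (fun x => (!₂[u x, v x] : Plane) + W) (boxMeasure d) := by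
    simp_rw [pair_eq]
    exact ((hu.smul_const _).add (hv.smul_const _)).add aestronglyMeasurable_const
  refine (hg.continuous.comp_aestronglyMeasurable hm).congr ?_
  filter_upwards [h] with x hx
  exact (hgG (pair_add_mem_closedBall hη hx)).symm

lemma LipBoundOn.integrable (hG : LipBoundOn G W η B) (hη : 0 ≤ η)
    (hu : AEStronglyMeasurable u (boxMeasure d)) (hv : AEStronglyMeasurable v (boxMeasure d))
    (h : InDisc η u v) (hP : Integrable P (boxMeasure d)) {φ : Pt d → ℝ} (hφ : Continuous φ)
    {C : ℝ} (hC : ∀ x, |φ x| ≤ C) :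
    Integrable (fun x => G (!₂[u x, v x] + W) * P x * φ x) (boxMeasure d) := by
  refine Integrable.mul_bdd (c := C) ?_ hφ.aestronglyMeasurable (Eventually.of_forall hC)
  refine hP.bdd_mul (c := B) (hG.aestronglyMeasurable hη hu hv h) ?_
  filter_upwards [h] with x hx
  exact hG.abs_le _ (pair_add_mem_closedBall hη hx)

/-- The integral `∫ G(w + W) P φ` depends continuously on `w` and `P` in `L²`, as long as the
values of `w` stay in the disc where `G` is Lipschitz. -/
lemma LipBoundOn.tendsto_integral (hG : LipBoundOn G W η B) (hη : 0 ≤ η) {ι : Type*}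
    {l : Filter ι} {us vs Ps : ι → Pt d → ℝ} (hu : MemLp u 2 (boxMeasure d))
    (hv : MemLp v 2 (boxMeasure d)) (hP : MemLp P 2 (boxMeasure d)) (hw : InDisc η u v)
    (hus : ∀ᶠ n in l, MemLp (us n) 2 (boxMeasure d))
    (hvs : ∀ᶠ n in l, MemLp (vs n) 2 (boxMeasure d))
    (hPs : ∀ᶠ n in l, MemLp (Ps n) 2 (boxMeasure d)) (hws : ∀ᶠ n in l, InDisc η (us n) (vs n))
    (hul : Tendsto (fun n => l2Sq fun x => u x - us n x) l (𝓝 0))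
    (hvl : Tendsto (fun n => l2Sq fun x => v x - vs n x) l (𝓝 0))
    (hPl : Tendsto (fun n => l2Sq fun x => P x - Ps n x) l (𝓝 0))
    {φ : Pt d → ℝ} (hφ : Continuous φ) {C : ℝ} (hC : ∀ x, |φ x| ≤ C) :
    Tendsto (fun n => ∫ x, G (!₂[us n x, vs n x] + W) * Ps n x * φ x ∂(boxMeasure d)) l
      (𝓝 (∫ x, G (!₂[u x, v x] + W) * P x * φ x ∂(boxMeasure d))) := by
  have hB := hG.nonneg hη
  have hC0 : 0 ≤ C := (abs_nonneg _).trans (hC 0)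
  rw [tendsto_iff_dist_tendsto_zero]
  let one : Pt d → ℝ := fun _ => 1
  have hone : MemLp one 2 (boxMeasure d) := memLp_const 1
  have hlim : Tendsto (fun n => B * C * (√(l2Sq fun x => P x - Ps n x) * √(l2Sq one) +
      (√(l2Sq fun x => u x - us n x) * √(l2Sq P) +
        √(l2Sq fun x => v x - vs n x) * √(l2Sq P)))) l (𝓝 0) := by
    have h1 := (hPl.sqrt.mul_const √(l2Sq one)).add
      ((hul.sqrt.mul_const √(l2Sq P)).add (hvl.sqrt.mul_const √(l2Sq P)))
    have h2 := h1.const_mul (B * C)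
    simpa using h2
  refine squeeze_zero' (Eventually.of_forall fun _ => dist_nonneg) ?_ hlim
  filter_upwards [hus, hvs, hPs, hws] with n h1 h2 h3 h4
  have i1 := hG.integrable hη h1.1 h2.1 h4 h3.integrable_box hφ hC
  have i2 := hG.integrable hη hu.1 hv.1 hw hP.integrable_box hφ hC
  have j1 := integrable_abs_mul (hP.sub h3) hone
  have j2 := integrable_abs_mul (hu.sub h1) hP
  have j3 := integrable_abs_mul (hv.sub h2) hP
  have key : ∫ x, |G (!₂[us n x, vs n x] + W) * Ps n x * φ x - G (!₂[u x, v x] + W) * P x * φ x|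
      ∂(boxMeasure d) ≤ ∫ x, B * C * (|(P - Ps n) x| * |one x| +
        (|(u - us n) x| * |P x| + |(v - vs n) x| * |P x|)) ∂(boxMeasure d) := by
    refine integral_mono_ae (i1.sub i2).abs ((j1.add (j2.add j3)).const_mul _) ?_
    filter_upwards [hw, h4] with x hx hx'
    have b1 := hG.abs_le _ (pair_add_mem_closedBall (W := W) hη hx')
    have b2 := hG.abs_sub_le _ (pair_add_mem_closedBall (W := W) hη hx') _
      (pair_add_mem_closedBall (W := W) hη hx)
    have b3 : ‖(!₂[us n x, vs n x] + W - (!₂[u x, v x] + W) : Plane)‖ ≤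
        |u x - us n x| + |v x - vs n x| := by
      have : (!₂[us n x, vs n x] + W - (!₂[u x, v x] + W) : Plane) =
          !₂[us n x - u x, vs n x - v x] := by
        ext i; fin_cases i <;> simp
      rw [this, abs_sub_comm (u x), abs_sub_comm (v x)]
      exact norm_pair_le _ _
    have e : G (!₂[us n x, vs n x] + W) * Ps n x * φ x - G (!₂[u x, v x] + W) * P x * φ x =
        (-(G (!₂[us n x, vs n x] + W) * (P x - Ps n x)) +
          (G (!₂[us n x, vs n x] + W) - G (!₂[u x, v x] + W)) * P x) * φ x := by ring
    rw [e, abs_mul]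
    calc _ ≤ (B * |P x - Ps n x| + B * (|u x - us n x| + |v x - vs n x|) * |P x|) * C := by
          refine mul_le_mul ((abs_add_le _ _).trans (add_le_add ?_ ?_)) (hC x) (abs_nonneg _)
            (by positivity)
          · rw [abs_neg, abs_mul]; gcongr
          · rw [abs_mul]
            gcongr
            exact b2.trans (mul_le_mul_of_nonneg_left b3 hB)
      _ = _ := by simp [one]; ring
  rw [Real.dist_eq, ← integral_sub i1 i2]
  refine abs_integral_le_integral_abs.trans (key.trans ?_)
  have j23 : Integrable (fun x => |(u - us n) x| * |P x| + |(v - vs n) x| * |P x|)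
    (boxMeasure d) := j2.add j3
  rw [integral_const_mul, integral_add j1 j23, integral_add j2 j3]
  gcongr
  · exact integral_abs_mul_le (hP.sub h3) hone
  · exact integral_abs_mul_le (hu.sub h1) hP
  · exact integral_abs_mul_le (hv.sub h2) hP

lemma C2BoundOn.lip {D : Plane → ℝ} {M : ℝ} (hD : C2BoundOn D W η M) : LipBoundOn D W η M :=
  ⟨fun _ hz _ hz' => hD.abs_sub_le hz hz', hD.abs_le⟩

lemma C2BoundOn.lip_sub {D : Plane → ℝ} {M : ℝ} (hη : 0 ≤ η) (hD : C2BoundOn D W η M) :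
    LipBoundOn (fun z => D z - D W) W η (2 * M) := by
  have hM := hD.nonneg hη
  refine ⟨fun z hz z' hz' => ?_, fun z hz => ?_⟩
  · rw [sub_sub_sub_cancel_right]
    refine (hD.abs_sub_le hz hz').trans ?_
    gcongr; linarith
  · have h2 := hD.abs_le W (Metric.mem_closedBall_self hη)
    exact (abs_sub _ _).trans (by linarith [hD.abs_le z hz])

lemma C2BoundOn.lip_sub_sub {D : Plane → ℝ} {M : ℝ} (hη : 0 ≤ η) (hD : C2BoundOn D W η M) :
    LipBoundOn (fun z => D z - D W - fderiv ℝ D W (z - W)) W η (2 * M + M * η) := by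
  have hM := hD.nonneg hη
  have hW := hD.norm_fderiv_le W (Metric.mem_closedBall_self hη)
  have hMη : 0 ≤ M * η := by positivity
  refine ⟨fun z hz z' hz' => ?_, fun z hz => ?_⟩
  · have e : D z - D W - fderiv ℝ D W (z - W) - (D z' - D W - fderiv ℝ D W (z' - W)) =
        (D z - D z') - fderiv ℝ D W (z - z') := by
      simp only [map_sub]; ring
    rw [e]
    have h1 := hD.abs_sub_le hz hz'
    have h2 := ContinuousLinearMap.le_of_opNorm_le _ hW (z - z')
    rw [Real.norm_eq_abs] at h2
    refine (abs_sub _ _).trans ((add_le_add h1 h2).trans ?_)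
    nlinarith [norm_nonneg (z - z')]
  · have h2 := hD.abs_le W (Metric.mem_closedBall_self hη)
    have h3 := ContinuousLinearMap.le_of_opNorm_le _ hW (z - W)
    rw [Real.norm_eq_abs] at h3
    have h4 : ‖z - W‖ ≤ η := by rwa [← dist_eq_norm]
    refine (abs_sub _ _).trans ((add_le_add (abs_sub _ _) h3).trans ?_)
    have := mul_le_mul_of_nonneg_left h4 hM
    linarith [hD.abs_le z hz]

lemma eLpNorm_eq_sqrt_l2Sq {f : Pt d → ℝ} (hf : MemLp f 2 (boxMeasure d)) :
    eLpNorm f 2 (boxMeasure d) = ENNReal.ofReal √(l2Sq f) := by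
  rw [← norm_toLp_eq_sqrt_l2Sq hf, Lp.norm_toLp, ENNReal.ofReal_toReal hf.2.ne]

lemma tendstoInMeasure_of_l2Sq {ι : Type*} {l : Filter ι} {us : ι → Pt d → ℝ}
    (hu : MemLp u 2 (boxMeasure d)) (hus : ∀ n, MemLp (us n) 2 (boxMeasure d))
    (h : Tendsto (fun n => l2Sq fun x => u x - us n x) l (𝓝 0)) :
    TendstoInMeasure (boxMeasure d) us l u := by
  refine tendstoInMeasure_of_tendsto_eLpNorm (p := 2) (by norm_num) (fun n => (hus n).1) hu.1 ?_
  have e : ∀ n, eLpNorm (us n - u) 2 (boxMeasure d) =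
      ENNReal.ofReal √(l2Sq fun x => u x - us n x) := fun n => by
    rw [eLpNorm_sub_comm]; exact eLpNorm_eq_sqrt_l2Sq (hu.sub (hus n))
  simp_rw [e]
  simpa using ENNReal.tendsto_ofReal h.sqrt

section limit

variable {D : Plane → ℝ} {M : ℝ}

lemma coeffBound_coef (hu : InH 2 u) (hv : InH 2 v) (nu : Neumann u) (nv : Neumann v)
    (hu3 : InH 3 u) (hv3 : InH 3 v) (K : Finset (Fin d → ℕ)) :
    CoeffBound (coef ∅ u) (coef ∅ v) K (h2Sq u + h2Sq v) (thirdSq u + thirdSq v) := by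
  have h2 : ∀ k : Fin d → ℕ, 0 ≤ 1 + freqSq k + freqQuad k := fun k => by
    have := freqSq_nonneg k
    have := freqQuad_nonneg k
    positivity
  exact ⟨add_le_add
    (sum_le_hasSum K (fun k _ => mul_nonneg (h2 k) (sq_nonneg _)) (hasSum_h2Sq hu nu))
    (sum_le_hasSum K (fun k _ => mul_nonneg (h2 k) (sq_nonneg _)) (hasSum_h2Sq hv nv)),
    add_le_add
    (sum_le_hasSum K (fun k _ => mul_nonneg (pow_nonneg (freqSq_nonneg k) 3) (sq_nonneg _))
      (hasSum_thirdSq hu3 nu))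
    (sum_le_hasSum K (fun k _ => mul_nonneg (pow_nonneg (freqSq_nonneg k) 3) (sq_nonneg _))
      (hasSum_thirdSq hv3 nv))⟩

lemma sq_add_sq_trigPoly_le (h1 : 1 ≤ d) (h3 : d ≤ 3) (hu : InH 2 u) (hv : InH 2 v)
    (nu : Neumann u) (nv : Neumann v) (hX : 4 / 5 * (h2Sq u + h2Sq v) ≤ η ^ 2)
    (K : Finset (Fin d → ℕ)) (x : Pt d) :
    trigPoly ∅ (coef ∅ u) K x ^ 2 + trigPoly ∅ (coef ∅ v) K x ^ 2 ≤ η ^ 2 := by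
  have h2 : ∀ k : Fin d → ℕ, 0 ≤ 1 + freqSq k + freqQuad k := fun k => by
    have := freqSq_nonneg k
    have := freqQuad_nonneg k
    positivity
  linarith [sq_trigPoly_le h1 h3 (coef ∅ u) K x, sq_trigPoly_le h1 h3 (coef ∅ v) K x,
    sum_le_hasSum K (fun k _ => mul_nonneg (h2 k) (sq_nonneg _)) (hasSum_h2Sq hu nu),
    sum_le_hasSum K (fun k _ => mul_nonneg (h2 k) (sq_nonneg _)) (hasSum_h2Sq hv nv)]

/-- Sobolev's inequality for `H²` functions with Neumann conditions, with the constant `4 / 5`. -/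
lemma inDisc_of_h2Sq_le (h1 : 1 ≤ d) (h3 : d ≤ 3) (hu : InH 2 u) (hv : InH 2 v)
    (nu : Neumann u) (nv : Neumann v) (hX : 4 / 5 * (h2Sq u + h2Sq v) ≤ η ^ 2) :
    InDisc η u v := by
  obtain ⟨K, hK, hKu⟩ := (tendstoInMeasure_of_l2Sq hu.memLp
    (fun K => memLp_trigPoly ∅ (coef ∅ u) K 2)
    (tendsto_l2Sq_sub_trigPoly ∅ hu.memLp)).exists_seq_tendsto_ae'
  obtain ⟨n, hn, hKv⟩ := (tendstoInMeasure_of_l2Sq hv.memLp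
    (fun i => memLp_trigPoly ∅ (coef ∅ v) (K i) 2)
    ((tendsto_l2Sq_sub_trigPoly ∅ hv.memLp).comp hK)).exists_seq_tendsto_ae'
  filter_upwards [hKu, hKv] with x hxu hxv
  exact le_of_tendsto (((hxu.comp hn).pow 2).add (hxv.pow 2))
    (Eventually.of_forall fun i => sq_add_sq_trigPoly_le h1 h3 hu hv nu nv hX (K (n i)) x)

lemma classicalPartial_trigPoly_coef (hu : InH 1 u) (i : Fin d) (K : Finset (Fin d → ℕ)) :
    classicalPartial i (trigPoly ∅ (coef ∅ u) K) =
      trigPoly {i} (coef {i} (weakPartial i u)) K := by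
  rw [classicalPartial_trigPoly_of_notMem (Finset.notMem_empty i), insert_empty_eq]
  congr 1
  ext k
  exact (coef_weakPartial hu (Finset.notMem_empty i) k).symm

/-- The bound for the flux passes from the partial sums of the cosine series to `w` itself, since
only finitely many coefficients are involved. -/
lemma sum_sq_freqSq_mul_coef_flux_le_of_inH (h1 : 1 ≤ d) (h3 : d ≤ 3) (hη : 0 ≤ η)
    (hD : C2BoundOn D W η M) (hu : InH 3 u) (hv : InH 3 v) (nu : Neumann u) (nv : Neumann v)
    (hX : 4 / 5 * (h2Sq u + h2Sq v) ≤ η ^ 2) {z : Pt d → ℝ} (hz : z = u ∨ z = v) (i : Fin d)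
    (L : Finset (Fin d → ℕ)) :
    ∑ k ∈ L, (freqSq k * coef {i} (fun x => (D (!₂[u x, v x] + W) - D W) * weakPartial i z x)
      k) ^ 2 ≤ 52000 * M ^ 2 *
        ((1 + (h2Sq u + h2Sq v)) * (h2Sq u + h2Sq v) * (thirdSq u + thirdSq v)) := by
  have hz1 : InH 1 z := by rcases hz with rfl | rfl; exacts [hu.of_succ.of_succ, hv.of_succ.of_succ]
  have hw := inDisc_of_h2Sq_le h1 h3 hu.of_succ hv.of_succ nu nv hX
  have hlim : ∀ k, Tendsto (fun K => coef {i} (fun x =>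
      (D (!₂[trigPoly ∅ (coef ∅ u) K x, trigPoly ∅ (coef ∅ v) K x] + W) - D W) *
        classicalPartial i (trigPoly ∅ (coef ∅ z) K) x) k) atTop
      (𝓝 (coef {i} (fun x => (D (!₂[u x, v x] + W) - D W) * weakPartial i z x) k)) := by
    intro k
    refine (hD.lip_sub hη).tendsto_integral hη hu.memLp hv.memLp (hz1.isWeakPartial i).1 hw
      (Eventually.of_forall fun K => memLp_trigPoly _ _ K 2)
      (Eventually.of_forall fun K => memLp_trigPoly _ _ K 2)
      (Eventually.of_forall fun K => ?_)
      (Eventually.of_forall fun K => Eventually.of_forall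
        (sq_add_sq_trigPoly_le h1 h3 hu.of_succ hv.of_succ nu nv hX K))
      (tendsto_l2Sq_sub_trigPoly ∅ hu.memLp) (tendsto_l2Sq_sub_trigPoly ∅ hv.memLp) ?_
      (continuous_trig {i} k) (abs_trig_le {i} k)
    · rw [classicalPartial_trigPoly_coef hz1]; exact memLp_trigPoly _ _ K 2
    · simp_rw [classicalPartial_trigPoly_coef hz1]
      exact tendsto_l2Sq_sub_trigPoly {i} (hz1.isWeakPartial i).1
  refine le_of_tendsto (tendsto_finsetSum L fun k _ => ((hlim k).const_mul (freqSq k)).pow 2)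
    (Eventually.of_forall fun K => ?_)
  refine sum_sq_freqSq_mul_coef_flux_le h1 h3 hη hD hX
    (coeffBound_coef hu.of_succ hv.of_succ nu nv hu hv K) ?_ i L
  rcases hz with rfl | rfl
  · exact Or.inl rfl
  · exact Or.inr rfl

lemma sum_sq_freq_mul_coef_reaction_le_of_inH (h1 : 1 ≤ d) (h3 : d ≤ 3) (hη : 0 ≤ η)
    (hD : C2BoundOn D W η M) (hu : InH 3 u) (hv : InH 3 v) (nu : Neumann u) (nv : Neumann v)
    (hX : 4 / 5 * (h2Sq u + h2Sq v) ≤ η ^ 2) (j : Fin d) (L : Finset (Fin d → ℕ)) :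
    ∑ k ∈ L, (k j * coef ∅ (fun x => D (!₂[u x, v x] + W) - D W - fderiv ℝ D W !₂[u x, v x])
      k) ^ 2 ≤ 2 * M ^ 2 * ((h2Sq u + h2Sq v) * (thirdSq u + thirdSq v)) := by
  have hw := inDisc_of_h2Sq_le h1 h3 hu.of_succ hv.of_succ nu nv hX
  have hlim : ∀ k, Tendsto (fun K => coef ∅ (fun x =>
      D (!₂[trigPoly ∅ (coef ∅ u) K x, trigPoly ∅ (coef ∅ v) K x] + W) - D W -
        fderiv ℝ D W !₂[trigPoly ∅ (coef ∅ u) K x, trigPoly ∅ (coef ∅ v) K x]) k) atTop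
      (𝓝 (coef ∅ (fun x => D (!₂[u x, v x] + W) - D W - fderiv ℝ D W !₂[u x, v x]) k)) := by
    intro k
    have := (hD.lip_sub_sub hη).tendsto_integral hη (l := atTop)
      (us := fun K => trigPoly ∅ (coef ∅ u) K) (vs := fun K => trigPoly ∅ (coef ∅ v) K)
      (Ps := fun _ _ => 1) (P := fun _ => 1) hu.memLp hv.memLp (memLp_const 1) hw
      (Eventually.of_forall fun K => memLp_trigPoly _ _ K 2)
      (Eventually.of_forall fun K => memLp_trigPoly _ _ K 2)
      (Eventually.of_forall fun K => memLp_const 1)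
      (Eventually.of_forall fun K => Eventually.of_forall
        (sq_add_sq_trigPoly_le h1 h3 hu.of_succ hv.of_succ nu nv hX K))
      (tendsto_l2Sq_sub_trigPoly ∅ hu.memLp) (tendsto_l2Sq_sub_trigPoly ∅ hv.memLp)
      (by simp [l2Sq]) (continuous_trig ∅ k) (abs_trig_le ∅ k)
    simp only [mul_one, add_sub_cancel_right] at this
    exact this
  refine le_of_tendsto (tendsto_finsetSum L fun k _ => ((hlim k).const_mul (k j : ℝ)).pow 2)
    (Eventually.of_forall fun K => ?_)
  exact sum_sq_freq_mul_coef_reaction_le h1 h3 hη hD hX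
    (coeffBound_coef hu.of_succ hv.of_succ nu nv hu hv K) j L

end limit

end

section

/-! ### The evolution of a single mode -/

/-- The rate of change of the cosine coefficient with frequency `k` of a solution of
`∂z/∂t = ∇·(D(w + W) ∇z) + h(w + W)`. -/
def modeRate (D h : Plane → ℝ) (W : Plane) (u v z : Pt d → ℝ) (k : Fin d → ℕ) : ℝ :=
  ∫ x, (-(D (!₂[u x, v x] + W) *
      ∑ i : Fin d, weakPartial i z x * classicalPartial i (trig ∅ k) x) +
    h (!₂[u x, v x] + W) * trig ∅ k x) ∂(boxMeasure d)

/-- The contribution to `modeRate` of the terms that are superlinear at `w = 0`. -/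
def modeRemainder (D h : Plane → ℝ) (W : Plane) (u v z : Pt d → ℝ) (k : Fin d → ℕ) : ℝ :=
  ∑ i, k i * coef {i} (fun x => (D (!₂[u x, v x] + W) - D W) * weakPartial i z x) k +
    coef ∅ (fun x => h (!₂[u x, v x] + W) - h W - fderiv ℝ h W !₂[u x, v x]) k

variable {D h : Plane → ℝ} {W : Plane} {η M : ℝ} {u v z : Pt d → ℝ}

lemma fderiv_pair_eq (h : Plane → ℝ) (W : Plane) (a b : ℝ) :
    fderiv ℝ h W !₂[a, b] = derivU h W * a + derivV h W * b := by
  rw [pair_eq, map_add, map_smul, map_smul, derivU, derivV, smul_eq_mul, smul_eq_mul]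
  ring

lemma modeRate_eq_sum (hη : 0 ≤ η) (hD : C2BoundOn D W η M) (hh : C2BoundOn h W η M)
    (hu : MemLp u 2 (boxMeasure d)) (hv : MemLp v 2 (boxMeasure d)) (hz : InH 1 z)
    (hw : InDisc η u v) (k : Fin d → ℕ) : modeRate D h W u v z k =
      ∑ i, k i * ∫ x, D (!₂[u x, v x] + W) * weakPartial i z x * trig {i} k x ∂(boxMeasure d) +
        ∫ x, h (!₂[u x, v x] + W) * 1 * trig ∅ k x ∂(boxMeasure d) := by
  have i1 : ∀ i, Integrable (fun x => D (!₂[u x, v x] + W) * weakPartial i z x * trig {i} k x)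
      (boxMeasure d) := fun i => hD.lip.integrable hη hu.1 hv.1 hw
    (hz.isWeakPartial i).1.integrable_box (continuous_trig {i} k) (abs_trig_le {i} k)
  have i2 : Integrable (fun x => h (!₂[u x, v x] + W) * 1 * trig ∅ k x) (boxMeasure d) :=
    hh.lip.integrable hη hu.1 hv.1 hw (P := fun _ => 1) (integrable_const 1)
      (continuous_trig ∅ k) (abs_trig_le ∅ k)
  have i3 : Integrable (fun x => ∑ i, (k i : ℝ) *
      (D (!₂[u x, v x] + W) * weakPartial i z x * trig {i} k x)) (boxMeasure d) :=
    integrable_finsetSum _ fun i _ => (i1 i).const_mul _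
  simp_rw [← integral_const_mul]
  rw [← integral_finsetSum _ fun i _ => (i1 i).const_mul _, ← integral_add i3 i2, modeRate]
  refine integral_congr_ae (Eventually.of_forall fun x => ?_)
  simp only [classicalPartial_trig_of_notMem (Finset.notMem_empty _), insert_empty_eq]
  rw [Finset.mul_sum, ← Finset.sum_neg_distrib, mul_one]
  congr 1
  exact Finset.sum_congr rfl fun i _ => by ring

/-- The linearization at `w = 0` acts diagonally on the modes. -/
lemma modeRate_eq (hη : 0 ≤ η) (hD : C2BoundOn D W η M) (hh : C2BoundOn h W η M) (h0 : h W = 0)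
    (hu : MemLp u 2 (boxMeasure d)) (hv : MemLp v 2 (boxMeasure d)) (hz : InH 1 z)
    (hw : InDisc η u v) (k : Fin d → ℕ) : modeRate D h W u v z k =
      -(D W * freqSq k * coef ∅ z k) + (derivU h W * coef ∅ u k + derivV h W * coef ∅ v k) +
        modeRemainder D h W u v z k := by
  rw [modeRate_eq_sum hη hD hh hu hv hz hw, modeRemainder]
  have e1 : ∀ i, ∫ x, D (!₂[u x, v x] + W) * weakPartial i z x * trig {i} k x ∂(boxMeasure d) =
      coef {i} (fun x => (D (!₂[u x, v x] + W) - D W) * weakPartial i z x) k -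
        D W * (k i * coef ∅ z k) := by
    intro i
    have hc := coef_weakPartial hz (Finset.notMem_empty i) k
    rw [insert_empty_eq] at hc
    have j1 := (hD.lip_sub hη).integrable hη hu.1 hv.1 hw
      (hz.isWeakPartial i).1.integrable_box (continuous_trig {i} k) (abs_trig_le {i} k)
    have j2 := (integrable_mul_trig (hz.isWeakPartial i).1.integrable_box {i} k).const_mul (D W)
    rw [← neg_eq_iff_eq_neg.2 hc, mul_neg, sub_neg_eq_add, coef, coef, ← integral_const_mul,
      ← integral_add j1 j2]
    exact integral_congr_ae (Eventually.of_forall fun x => by ring)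
  have e2 : ∫ x, h (!₂[u x, v x] + W) * 1 * trig ∅ k x ∂(boxMeasure d) =
      coef ∅ (fun x => h (!₂[u x, v x] + W) - h W - fderiv ℝ h W !₂[u x, v x]) k +
        (derivU h W * coef ∅ u k + derivV h W * coef ∅ v k) := by
    have j1 := (hh.lip_sub_sub hη).integrable hη hu.1 hv.1 hw (P := fun _ => 1)
      (integrable_const 1) (continuous_trig ∅ k) (abs_trig_le ∅ k)
    simp only [mul_one, add_sub_cancel_right] at j1
    have j2 := (integrable_mul_trig hu.integrable_box ∅ k).const_mul (derivU h W)
    have j3 := (integrable_mul_trig hv.integrable_box ∅ k).const_mul (derivV h W)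
    have j23 : Integrable (fun x => derivU h W * (u x * trig ∅ k x) +
      derivV h W * (v x * trig ∅ k x)) (boxMeasure d) := j2.add j3
    rw [coef, coef, coef, ← integral_const_mul, ← integral_const_mul, ← integral_add j2 j3,
      ← integral_add j1 j23]
    refine integral_congr_ae (Eventually.of_forall fun x => ?_)
    simp only [fderiv_pair_eq, h0]
    ring
  simp_rw [e1, e2, mul_sub, Finset.sum_sub_distrib]
  rw [freqSq, Finset.mul_sum, Finset.sum_mul]
  have e3 : ∀ i, (k i : ℝ) * (D W * (k i * coef ∅ z k)) = D W * (k i : ℝ) ^ 2 * coef ∅ z k :=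
    fun i => by ring
  simp_rw [e3]
  ring

/-- The superlinear terms contribute to the energy balance at most a multiple of
`‖w‖_{H²} ‖∇³w‖²`. -/
lemma sum_freqQuad_mul_abs_remainder_le (h1 : 1 ≤ d) (h3 : d ≤ 3) (hη : 0 ≤ η)
    (hD : C2BoundOn D W η M) (hh : C2BoundOn h W η M) (hu : InH 3 u) (hv : InH 3 v)
    (nu : Neumann u) (nv : Neumann v) (hX : 4 / 5 * (h2Sq u + h2Sq v) ≤ η ^ 2)
    (hz : z = u ∨ z = v) (L : Finset (Fin d → ℕ)) :
    ∑ k ∈ L, freqQuad k * (|coef ∅ z k| * |modeRemainder D h W u v z k|) ≤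
      700 * M * ((1 + h2Norm u v) * h2Norm u v * (thirdSq u + thirdSq v)) := by
  have hM := hD.nonneg hη
  set X₂ := h2Sq u + h2Sq v with hX2
  set X₃ := thirdSq u + thirdSq v with hX3
  set N := h2Norm u v with hN
  have hN0 : 0 ≤ N := Real.sqrt_nonneg _
  have hcb := coeffBound_coef hu.of_succ hv.of_succ nu nv hu hv L
  have hX20 : 0 ≤ X₂ := (add_nonneg (sum_two_nonneg _ L) (sum_two_nonneg _ L)).trans hcb.two
  have hX30 : 0 ≤ X₃ := (add_nonneg (sum_three_nonneg _ L) (sum_three_nonneg _ L)).trans hcb.three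
  have hNX : N ^ 2 = X₂ := Real.sq_sqrt hX20
  set c := coef ∅ z with hc
  have hc3 : ∑ k ∈ L, freqSq k ^ 3 * c k ^ 2 ≤ X₃ := by
    have := sum_three_nonneg (coef ∅ u) L
    have := sum_three_nonneg (coef ∅ v) L
    rcases hz with rfl | rfl <;> linarith [hcb.three]
  set p : Fin d → (Fin d → ℕ) → ℝ := fun i => coef {i} (fun x =>
    (D (!₂[u x, v x] + W) - D W) * weakPartial i z x) with hp
  set q : (Fin d → ℕ) → ℝ := coef ∅ (fun x =>
    h (!₂[u x, v x] + W) - h W - fderiv ℝ h W !₂[u x, v x]) with hq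
  have hbc : ∀ i, √(∑ k ∈ L, (freqSq k * k i * |c k|) ^ 2) ≤ √X₃ := fun i => by
    refine Real.sqrt_le_sqrt ((Finset.sum_le_sum fun k _ => ?_).trans hc3)
    have := freqSq_nonneg k
    rw [mul_pow, mul_pow, sq_abs]
    calc freqSq k ^ 2 * (k i : ℝ) ^ 2 * c k ^ 2 ≤ freqSq k ^ 2 * freqSq k * c k ^ 2 := by
          gcongr; exact sq_le_freqSq k i
      _ = _ := by ring
  -- `230 ^ 2 ≥ 52000`, and `(1 + X₂) X₂ ≤ ((1 + N) N)²` as `X₂ = N²`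
  have hbp : ∀ i, √(∑ k ∈ L, (freqSq k * |p i k|) ^ 2) ≤
      230 * M * ((1 + N) * N) * √X₃ := fun i => by
    have := sum_sq_freqSq_mul_coef_flux_le_of_inH h1 h3 hη hD hu hv nu nv hX hz i L
    refine Real.sqrt_le_iff.2 ⟨by positivity, ?_⟩
    simp_rw [mul_pow, sq_abs] at this ⊢
    refine this.trans ?_
    rw [Real.sq_sqrt hX30, ← hX2, ← hX3, ← hNX]
    have e : 0 ≤ M ^ 2 * N ^ 2 * X₃ := by positivity
    have e' : 0 ≤ M ^ 2 * N ^ 2 * X₃ * N := by positivity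
    have e'' : 0 ≤ M ^ 2 * N ^ 2 * X₃ * N ^ 2 := by positivity
    linarith
  have hbq : ∀ j, √(∑ k ∈ L, (k j * |q k|) ^ 2) ≤ 2 * M * ((1 + N) * N) * √X₃ := fun j => by
    have := sum_sq_freq_mul_coef_reaction_le_of_inH h1 h3 hη hh hu hv nu nv hX j L
    refine Real.sqrt_le_iff.2 ⟨by positivity, ?_⟩
    simp_rw [mul_pow, sq_abs] at this ⊢
    refine this.trans ?_
    rw [Real.sq_sqrt hX30, ← hX2, ← hX3, ← hNX]
    have e : 0 ≤ M ^ 2 * N ^ 2 * X₃ := by positivity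
    have e' : 0 ≤ M ^ 2 * N ^ 2 * X₃ * N := by positivity
    have e'' : 0 ≤ M ^ 2 * N ^ 2 * X₃ * N ^ 2 := by positivity
    linarith
  -- the coefficient takes the weight `s k_i`, which leaves the flux the weight `s` that belongs to
  -- its second derivatives and, as `s = ∑ k_i²`, the reaction the weight `k_i` of its first ones
  have hk : ∀ k ∈ L, freqQuad k * (|c k| * |modeRemainder D h W u v z k|) ≤
      ∑ i, ((freqSq k * k i * |c k|) * (freqSq k * |p i k|) +
        (freqSq k * k i * |c k|) * (k i * |q k|)) := by
    intro k _
    have hs := freqSq_nonneg k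
    have a1 : |modeRemainder D h W u v z k| ≤ ∑ i, k i * |p i k| + |q k| := by
      refine (abs_add_le _ _).trans
        (add_le_add ((Finset.abs_sum_le_sum_abs _ _).trans_eq ?_) le_rfl)
      exact Finset.sum_congr rfl fun i _ => by rw [abs_mul, Nat.abs_cast]
    calc freqQuad k * (|c k| * |modeRemainder D h W u v z k|)
        ≤ freqSq k ^ 2 * (|c k| * (∑ i, k i * |p i k| + |q k|)) := by
          gcongr; exact freqQuad_le k
      _ = ∑ i, (freqSq k * k i * |c k|) * (freqSq k * |p i k|) +
          freqSq k * |c k| * |q k| * ∑ i, (k i : ℝ) ^ 2 := by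
          have : ∑ i, (freqSq k * k i * |c k|) * (freqSq k * |p i k|) =
              freqSq k ^ 2 * |c k| * ∑ i, k i * |p i k| := by
            rw [Finset.mul_sum]
            exact Finset.sum_congr rfl fun i _ => by ring
          rw [this, ← freqSq]; ring
      _ = _ := by
          rw [Finset.mul_sum, Finset.sum_add_distrib]
          congr 1
          exact Finset.sum_congr rfl fun i _ => by ring
  calc ∑ k ∈ L, freqQuad k * (|c k| * |modeRemainder D h W u v z k|)
      ≤ ∑ k ∈ L, ∑ i, ((freqSq k * k i * |c k|) * (freqSq k * |p i k|) +
        (freqSq k * k i * |c k|) * (k i * |q k|)) := Finset.sum_le_sum hk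
    _ = ∑ i, (∑ k ∈ L, (freqSq k * k i * |c k|) * (freqSq k * |p i k|) +
        ∑ k ∈ L, (freqSq k * k i * |c k|) * (k i * |q k|)) := by
        rw [Finset.sum_comm]
        exact Finset.sum_congr rfl fun i _ => Finset.sum_add_distrib
    _ ≤ ∑ _i : Fin d, (√X₃ * (230 * M * ((1 + N) * N) * √X₃) +
        √X₃ * (2 * M * ((1 + N) * N) * √X₃)) := by
        refine Finset.sum_le_sum fun i _ => add_le_add ?_ ?_
        · exact (Real.sum_mul_le_sqrt_mul_sqrt _ _ _).trans
            (mul_le_mul (hbc i) (hbp i) (Real.sqrt_nonneg _) (Real.sqrt_nonneg _))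
        · exact (Real.sum_mul_le_sqrt_mul_sqrt _ _ _).trans
            (mul_le_mul (hbc i) (hbq i) (Real.sqrt_nonneg _) (Real.sqrt_nonneg _))
    _ = d * (232 * M * ((1 + N) * N) * (√X₃ * √X₃)) := by
        rw [Finset.sum_const, Finset.card_univ, Fintype.card_fin, nsmul_eq_mul]; ring
    _ ≤ 3 * (232 * M * ((1 + N) * N) * X₃) := by
        rw [Real.mul_self_sqrt hX30]
        gcongr
        exact_mod_cast h3
    _ ≤ 700 * M * ((1 + N) * N * X₃) := by
        have : 0 ≤ M * ((1 + N) * N) * X₃ := by positivity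
        linarith

end

section

/-! ### Continuity in time -/

lemma l2Sq_sub_comm (f g : Pt d → ℝ) : l2Sq (fun x => f x - g x) = l2Sq (fun x => g x - f x) := by
  simp_rw [l2Sq, sub_sq_comm]

lemma l2Sq_le_add {f g : Pt d → ℝ} (hf : MemLp f 2 (boxMeasure d)) (hg : MemLp g 2 (boxMeasure d))
    {ε : ℝ} (hε : 0 < ε) :
    l2Sq f ≤ (1 + ε) * l2Sq g + (1 + ε⁻¹) * l2Sq fun x => f x - g x := by
  have i1 := hf.integrable_sq
  have i2 := hg.integrable_sq.const_mul (1 + ε)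
  have i3 := (hf.sub hg).integrable_sq.const_mul (1 + ε⁻¹)
  simp only [Pi.sub_apply] at i3
  rw [l2Sq, l2Sq, l2Sq, ← integral_const_mul, ← integral_const_mul, ← integral_add i2 i3]
  refine integral_mono i1 (i2.add i3) fun x => ?_
  have h : 0 ≤ ε⁻¹ * (ε * g x - (f x - g x)) ^ 2 := by positivity
  have e : ε⁻¹ * (ε * g x - (f x - g x)) ^ 2 =
      ε * g x ^ 2 - 2 * (g x * (f x - g x)) + ε⁻¹ * (f x - g x) ^ 2 := by
    field_simp
    ring
  simp only
  nlinarith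

lemma weakPartial_sub_ae {i : Fin d} {f g : Pt d → ℝ} (hf : InH 1 f) (hg : InH 1 g) :
    weakPartial i (fun x => f x - g x) =ᵐ[boxMeasure d]
      fun x => weakPartial i f x - weakPartial i g x := by
  have h := (hf.isWeakPartial i).sub hf.memLp.integrable_box hg.memLp.integrable_box
    (hg.isWeakPartial i)
  exact (isWeakPartial_weakPartial ⟨_, h⟩).unique (hf.memLp.sub hg.memLp).integrable_box h

lemma secondSq_nonneg (f : Pt d → ℝ) : 0 ≤ secondSq f :=
  Finset.sum_nonneg fun _ _ => Finset.sum_nonneg fun _ _ => l2Sq_nonneg _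

lemma thirdSq_nonneg (f : Pt d → ℝ) : 0 ≤ thirdSq f :=
  Finset.sum_nonneg fun _ _ => Finset.sum_nonneg fun _ _ => Finset.sum_nonneg fun _ _ =>
    l2Sq_nonneg _

lemma l2Sq_le_h2Sq (f : Pt d → ℝ) : l2Sq f ≤ h2Sq f := by
  have h1 : 0 ≤ ∑ i, l2Sq (weakPartial i f) := Finset.sum_nonneg fun _ _ => l2Sq_nonneg _
  have h2 := secondSq_nonneg f
  rw [h2Sq]; linarith

lemma l2Sq_weakPartial_le_h2Sq (f : Pt d → ℝ) (i : Fin d) : l2Sq (weakPartial i f) ≤ h2Sq f := by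
  have h1 := Finset.single_le_sum (f := fun i => l2Sq (weakPartial i f))
    (fun _ _ => l2Sq_nonneg _) (Finset.mem_univ i)
  have h2 := secondSq_nonneg f
  have h3 := l2Sq_nonneg f
  rw [h2Sq]; linarith

lemma h2Sq_nonneg (f : Pt d → ℝ) : 0 ≤ h2Sq f := (l2Sq_nonneg f).trans (l2Sq_le_h2Sq f)

lemma h2Sq_le_add {f g : Pt d → ℝ} (hf : InH 2 f) (hg : InH 2 g) {ε : ℝ} (hε : 0 < ε) :
    h2Sq f ≤ (1 + ε) * h2Sq g + (1 + ε⁻¹) * h2Sq fun x => f x - g x := by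
  have e1 : ∀ i, l2Sq (weakPartial i fun x => f x - g x) =
      l2Sq fun x => weakPartial i f x - weakPartial i g x := fun i =>
    l2Sq_congr (weakPartial_sub_ae hf.of_succ hg.of_succ)
  have e2 : ∀ i j, l2Sq (weakPartial i (weakPartial j fun x => f x - g x)) =
      l2Sq fun x => weakPartial i (weakPartial j f) x - weakPartial i (weakPartial j g) x :=
    fun i j => by
      rw [weakPartial_congr (weakPartial_sub_ae hf.of_succ hg.of_succ)]
      exact l2Sq_congr (weakPartial_sub_ae (hf.weakPartial j) (hg.weakPartial j))
  simp only [h2Sq, secondSq, e1, e2, mul_add, Finset.mul_sum]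
  have b0 := l2Sq_le_add hf.memLp hg.memLp hε
  have b1 := Finset.sum_le_sum fun i (_ : i ∈ Finset.univ) =>
    l2Sq_le_add (hf.weakPartial i).memLp (hg.weakPartial i).memLp hε
  have b2 := Finset.sum_le_sum fun i (_ : i ∈ Finset.univ) =>
    Finset.sum_le_sum fun j (_ : j ∈ Finset.Ici i) =>
    l2Sq_le_add ((hf.weakPartial j).weakPartial i).memLp ((hg.weakPartial j).weakPartial i).memLp hε
  simp only [Finset.sum_add_distrib] at b1 b2
  linarith

variable {T : ℝ} {u v z : ℝ → Pt d → ℝ}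

lemma IsRegular.tendsto_l2Sq (hz : IsRegular T z) {s : ℝ} (hs : s ∈ Ico 0 T) :
    Tendsto (fun t => l2Sq fun x => z s x - z t x) (𝓝[Ico 0 T] s) (𝓝 0) := by
  refine squeeze_zero (fun t => l2Sq_nonneg _) (fun t => ?_) (hz.continuous s hs)
  rw [l2Sq_sub_comm]
  exact l2Sq_le_h2Sq _

lemma IsRegular.tendsto_l2Sq_weakPartial (hz : IsRegular T z) {s : ℝ} (hs : s ∈ Ico 0 T)
    (i : Fin d) : Tendsto (fun t => l2Sq fun x => weakPartial i (z s) x - weakPartial i (z t) x)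
      (𝓝[Ico 0 T] s) (𝓝 0) := by
  refine squeeze_zero' (Eventually.of_forall fun t => l2Sq_nonneg _) ?_ (hz.continuous s hs)
  filter_upwards [self_mem_nhdsWithin] with t ht
  rw [l2Sq_sub_comm,
    ← l2Sq_congr (weakPartial_sub_ae (hz.inH2 t ht).of_succ (hz.inH2 s hs).of_succ)]
  exact l2Sq_weakPartial_le_h2Sq _ i

/-- Since the Sobolev constant is smaller than one, the pair keeps its values in the disc of
radius `η` for a while after its `H²` norm has been at most `η`. -/
lemma IsRegular.eventually_h2Sq_le (hu : IsRegular T u) (hv : IsRegular T v) {η s : ℝ}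
    (hη : 0 < η) (hs : s ∈ Ico 0 T) (h : h2Norm (u s) (v s) ≤ η) :
    ∀ᶠ t in 𝓝[Ico 0 T] s, 4 / 5 * (h2Sq (u t) + h2Sq (v t)) ≤ η ^ 2 := by
  have h0 : h2Sq (u s) + h2Sq (v s) ≤ η ^ 2 := (Real.sqrt_le_left hη.le).1 h
  have hη2 : 0 < η ^ 2 / 72 := by positivity
  have hl : Tendsto (fun t => h2Sq (fun x => u t x - u s x) + h2Sq (fun x => v t x - v s x))
      (𝓝[Ico 0 T] s) (𝓝 0) := by
    simpa using (hu.continuous s hs).add (hv.continuous s hs)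
  filter_upwards [self_mem_nhdsWithin, hl.eventually_le_const hη2] with t ht hd
  -- `4 / 5 * (1 + 1 / 8) = 9 / 10`, and the difference accounts for `4 / 5 * 9 / 72 = 1 / 10`
  have b1 := h2Sq_le_add (hu.inH2 t ht) (hu.inH2 s hs) (ε := 1 / 8) (by norm_num)
  have b2 := h2Sq_le_add (hv.inH2 t ht) (hv.inH2 s hs) (ε := 1 / 8) (by norm_num)
  norm_num at b1 b2
  linarith

variable {D h : Plane → ℝ} {W : Plane} {η M a b : ℝ}

/-- At all times in `I` the `H²` norm is so small that, by Sobolev's inequality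
`inDisc_of_h2Sq_le`, the pair takes its values in the disc of radius `η`. -/
def SmallOn (η : ℝ) (u v : ℝ → Pt d → ℝ) (I : Set ℝ) : Prop :=
  ∀ t ∈ I, 4 / 5 * (h2Sq (u t) + h2Sq (v t)) ≤ η ^ 2

lemma continuousOn_modeRate (h1 : 1 ≤ d) (h3 : d ≤ 3) (hη : 0 ≤ η) (hD : C2BoundOn D W η M)
    (hh : C2BoundOn h W η M) (hu : IsRegular T u) (hv : IsRegular T v) (hz : IsRegular T z)
    {I : Set ℝ} (hI : I ⊆ Ico 0 T) (hs : SmallOn η u v I) (k : Fin d → ℕ) :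
    ContinuousOn (fun t => modeRate D h W (u t) (v t) (z t) k) I := by
  have hdisc : ∀ t ∈ I, InDisc η (u t) (v t) := fun t ht =>
    inDisc_of_h2Sq_le h1 h3 (hu.inH2 t (hI ht)) (hv.inH2 t (hI ht)) (hu.neumann t (hI ht))
      (hv.neumann t (hI ht)) (hs t ht)
  have hmem : ∀ {y : ℝ → Pt d → ℝ} (_ : IsRegular T y) (s : ℝ),
      ∀ᶠ t in 𝓝[I] s, MemLp (y t) 2 (boxMeasure d) := fun hy s => by
    filter_upwards [self_mem_nhdsWithin] with t ht using (hy.inH2 t (hI ht)).memLp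
  have e : ∀ t ∈ I, modeRate D h W (u t) (v t) (z t) k = _ := fun t ht =>
    modeRate_eq_sum hη hD hh (hu.inH2 t (hI ht)).memLp (hv.inH2 t (hI ht)).memLp
      (hz.inH2 t (hI ht)).of_succ (hdisc t ht) k
  refine ContinuousOn.congr (fun s hsI => ?_) e
  have hsT := hI hsI
  have hle := nhdsWithin_mono s hI
  have hd : ∀ᶠ t in 𝓝[I] s, InDisc η (u t) (v t) := by
    filter_upwards [self_mem_nhdsWithin] with t ht using hdisc t ht
  refine Tendsto.add (tendsto_finsetSum _ fun i _ => Tendsto.const_mul _ ?_) ?_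
  · refine hD.lip.tendsto_integral hη (hu.inH2 s hsT).memLp (hv.inH2 s hsT).memLp
      ((hz.inH2 s hsT).weakPartial i).memLp (hdisc s hsI) (hmem hu s) (hmem hv s) ?_ hd
      ((hu.tendsto_l2Sq hsT).mono_left hle) ((hv.tendsto_l2Sq hsT).mono_left hle)
      ((hz.tendsto_l2Sq_weakPartial hsT i).mono_left hle) (continuous_trig {i} k)
      (abs_trig_le {i} k)
    filter_upwards [self_mem_nhdsWithin] with t ht using ((hz.inH2 t (hI ht)).weakPartial i).memLp
  · refine hh.lip.tendsto_integral hη (hu.inH2 s hsT).memLp (hv.inH2 s hsT).memLp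
      (P := fun _ => 1) (Ps := fun _ _ => 1) (memLp_const 1) (hdisc s hsI) (hmem hu s) (hmem hv s)
      (Eventually.of_forall fun _ => memLp_const 1) hd ((hu.tendsto_l2Sq hsT).mono_left hle)
      ((hv.tendsto_l2Sq hsT).mono_left hle) ?_ (continuous_trig ∅ k) (abs_trig_le ∅ k)
    simpa [l2Sq] using tendsto_const_nhds

lemma WeakEquation.coef_sub_eq (hz : WeakEquation D h W T u v z) (k : Fin d → ℕ) {s t : ℝ}
    (h0 : 0 ≤ s) (hst : s ≤ t) (hT : t < T) :
    coef ∅ (z t) k - coef ∅ (z s) k = ∫ τ in s..t, modeRate D h W (u τ) (v τ) (z τ) k :=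
  hz _ (contDiff_trig ∅ k) s t h0 hst hT

/-- A solution keeps to the ordinary differential equation of each mode. -/
lemma WeakEquation.hasDerivAt_coef (hz : WeakEquation D h W T u v z) (k : Fin d → ℕ) {t : ℝ}
    (h0 : 0 ≤ a) (hT : b < T)
    (hc : ContinuousOn (fun t => modeRate D h W (u t) (v t) (z t) k) (Icc a b))
    (ht : t ∈ Ioo a b) :
    HasDerivAt (fun t => coef ∅ (z t) k) (modeRate D h W (u t) (v t) (z t) k) t := by
  have hI : IntervalIntegrable (fun t => modeRate D h W (u t) (v t) (z t) k) volume a t :=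
    (hc.mono (by rw [uIcc_of_le ht.1.le]; exact Icc_subset_Icc_right ht.2.le)).intervalIntegrable
  have hn : Icc a b ∈ 𝓝 t := Icc_mem_nhds ht.1 ht.2
  have hm := hc.stronglyMeasurableAtFilter_nhdsWithin measurableSet_Icc t (μ := volume)
  rw [nhdsWithin_eq_nhds.2 hn] at hm
  have := (intervalIntegral.integral_hasDerivAt_right hI hm (hc.continuousAt hn)).add_const
    (coef ∅ (z a) k)
  refine this.congr_of_eventuallyEq ?_
  filter_upwards [Ioo_mem_nhds ht.1 ht.2] with s hs
  rw [← hz.coef_sub_eq k h0 hs.1.le (hs.2.trans hT), sub_add_cancel]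

lemma WeakEquation.coef_sq_sub_eq (hz : WeakEquation D h W T u v z) (k : Fin d → ℕ)
    (h0 : 0 ≤ a) (hab : a ≤ b) (hT : b < T)
    (hc : ContinuousOn (fun t => modeRate D h W (u t) (v t) (z t) k) (Icc a b)) :
    ContinuousOn (fun t => coef ∅ (z t) k) (Icc a b) ∧
    coef ∅ (z b) k ^ 2 - coef ∅ (z a) k ^ 2 =
      ∫ τ in a..b, 2 * (coef ∅ (z τ) k * modeRate D h W (u τ) (v τ) (z τ) k) := by
  have hI : IntervalIntegrable (fun t => modeRate D h W (u t) (v t) (z t) k) volume a b :=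
    (hc.mono (by rw [uIcc_of_le hab])).intervalIntegrable
  have hca : ContinuousOn (fun t => coef ∅ (z t) k) (Icc a b) := by
    have := (intervalIntegral.continuousOn_primitive_interval' hI left_mem_uIcc).add_const
      (coef ∅ (z a) k)
    rw [uIcc_of_le hab] at this
    refine this.congr fun t ht => ?_
    simp only
    rw [← hz.coef_sub_eq k h0 ht.1 (ht.2.trans_lt hT), sub_add_cancel]
  refine ⟨hca, Eq.symm (intervalIntegral.integral_eq_sub_of_hasDerivAt_of_le
    (f := fun t => coef ∅ (z t) k ^ 2) hab (hca.pow 2) (fun t ht => ?_) ?_)⟩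
  · have := (hz.hasDerivAt_coef k h0 hT hc ht).pow 2
    exact this.congr_deriv (by ring)
  · refine ContinuousOn.intervalIntegrable ?_
    rw [uIcc_of_le hab]
    exact (hca.mul hc).const_mul 2

end

section

/-! ### The energy identity -/

/-- The rate of change of `secondSq (z t)` for a solution of
`∂z/∂t = ∇·(D(w + W) ∇z) + h(w + W)`, as a sum over the modes. The series converges absolutely if
`u` and `v` are in `H³` (`hasSum_secondRate`). -/
def secondRate (D h : Plane → ℝ) (W : Plane) (u v z : Pt d → ℝ) : ℝ :=
  ∑' k, freqQuad k * (2 * (coef ∅ z k * modeRate D h W u v z k))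

lemma abs_derivU_le {h : Plane → ℝ} {W : Plane} {M : ℝ} (hM : ‖fderiv ℝ h W‖ ≤ M) :
    |derivU h W| ≤ M := by
  have := ContinuousLinearMap.le_of_opNorm_le _ hM (EuclideanSpace.single (0 : Fin 2) (1 : ℝ))
  simpa [derivU] using this

lemma abs_derivV_le {h : Plane → ℝ} {W : Plane} {M : ℝ} (hM : ‖fderiv ℝ h W‖ ≤ M) :
    |derivV h W| ≤ M := by
  have := ContinuousLinearMap.le_of_opNorm_le _ hM (EuclideanSpace.single (1 : Fin 2) (1 : ℝ))
  simpa [derivV] using this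

section Static

variable {D h : Plane → ℝ} {W : Plane} {η M : ℝ} {u v z : Pt d → ℝ}

lemma sum_freqSq_pow_le {f : Pt d → ℝ} (h : InH 3 f) (hN : Neumann f) (L : Finset (Fin d → ℕ)) :
    ∑ k ∈ L, freqSq k ^ 3 * coef ∅ f k ^ 2 ≤ thirdSq f :=
  sum_le_hasSum L (fun k _ => mul_nonneg (pow_nonneg (freqSq_nonneg k) 3) (sq_nonneg _))
    (hasSum_thirdSq h hN)

lemma h2Norm_le_two_mul (hη : 0 ≤ η) (hX : 4 / 5 * (h2Sq u + h2Sq v) ≤ η ^ 2) :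
    h2Norm u v ≤ 2 * η :=
  Real.sqrt_le_iff.2 ⟨by positivity, by nlinarith⟩

lemma sum_abs_rate_le (h1 : 1 ≤ d) (h3 : d ≤ 3) (hη : 0 ≤ η)
    (hD : C2BoundOn D W η M) (hh : C2BoundOn h W η M) (h0 : h W = 0) (hu : InH 3 u) (hv : InH 3 v)
    (nu : Neumann u) (nv : Neumann v) (hX : 4 / 5 * (h2Sq u + h2Sq v) ≤ η ^ 2)
    (hz : z = u ∨ z = v) (L : Finset (Fin d → ℕ)) :
    ∑ k ∈ L, |freqQuad k * (2 * (coef ∅ z k * modeRate D h W u v z k))| ≤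
      (5 * M + 1400 * M * ((1 + 2 * η) * (2 * η))) * (thirdSq u + thirdSq v) := by
  have hM := hD.nonneg hη
  have hz3 : InH 3 z := by rcases hz with rfl | rfl <;> assumption
  have nz : Neumann z := by rcases hz with rfl | rfl <;> assumption
  have hzX : thirdSq z ≤ thirdSq u + thirdSq v := by
    rcases hz with e | e <;> rw [e] <;> linarith [thirdSq_nonneg u, thirdSq_nonneg v]
  have hw := inDisc_of_h2Sq_le h1 h3 hu.of_succ hv.of_succ nu nv hX
  have hDW := hD.abs_le W (Metric.mem_closedBall_self hη)
  have hdh := hh.norm_fderiv_le W (Metric.mem_closedBall_self hη)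
  have hfu := abs_derivU_le hdh
  have hfv := abs_derivV_le hdh
  have key : ∀ k ∈ L, |freqQuad k * (2 * (coef ∅ z k * modeRate D h W u v z k))| ≤
      4 * M * (freqSq k ^ 3 * coef ∅ z k ^ 2) + M * (freqSq k ^ 3 * coef ∅ u k ^ 2) +
        M * (freqSq k ^ 3 * coef ∅ v k ^ 2) +
        2 * (freqQuad k * (|coef ∅ z k| * |modeRemainder D h W u v z k|)) := by
    intro k _
    rw [modeRate_eq hη hD hh h0 hu.memLp hv.memLp hz3.of_succ.of_succ hw]
    have hs := freqSq_nonneg k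
    have hΛ := freqQuad_nonneg k
    have hΛ2 : freqQuad k ≤ freqSq k ^ 3 :=
      (freqQuad_le k).trans (freqSq_pow_le k (by norm_num) (by norm_num))
    have hΛ3 : freqQuad k * freqSq k ≤ freqSq k ^ 3 := by
      calc _ ≤ freqSq k ^ 2 * freqSq k := by gcongr; exact freqQuad_le k
        _ = _ := by ring
    set s := freqSq k
    set Λ := freqQuad k
    set a := coef ∅ z k
    set p := coef ∅ u k
    set q := coef ∅ v k
    set ρ := modeRemainder D h W u v z k
    rw [abs_mul, abs_mul, abs_mul, abs_of_nonneg hΛ, abs_two]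
    have e1 : |-(D W * s * a) + (derivU h W * p + derivV h W * q) + ρ| ≤
        M * s * |a| + (M * |p| + M * |q|) + |ρ| := by
      refine (abs_add_le _ _).trans (add_le_add_left ((abs_add_le _ _).trans
        (add_le_add ?_ ((abs_add_le _ _).trans ?_))) _)
      · rw [abs_neg, abs_mul, abs_mul, abs_of_nonneg hs]; gcongr
      · rw [abs_mul, abs_mul]; gcongr
    have e2 : |a| * |p| ≤ (a ^ 2 + p ^ 2) / 2 := by
      nlinarith [sq_nonneg (|a| - |p|), sq_abs a, sq_abs p]
    have e3 : |a| * |q| ≤ (a ^ 2 + q ^ 2) / 2 := by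
      nlinarith [sq_nonneg (|a| - |q|), sq_abs a, sq_abs q]
    calc Λ * (2 * (|a| * |-(D W * s * a) + (derivU h W * p + derivV h W * q) + ρ|))
        ≤ Λ * (2 * (|a| * (M * s * |a| + (M * |p| + M * |q|) + |ρ|))) := by gcongr
      _ = 2 * M * (Λ * s * a ^ 2) + 2 * M * (Λ * (|a| * |p|)) + 2 * M * (Λ * (|a| * |q|)) +
          2 * (Λ * (|a| * |ρ|)) := by rw [← sq_abs a]; ring
      _ ≤ 2 * M * (s ^ 3 * a ^ 2) + 2 * M * (s ^ 3 * ((a ^ 2 + p ^ 2) / 2)) +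
          2 * M * (s ^ 3 * ((a ^ 2 + q ^ 2) / 2)) + 2 * (Λ * (|a| * |ρ|)) := by gcongr
      _ = _ := by ring
  refine (Finset.sum_le_sum key).trans ?_
  simp only [Finset.sum_add_distrib, ← Finset.mul_sum]
  have r := sum_freqQuad_mul_abs_remainder_le h1 h3 hη hD hh hu hv nu nv hX hz L
  have b1 := sum_freqSq_pow_le hz3 nz L
  have b2 := sum_freqSq_pow_le hu nu L
  have b3 := sum_freqSq_pow_le hv nv L
  have hN := h2Norm_le_two_mul hη hX
  have hN0 : 0 ≤ h2Norm u v := Real.sqrt_nonneg _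
  have hX3 : 0 ≤ thirdSq u + thirdSq v := add_nonneg (thirdSq_nonneg u) (thirdSq_nonneg v)
  have r' : 700 * M * ((1 + h2Norm u v) * h2Norm u v * (thirdSq u + thirdSq v)) ≤
      700 * M * ((1 + 2 * η) * (2 * η) * (thirdSq u + thirdSq v)) := by gcongr
  have c1 := mul_le_mul_of_nonneg_left (b1.trans hzX) (by positivity : 0 ≤ 4 * M)
  have c2 := mul_le_mul_of_nonneg_left b2 hM
  have c3 := mul_le_mul_of_nonneg_left b3 hM
  linarith

lemma hasSum_secondRate (h1 : 1 ≤ d) (h3 : d ≤ 3) (hη : 0 ≤ η)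
    (hD : C2BoundOn D W η M) (hh : C2BoundOn h W η M) (h0 : h W = 0) (hu : InH 3 u) (hv : InH 3 v)
    (nu : Neumann u) (nv : Neumann v) (hX : 4 / 5 * (h2Sq u + h2Sq v) ≤ η ^ 2)
    (hz : z = u ∨ z = v) :
    HasSum (fun k => freqQuad k * (2 * (coef ∅ z k * modeRate D h W u v z k)))
      (secondRate D h W u v z) :=
  (Summable.of_abs (summable_of_sum_le (fun _ => abs_nonneg _)
    (sum_abs_rate_le h1 h3 hη hD hh h0 hu hv nu nv hX hz))).hasSum

end Static

variable {D h : Plane → ℝ} {W : Plane} {η M a b T : ℝ} {u v z : ℝ → Pt d → ℝ}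

lemma IsRegular.ae_inH3 (hz : IsRegular T z) (h0 : 0 ≤ a) (hT : b < T) :
    ∀ᵐ t ∂(volume.restrict (Ioc a b)), InH 3 (z t) :=
  ae_restrict_of_ae_restrict_of_subset
    (show Ioc a b ⊆ Ioo 0 T from fun _ ht => ⟨h0.trans_lt ht.1, ht.2.trans_lt hT⟩) hz.inH3

lemma IsRegular.integrableOn_thirdSq (hz : IsRegular T z) (h0 : 0 ≤ a) (hab : a ≤ b) (hT : b < T) :
    IntegrableOn (fun t => thirdSq (z t)) (Ioc a b) :=
  (hz.integrable ((b + T) / 2) ⟨by linarith, by linarith⟩).mono_set fun t ht =>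
    ⟨h0.trans_lt ht.1, by linarith [ht.2]⟩

/-- The energy identity of one component. The partial sums over the modes are differentiable in
time, and their derivatives are dominated by a multiple of `‖∇³w‖²`. -/
theorem secondSq_sub_eq (h1 : 1 ≤ d) (h3 : d ≤ 3) (hη : 0 ≤ η)
    (hD : C2BoundOn D W η M) (hh : C2BoundOn h W η M) (h0 : h W = 0)
    (hu : IsRegular T u) (hv : IsRegular T v) (hz : z = u ∨ z = v)
    (he : WeakEquation D h W T u v z) (ha : 0 ≤ a) (hab : a ≤ b) (hT : b < T)
    (hs : SmallOn η u v (Icc a b)) :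
    IntervalIntegrable (fun τ => secondRate D h W (u τ) (v τ) (z τ)) volume a b ∧
    secondSq (z b) - secondSq (z a) = ∫ τ in a..b, secondRate D h W (u τ) (v τ) (z τ) := by
  have hzr : IsRegular T z := by rcases hz with rfl | rfl <;> assumption
  have hI : Icc a b ⊆ Ico 0 T := fun t ht => ⟨ha.trans ht.1, ht.2.trans_lt hT⟩
  have hc : ∀ k, ContinuousOn (fun t => modeRate D h W (u t) (v t) (z t) k) (Icc a b) :=
    continuousOn_modeRate h1 h3 hη hD hh hu hv hzr hI hs
  set C := 5 * M + 1400 * M * ((1 + 2 * η) * (2 * η)) with hC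
  set F : (Fin d → ℕ) → ℝ → ℝ := fun k τ =>
    freqQuad k * (2 * (coef ∅ (z τ) k * modeRate D h W (u τ) (v τ) (z τ) k)) with hF
  have hFc : ∀ k, ContinuousOn (F k) (Icc a b) := fun k =>
    (((he.coef_sq_sub_eq k ha hab hT (hc k)).1.mul (hc k)).const_mul 2).const_mul (freqQuad k)
  have hFi : ∀ k, IntervalIntegrable (F k) volume a b := fun k =>
    ContinuousOn.intervalIntegrable (by rw [uIcc_of_le hab]; exact hFc k)
  have hbi : IntegrableOn (fun τ => C * (thirdSq (u τ) + thirdSq (v τ))) (Ioc a b) :=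
    ((hu.integrableOn_thirdSq ha hab hT).add (hv.integrableOn_thirdSq ha hab hT)).const_mul C
  have hgood : ∀ᵐ τ ∂(volume.restrict (Ioc a b)), (∀ L : Finset (Fin d → ℕ),
      ∑ k ∈ L, |F k τ| ≤ C * (thirdSq (u τ) + thirdSq (v τ))) ∧
      HasSum (fun k => F k τ) (secondRate D h W (u τ) (v τ) (z τ)) := by
    filter_upwards [hu.ae_inH3 ha hT, hv.ae_inH3 ha hT, ae_restrict_mem measurableSet_Ioc]
      with τ u3 v3 hτ
    have hτ' := Ioc_subset_Icc_self hτ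
    have hzτ : z τ = u τ ∨ z τ = v τ := hz.imp (congrFun · τ) (congrFun · τ)
    exact ⟨sum_abs_rate_le h1 h3 hη hD hh h0 u3 v3 (hu.neumann τ (hI hτ')) (hv.neumann τ (hI hτ'))
      (hs τ hτ') hzτ, hasSum_secondRate h1 h3 hη hD hh h0 u3 v3 (hu.neumann τ (hI hτ'))
      (hv.neumann τ (hI hτ')) (hs τ hτ') hzτ⟩
  have hm : ∀ L : Finset (Fin d → ℕ),
      AEStronglyMeasurable (fun τ => ∑ k ∈ L, F k τ) (volume.restrict (Ioc a b)) := fun L =>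
    ((continuousOn_finsetSum L fun k _ => hFc k).mono Ioc_subset_Icc_self).aestronglyMeasurable
      measurableSet_Ioc
  have hlim : ∀ᵐ τ ∂(volume.restrict (Ioc a b)), Tendsto (fun L => ∑ k ∈ L, F k τ) atTop
      (𝓝 (secondRate D h W (u τ) (v τ) (z τ))) := hgood.mono fun τ h => h.2
  have hbound : ∀ L : Finset (Fin d → ℕ), ∀ᵐ τ ∂(volume.restrict (Ioc a b)),
      ‖∑ k ∈ L, F k τ‖ ≤ C * (thirdSq (u τ) + thirdSq (v τ)) := fun L =>
    hgood.mono fun τ h => (Finset.abs_sum_le_sum_abs _ _).trans (h.1 L)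
  constructor
  · rw [intervalIntegrable_iff_integrableOn_Ioc_of_le hab]
    refine Integrable.mono' hbi (aestronglyMeasurable_of_tendsto_ae atTop hm hlim) ?_
    filter_upwards [hgood] with τ hτ
    exact le_of_tendsto hτ.2.norm
      (Eventually.of_forall fun L => (Finset.abs_sum_le_sum_abs _ _).trans (hτ.1 L))
  · have l1 : Tendsto (fun L : Finset (Fin d → ℕ) => ∫ τ in a..b, ∑ k ∈ L, F k τ) atTop
        (𝓝 (∫ τ in a..b, secondRate D h W (u τ) (v τ) (z τ))) := by
      simp_rw [intervalIntegral.integral_of_le hab]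
      exact tendsto_integral_filter_of_dominated_convergence _ (Eventually.of_forall hm)
        (Eventually.of_forall hbound) hbi hlim
    have l2 := (hasSum_secondSq (hzr.inH2 b (hI (right_mem_Icc.2 hab)))
      (hzr.neumann b (hI (right_mem_Icc.2 hab)))).sub
      (hasSum_secondSq (hzr.inH2 a (hI (left_mem_Icc.2 hab)))
      (hzr.neumann a (hI (left_mem_Icc.2 hab))))
    refine tendsto_nhds_unique l2 (l1.congr fun L => ?_)
    rw [intervalIntegral.integral_finsetSum fun k _ => hFi k]
    refine Finset.sum_congr rfl fun k _ => ?_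
    rw [hF, intervalIntegral.integral_const_mul,
      ← (he.coef_sq_sub_eq k ha hab hT (hc k)).2, mul_sub]

end

section

/-! ### The constant `C_η` -/

lemma continuousOn_c2At {h : Plane → ℝ} {W : Plane} {η : ℝ}
    (hh : ∀ z ∈ Metric.closedBall W η, ContDiffAt ℝ 2 h z) :
    ContinuousOn (fun w => c2At h (W + w)) (Metric.closedBall 0 η) := by
  refine continuousOn_finsetSum _ fun k hk w hw => ContinuousAt.continuousWithinAt ?_
  have hz : W + w ∈ Metric.closedBall W η := by simpa using hw
  have hk2 : ((k : ℕ) : WithTop ℕ∞) ≤ 2 := by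
    have : k ≤ 2 := by have := Finset.mem_range.1 hk; omega
    exact_mod_cast this
  have h1 := ((hh _ hz).continuousAt_iteratedFDeriv hk2).norm
  exact h1.comp (f := fun w => W + w) (by fun_prop)

lemma c2BoundOn_of_c2At_le {h : Plane → ℝ} {W : Plane} {η M : ℝ}
    (hh : ∀ z ∈ Metric.closedBall W η, ContDiffAt ℝ 2 h z)
    (hM : ∀ z ∈ Metric.closedBall W η, c2At h z ≤ M) : C2BoundOn h W η M := by
  have key : ∀ z ∈ Metric.closedBall W η, ‖iteratedFDeriv ℝ 0 h z‖ + ‖iteratedFDeriv ℝ 1 h z‖ +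
      ‖iteratedFDeriv ℝ 2 h z‖ ≤ M := fun z hz => by
    have := hM z hz
    simpa only [c2At, Finset.sum_range_succ, Finset.sum_range_zero, zero_add] using this
  refine ⟨hh, fun z hz => ?_, fun z hz => ?_, fun z hz => ?_⟩ <;>
  · have := key z hz
    have e0 : ‖iteratedFDeriv ℝ 0 h z‖ = |h z| := norm_iteratedFDeriv_zero
    have e1 : ‖iteratedFDeriv ℝ 1 h z‖ = ‖fderiv ℝ h z‖ := norm_iteratedFDeriv_one h
    have e2 : ‖iteratedFDeriv ℝ 2 h z‖ = ‖fderiv ℝ (fderiv ℝ h) z‖ := by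
      rw [← norm_iteratedFDeriv_one, norm_iteratedFDeriv_fderiv]
    linarith [norm_nonneg (iteratedFDeriv ℝ 0 h z),
      norm_nonneg (iteratedFDeriv ℝ 1 h z), norm_nonneg (iteratedFDeriv ℝ 2 h z)]

lemma c2At_nonneg (h : Plane → ℝ) (z : Plane) : 0 ≤ c2At h z :=
  Finset.sum_nonneg fun _ _ => norm_nonneg _

lemma c2BoundOn_cEta {D₁ D₂ f g : Plane → ℝ} {W : Plane} {η : ℝ}
    (hs : ∀ h ∈ ({D₁, D₂, f, g} : Set (Plane → ℝ)),
      ∀ z ∈ Metric.closedBall W η, ContDiffAt ℝ 2 h z) :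
    C2BoundOn D₁ W η (cEta D₁ D₂ f g W η) ∧ C2BoundOn D₂ W η (cEta D₁ D₂ f g W η) ∧
      C2BoundOn f W η (cEta D₁ D₂ f g W η) ∧ C2BoundOn g W η (cEta D₁ D₂ f g W η) := by
  have s1 := hs D₁ (by simp)
  have s2 := hs D₂ (by simp)
  have s3 := hs f (by simp)
  have s4 := hs g (by simp)
  have hc := (((continuousOn_c2At s1).add (continuousOn_c2At s2)).add (continuousOn_c2At s3)).add
    (continuousOn_c2At s4)
  have hb := (isCompact_closedBall (0 : Plane) η).bddAbove_image hc
  have key : ∀ z ∈ Metric.closedBall W η, c2At D₁ z + c2At D₂ z + c2At f z + c2At g z ≤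
      cEta D₁ D₂ f g W η := fun z hz =>
    le_csSup hb ⟨z - W, by simpa [dist_eq_norm] using hz, by simp⟩
  refine ⟨c2BoundOn_of_c2At_le s1 fun z hz => ?_, c2BoundOn_of_c2At_le s2 fun z hz => ?_,
    c2BoundOn_of_c2At_le s3 fun z hz => ?_, c2BoundOn_of_c2At_le s4 fun z hz => ?_⟩ <;>
  linarith [key z hz, c2At_nonneg D₁ z, c2At_nonneg D₂ z, c2At_nonneg f z, c2At_nonneg g z]

/-! ### The differential inequality -/

/-- The destabilizing term is absorbed by half of the diffusion at high frequencies and costs a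
fixed amount at the others. -/
lemma mul_le_half_diffusion {A D s Λ : ℝ} (hD : 0 < D) (hA : 0 ≤ A) (hs : 0 ≤ s) (hΛ : 0 ≤ Λ)
    (h : Λ ≤ s ^ 2) : A * Λ ≤ D / 2 * (s * Λ) + A ^ 3 / D ^ 2 := by
  have hA3 : 0 ≤ A ^ 3 / D ^ 2 := by positivity
  rcases le_total A (D * s / 2) with hc | hc
  · nlinarith [mul_le_mul_of_nonneg_right hc hΛ]
  · have h1 : (A - D * s / 2) * Λ ≤ (A - D * s / 2) * s ^ 2 :=
      mul_le_mul_of_nonneg_left h (by linarith)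
    have h2 : (A - D * s / 2) * s ^ 2 ≤ A ^ 3 / D ^ 2 := by
      rw [le_div_iff₀ (by positivity)]
      -- with `y = D s` this is `A y² - y³ / 2 ≤ A³`, whose left side is largest at `y = 4A/3`
      have hy : 0 ≤ D * s := by positivity
      have hp : 0 ≤ (D * s - 4 * A / 3) ^ 2 * (D * s + 2 * A / 3) := by positivity
      have hA' : 0 ≤ A ^ 3 := by positivity
      nlinarith
    nlinarith

/-- The linear part of the system for one mode, after Young's inequality for the cross term. -/
lemma reaction_mode_le {fu q gv D₁ D₂ s Λ a b ρ₁ ρ₂ : ℝ} (hD : 0 < D₁) (hfu : 0 < fu) (hgv : gv < 0)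
    (hs : 0 ≤ s) (hΛ : 0 ≤ Λ) (h : Λ ≤ s ^ 2) :
    Λ * (a * (-(D₁ * s * a) + fu * a + ρ₁) + b * (-(D₂ * s * b) + gv * b + ρ₂) + q * (a * b)) ≤
      -(D₁ / 2 * (s * Λ * a ^ 2)) - D₂ * (s * Λ * b ^ 2) - |gv| / 2 * (Λ * b ^ 2) +
        (q ^ 2 / (2 * |gv|) + fu) ^ 3 / D₁ ^ 2 * a ^ 2 + (Λ * (|a| * |ρ₁|) + Λ * (|b| * |ρ₂|)) := by
  have hg : 0 < |gv| := abs_pos.2 hgv.ne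
  have hA : 0 ≤ q ^ 2 / (2 * |gv|) + fu := by positivity
  have m := mul_le_mul_of_nonneg_right (mul_le_half_diffusion hD hA hs hΛ h) (sq_nonneg a)
  have y : q * (a * b) ≤ q ^ 2 / (2 * |gv|) * a ^ 2 + |gv| / 2 * b ^ 2 := by
    have e : q ^ 2 / (2 * |gv|) * a ^ 2 + |gv| / 2 * b ^ 2 - q * (a * b) =
        (q * a - |gv| * b) ^ 2 / (2 * |gv|) := by field_simp; ring
    have : 0 ≤ (q * a - |gv| * b) ^ 2 / (2 * |gv|) := by positivity
    linarith
  have y' := mul_le_mul_of_nonneg_left y hΛ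
  have r1 : Λ * (a * ρ₁) ≤ Λ * (|a| * |ρ₁|) := by
    rw [← abs_mul]; exact mul_le_mul_of_nonneg_left (le_abs_self _) hΛ
  have r2 : Λ * (b * ρ₂) ≤ Λ * (|b| * |ρ₂|) := by
    rw [← abs_mul]; exact mul_le_mul_of_nonneg_left (le_abs_self _) hΛ
  have hgv' : gv = -|gv| := by rw [abs_of_neg hgv]; ring
  have e3 : Λ * (gv * b ^ 2) = -(|gv| * (Λ * b ^ 2)) := by
    linear_combination Λ * b ^ 2 * hgv'
  linarith

lemma secondRate_add_le {D₁ D₂ f g : Plane → ℝ} {W : Plane} {η M : ℝ} {u v : Pt d → ℝ}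
    (h1 : 1 ≤ d) (h3 : d ≤ 3) (hη : 0 ≤ η)
    (cD₁ : C2BoundOn D₁ W η M) (cD₂ : C2BoundOn D₂ W η M) (cf : C2BoundOn f W η M)
    (cg : C2BoundOn g W η M) (hf : f W = 0) (hg : g W = 0) (hD₁ : 0 < D₁ W)
    (hfu : 0 < derivU f W) (hgv : derivV g W < 0) (hu : InH 3 u) (hv : InH 3 v)
    (nu : Neumann u) (nv : Neumann v) (hX : 4 / 5 * (h2Sq u + h2Sq v) ≤ η ^ 2) :
    (1 / 2) * (secondRate D₁ f W u v u + secondRate D₂ g W u v v) ≤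
      -(D₁ W / 2 * gradSecondSq u) - D₂ W * gradSecondSq v - |derivV g W| / 2 * secondSq v +
        cTwo D₁ f g W * l2Sq u +
        1400 * M * ((1 + h2Norm u v) * h2Norm u v * (thirdSq u + thirdSq v)) := by
  have l1 := ((hasSum_secondRate h1 h3 hη cD₁ cf hf hu hv nu nv hX (Or.inl rfl)).add
    (hasSum_secondRate h1 h3 hη cD₂ cg hg hu hv nu nv hX (Or.inr rfl))).mul_left (1 / 2)
  have l2 := ((((hasSum_gradSecondSq hu nu).mul_left (D₁ W / 2)).neg.sub
    ((hasSum_gradSecondSq hv nv).mul_left (D₂ W))).sub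
    ((hasSum_secondSq hv.of_succ nv).mul_left (|derivV g W| / 2))).add
    ((hasSum_l2Sq hu.memLp).mul_left (cTwo D₁ f g W))
  have hw := inDisc_of_h2Sq_le h1 h3 hu.of_succ hv.of_succ nu nv hX
  refine le_of_tendsto_of_tendsto' l1 (l2.add_const _) fun L => ?_
  have r1 := sum_freqQuad_mul_abs_remainder_le h1 h3 hη cD₁ cf hu hv nu nv hX (Or.inl rfl) L
  have r2 := sum_freqQuad_mul_abs_remainder_le h1 h3 hη cD₂ cg hu hv nu nv hX (Or.inr rfl) L
  have key := Finset.sum_le_sum fun k (_ : k ∈ L) =>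
    reaction_mode_le (fu := derivU f W) (q := derivV f W + derivU g W) (gv := derivV g W)
      (D₂ := D₂ W) (a := coef ∅ u k) (b := coef ∅ v k) (ρ₁ := modeRemainder D₁ f W u v u k)
      (ρ₂ := modeRemainder D₂ g W u v v k) hD₁ hfu hgv (freqSq_nonneg k) (freqQuad_nonneg k)
      (freqQuad_le k)
  rw [Finset.sum_add_distrib, Finset.sum_add_distrib] at key
  have e : ∀ k, 1 / 2 * (freqQuad k * (2 * (coef ∅ u k * modeRate D₁ f W u v u k)) +
      freqQuad k * (2 * (coef ∅ v k * modeRate D₂ g W u v v k))) =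
      freqQuad k * (coef ∅ u k * (-(D₁ W * freqSq k * coef ∅ u k) + derivU f W * coef ∅ u k +
        modeRemainder D₁ f W u v u k) + coef ∅ v k * (-(D₂ W * freqSq k * coef ∅ v k) +
        derivV g W * coef ∅ v k + modeRemainder D₂ g W u v v k) +
        (derivV f W + derivU g W) * (coef ∅ u k * coef ∅ v k)) := fun k => by
    rw [modeRate_eq hη cD₁ cf hf hu.memLp hv.memLp hu.of_succ.of_succ hw,
      modeRate_eq hη cD₂ cg hg hu.memLp hv.memLp hv.of_succ.of_succ hw]
    ring
  simp only [e]
  rw [cTwo]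
  rw [Finset.sum_add_distrib] at key
  rw [Finset.sum_add_distrib]
  linarith

/-! ### The energy of a solution -/

variable {D₁ D₂ f g : Plane → ℝ} {W : Plane} {η M a b T : ℝ} {u v : ℝ → Pt d → ℝ}

/-- The rate of change of the energy of a solution. -/
def energyRate (D₁ D₂ f g : Plane → ℝ) (W : Plane) (u v : ℝ → Pt d → ℝ) (t : ℝ) : ℝ :=
  secondRate D₁ f W (u t) (v t) (u t) + secondRate D₂ g W (u t) (v t) (v t)

lemma SmallOn.mono {I J : Set ℝ} (h : SmallOn η u v J) (hIJ : I ⊆ J) : SmallOn η u v I :=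
  fun t ht => h t (hIJ ht)

lemma IsSolution.energy_eq (hsol : IsSolution D₁ D₂ f g W T u v) (h1 : 1 ≤ d) (h3 : d ≤ 3)
    (hη : 0 ≤ η) (cD₁ : C2BoundOn D₁ W η M) (cD₂ : C2BoundOn D₂ W η M) (cf : C2BoundOn f W η M)
    (cg : C2BoundOn g W η M) (hf : f W = 0) (hg : g W = 0) (ha : 0 ≤ a) (hab : a ≤ b)
    (hT : b < T) (hs : SmallOn η u v (Icc a b)) :
    IntervalIntegrable (energyRate D₁ D₂ f g W u v) volume a b ∧ ∀ t ∈ Icc a b,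
      energy u v t = (∫ τ in a..t, energyRate D₁ D₂ f g W u v τ) + energy u v a := by
  have key : ∀ t ∈ Icc a b, IntervalIntegrable (energyRate D₁ D₂ f g W u v) volume a t ∧
      energy u v t = (∫ τ in a..t, energyRate D₁ D₂ f g W u v τ) + energy u v a := by
    intro t ht
    have hs' := hs.mono (Icc_subset_Icc_right ht.2)
    have eu := secondSq_sub_eq h1 h3 hη cD₁ cf hf hsol.regular_u hsol.regular_v (Or.inl rfl)
      hsol.equation_u ha ht.1 (ht.2.trans_lt hT) hs'
    have ev := secondSq_sub_eq h1 h3 hη cD₂ cg hg hsol.regular_u hsol.regular_v (Or.inr rfl)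
      hsol.equation_v ha ht.1 (ht.2.trans_lt hT) hs'
    refine ⟨eu.1.add ev.1, ?_⟩
    have e : ∫ τ in a..t, energyRate D₁ D₂ f g W u v τ = _ :=
      intervalIntegral.integral_add eu.1 ev.1
    rw [e, ← eu.2, ← ev.2, energy, energy]
    ring
  exact ⟨(key b (right_mem_Icc.2 hab)).1, fun t ht => (key t ht).2⟩

lemma IsSolution.ae_hasDerivAt_energy (hsol : IsSolution D₁ D₂ f g W T u v) (h1 : 1 ≤ d)
    (h3 : d ≤ 3) (hη : 0 < η) (cD₁ : C2BoundOn D₁ W η M) (cD₂ : C2BoundOn D₂ W η M)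
    (cf : C2BoundOn f W η M) (cg : C2BoundOn g W η M) (hf : f W = 0) (hg : g W = 0) :
    ∀ᵐ t ∂(volume.restrict (Ioo 0 T)), h2Norm (u t) (v t) ≤ η →
      HasDerivAt (energy u v) (energyRate D₁ D₂ f g W u v t) t := by
  -- near a time with `‖w‖_{H²} ≤ η` the energy is the integral of `energyRate`
  rw [ae_restrict_iff' measurableSet_Ioo, ae_iff]
  refine measure_null_of_locally_null _ fun s hs => ?_
  push Not at hs
  obtain ⟨hsT, hsη, -⟩ := hs
  have hev : ∀ᶠ t in 𝓝 s, t ∈ Ioo 0 T ∧ 4 / 5 * (h2Sq (u t) + h2Sq (v t)) ≤ η ^ 2 := by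
    have := hsol.regular_u.eventually_h2Sq_le hsol.regular_v hη (Ioo_subset_Ico_self hsT) hsη
    rw [nhdsWithin_eq_nhds.2 (Ico_mem_nhds hsT.1 hsT.2)] at this
    exact Eventually.and (Ioo_mem_nhds hsT.1 hsT.2) this
  obtain ⟨δ, hδ, hball⟩ := Metric.eventually_nhds_iff_ball.1 hev
  have hI : ∀ t ∈ Icc (s - δ / 2) (s + δ / 2),
      t ∈ Ioo 0 T ∧ 4 / 5 * (h2Sq (u t) + h2Sq (v t)) ≤ η ^ 2 := fun t ht => hball t (by
    rw [Metric.mem_ball, Real.dist_eq, abs_lt]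
    constructor <;> linarith [ht.1, ht.2])
  have hab : s - δ / 2 ≤ s + δ / 2 := by linarith
  obtain ⟨hi, he⟩ := hsol.energy_eq h1 h3 hη.le cD₁ cD₂ cf cg hf hg
    (hI _ (left_mem_Icc.2 hab)).1.1.le hab (hI _ (right_mem_Icc.2 hab)).1.2 fun t ht => (hI t ht).2
  refine ⟨_, inter_mem_nhdsWithin _ (Ioo_mem_nhds (a := s - δ / 2) (b := s + δ / 2) (by linarith)
    (by linarith)), measure_mono_null ?_ (ae_iff.1 hi.ae_hasDerivAt_integral)⟩
  rintro t ⟨ht, htI⟩ hcon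
  refine ht fun _ _ => ?_
  rw [uIcc_of_le hab] at hcon
  refine ((hcon (Ioo_subset_Icc_self htI) _ (left_mem_Icc.2 hab)).add_const
    (energy u v (s - δ / 2))).congr_of_eventuallyEq ?_
  filter_upwards [Ioo_mem_nhds htI.1 htI.2] with r hr
  exact he r (Ioo_subset_Icc_self hr)

lemma IsSolution.absolutelyContinuousOnInterval_energy (hsol : IsSolution D₁ D₂ f g W T u v)
    (h1 : 1 ≤ d) (h3 : d ≤ 3) (hη : 0 ≤ η) (cD₁ : C2BoundOn D₁ W η M) (cD₂ : C2BoundOn D₂ W η M)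
    (cf : C2BoundOn f W η M) (cg : C2BoundOn g W η M) (hf : f W = 0) (hg : g W = 0) (ha : 0 ≤ a)
    (hab : a ≤ b) (hT : b < T) (hs : SmallOn η u v (Icc a b)) :
    AbsolutelyContinuousOnInterval (energy u v) a b := by
  obtain ⟨hi, he⟩ := hsol.energy_eq h1 h3 hη cD₁ cD₂ cf cg hf hg ha hab hT hs
  have hp := hi.absolutelyContinuousOnInterval_intervalIntegral left_mem_uIcc
  rw [absolutelyContinuousOnInterval_iff] at hp ⊢
  intro ε hε
  obtain ⟨δ, hδ, H⟩ := hp ε hε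
  refine ⟨δ, hδ, fun E hE hEδ => ?_⟩
  convert H E hE hEδ using 1
  refine Finset.sum_congr rfl fun i hi' => ?_
  have hm := hE.1 i hi'
  rw [uIcc_of_le hab] at hm
  rw [he _ hm.1, he _ hm.2, dist_add_right]

lemma smallOn_of_h2Norm_le (hη : 0 ≤ η) {I : Set ℝ} (h : ∀ t ∈ I, h2Norm (u t) (v t) ≤ η) :
    SmallOn η u v I := fun t ht => by
  have := (Real.sqrt_le_left hη).1 (h t ht)
  linarith [h2Sq_nonneg (u t), h2Sq_nonneg (v t)]

end

end Turing

end

theorem lemma3 :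
    ∃ C₀ : ℝ, 0 < C₀ ∧
      ∀ (d : ℕ), 1 ≤ d → d ≤ 3 →
      ∀ (D₁ D₂ f g : Turing.Plane → ℝ) (Wbar : Turing.Plane) (η T : ℝ)
        (u v : ℝ → Turing.Pt d → ℝ),
        0 < η →
        (∀ h ∈ ({D₁, D₂, f, g} : Set (Turing.Plane → ℝ)),
          ∀ z ∈ Metric.closedBall Wbar η, ContDiffAt ℝ 2 h z) →
        f Wbar = 0 → g Wbar = 0 →
        0 < D₁ Wbar → 0 < D₂ Wbar →
        0 < Turing.derivU f Wbar → Turing.derivV g Wbar < 0 →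
        Turing.IsSolution D₁ D₂ f g Wbar T u v →
        (∀ a b : ℝ, 0 ≤ a → a ≤ b → b < T →
          (∀ t ∈ Set.Icc a b, Turing.h2Norm (u t) (v t) ≤ η) →
          AbsolutelyContinuousOnInterval (Turing.energy u v) a b) ∧
        ∀ᵐ t ∂(MeasureTheory.volume.restrict (Set.Ioo 0 T)),
          Turing.h2Norm (u t) (v t) ≤ η →
          DifferentiableAt ℝ (Turing.energy u v) t ∧
          (1 / 2) * deriv (Turing.energy u v) t +
              (D₁ Wbar / 2 * Turing.gradSecondSq (u t) +
                D₂ Wbar * Turing.gradSecondSq (v t)) +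
              |Turing.derivV g Wbar| / 2 * Turing.secondSq (v t) ≤
            C₀ * (C₀ * Turing.cEta D₁ D₂ f g Wbar η * (1 + η)) *
                Turing.h2Norm (u t) (v t) *
                (Turing.thirdSq (u t) + Turing.thirdSq (v t)) +
              Turing.cTwo D₁ f g Wbar * Turing.l2Sq (u t) := by
  -- `40 ^ 2` exceeds `2 * 700`, the constant of the remainder estimates of the two components
  refine ⟨40, by norm_num, fun d h1 h3 D₁ D₂ f g Wbar η T u v hη hC hf hg hD₁ _ hfu hgv hsol => ?_⟩
  obtain ⟨cD₁, cD₂, cf, cg⟩ := Turing.c2BoundOn_cEta hC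
  refine ⟨fun a b ha hab hT hs => hsol.absolutelyContinuousOnInterval_energy h1 h3 hη.le cD₁ cD₂
    cf cg hf hg ha hab hT (Turing.smallOn_of_h2Norm_le hη.le hs), ?_⟩
  filter_upwards [hsol.ae_hasDerivAt_energy h1 h3 hη cD₁ cD₂ cf cg hf hg, hsol.regular_u.inH3,
    hsol.regular_v.inH3, ae_restrict_mem measurableSet_Ioo] with t hd u3 v3 ht hN
  have hd := hd hN
  have ht' := Ioo_subset_Ico_self ht
  refine ⟨hd.differentiableAt, ?_⟩
  have key := Turing.secondRate_add_le h1 h3 hη.le cD₁ cD₂ cf cg hf hg hD₁ hfu hgv u3 v3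
    (hsol.regular_u.neumann t ht') (hsol.regular_v.neumann t ht')
    (Turing.smallOn_of_h2Norm_le (I := {t}) hη.le (by simpa using hN) t rfl)
  rw [hd.deriv, Turing.energyRate]
  have hN0 : 0 ≤ Turing.h2Norm (u t) (v t) := Real.sqrt_nonneg _
  have hM := cf.nonneg hη.le
  set M := Turing.cEta D₁ D₂ f g Wbar η
  set N := Turing.h2Norm (u t) (v t)
  have hX3 := add_nonneg (Turing.thirdSq_nonneg (u t)) (Turing.thirdSq_nonneg (v t))
  set X := Turing.thirdSq (u t) + Turing.thirdSq (v t)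
  have hle : 1400 * M * ((1 + N) * N * X) ≤ 40 * (40 * M * (1 + η)) * N * X := by
    calc 1400 * M * ((1 + N) * N * X) ≤ 1600 * M * ((1 + η) * N * X) := by gcongr; norm_num
      _ = _ := by ring
  linarith
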